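/- Let $\Bbbk$ be a field. Let $\mathsf{DCom}$ be the symmetric $2$-coloured operad over $\Bbbk$ (the operad of pairs consisting of a commutative algebra, of the first colour, and a space of its derivations, of the second colour) generated by two binary operations: $\alpha$, with both inputs and the output of the first colour, and $d$, with the first input and the output of the first colour and the second input of the second colour, subject to $$\alpha(1,2)=\alpha(2,1),\qquad \alpha(\alpha(1,2),3)=\alpha(1,\alpha(2,3)),\qquad d(\alpha(1,2),3)=\alpha(1,d(2,3))+\alpha(d(1,3),2).$$ Regarded as a shuffle operad, $\mathsf{DCom}$ is a quotient $\mathcal F_{sh}(\alpha,d,e)/\mathcal M$ of the free shuffle operad with generators $\alpha$, $d$ and $e(1,2)=d(2,1)$, where $\mathcal M$ is the kernel of the canonical (surjective) map. The QM-ordering with $x=\alpha$, $y=d$ (and $y=e$) is the following partial order of shuffle tree monomials with the same inputs $1,\dots,n$, input colours and output colour. To a monomial one associates the vector $(w_1,\dots,w_n)$, where $w_i$ is the product of the variables $x,y$ read off the vertices on the path from the root to the leaf $i$, computed in the quantum algebra $yx=xyq$, $q$ central, and written as $x^ay^bq^c$. One sets $x^{a_1}y^{b_1}q^{c_1}<x^{a_2}y^{b_2}q^{c_2}$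 if $a_1>a_2$, or $a_1=a_2$ and $b_1<b_2$, or $a_1=a_2$, $b_1=b_2$ and $c_1<c_2$, and one compares the vectors lexicographically. 1. The QM-ordering is compatible with shuffle compositions (strict inequalities are preserved in each factor), and there is a set $G$ of quadratic elements (linear combinations of tree monomials with two vertices) which is a Gröbner basis of $\mathcal M$ with respect to the QM-ordering: $G$ generates $\mathcal M$ as a shuffle operadic ideal, and for every total order of the tree monomials that refines the QM-ordering (in particular, for every admissible one) the leading term of each non-zero element of $\mathcal M$ is divisible by the leading term of some element of $G$. 2. There is an isomorphism of coloured symmetric collections $\mathsf{DCom}\cong\mathsf{Com}\circ\mathcal F(d)$, where $\mathcal F(d)$ is the free symmetric $2$-coloured operad generated by $d$, and $\mathsf{Com}$ is the $2$-coloured operad generated by the commutative associative product $\alpha$ of the first colour (so that in the second colour it contains only the identity). 3. All spaces of operations of $\mathsf{DCom}$ are finite-dimensional, and for the generating series $F^i(t_1,t_2)=\sum_{m_1,m_2\ge 0}\frac{\dim \mathsf{DCom}(m_1,m_2;i)}{m_1!\,m_2!}t_1^{m_1}t_2^{m_2}$, where $\mathsf{DCom}(m_1,m_2;i)$ is the space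 of operations with $m_j$ inputs of colour $j$ and the output of colour $i$, $$\bigl(F^1,F^2\bigr)=\Bigl(e^{\frac{t_1}{1-t_2}}-1,\;t_2\Bigr).$$ -/

import Mathlib

open scoped TensorProduct DirectSum

namespace ColOp

universe u

/-! ### Tree monomials -/

/-- A signature of binary generating operations coloured by `I`: each generator has the colours of
its first input, of its second input, and of its output. No symmetry of a generator is assumed;
symmetries are imposed as relations. -/
structure Signature (I : Type) where
  Gen : Type
  in₁ : Gen → I
  in₂ : Gen → I
  out : Gen → I

/-- Planar binary rooted trees, vertices labelled by `G`, leaves labelled by `L`. The tree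
`leaf l` is the degenerate tree (no vertices). -/
inductive BTree (G L : Type) : Type
  | leaf (l : L) : BTree G L
  | node (g : G) (a b : BTree G L) : BTree G L

namespace BTree

variable {G L A I : Type}

/-- The leaf labels, from left to right. -/
def leaves : BTree G L → List L
  | leaf l => [l]
  | node _ a b => a.leaves ++ b.leaves

/-- The number of (inner) vertices. -/
def size : BTree G L → ℕ
  | leaf _ => 0
  | node _ a b => a.size + b.size + 1

/-- Relabelling of the leaves. -/
def map (f : A → L) : BTree G A → BTree G L
  | leaf a => leaf (f a)
  | node g s t => node g (s.map f) (t.map f)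

/-- Grafting: the tree `s a` is grafted on each leaf labelled `a`. -/
def bind (s : A → BTree G L) : BTree G A → BTree G L
  | leaf a => s a
  | node g t t' => node g (t.bind s) (t'.bind s)

/-- `t.HasColour σ χ c`: the tree has output colour `c`, its leaves are coloured by `χ`, and at each
inner edge the colours match. -/
def HasColour (σ : Signature I) (χ : L → I) : BTree σ.Gen L → I → Prop
  | leaf l, c => χ l = c
  | node g a b, c => σ.out g = c ∧ a.HasColour σ χ (σ.in₁ g) ∧ b.HasColour σ χ (σ.in₂ g)

/-- `s.IsSubtree t`: the tree `s` consists of an edge of `t` together with all that grows from it. -/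
def IsSubtree (s : BTree G L) : BTree G L → Prop
  | leaf l => s = leaf l
  | node g a b => s = node g a b ∨ s.IsSubtree a ∨ s.IsSubtree b

/-- The smallest leaf label of `a` is smaller than the smallest leaf label of `b`. -/
def MinLT [LT L] (a b : BTree G L) : Prop :=
  ∃ l ∈ a.leaves, ∀ l' ∈ b.leaves, l < l'

/-- The shuffle condition: at each vertex the smallest descendants of its inputs increase from left
to right. -/
def IsShuffle [LT L] : BTree G L → Prop
  | leaf _ => True
  | node _ a b => a.MinLT b ∧ a.IsShuffle ∧ b.IsShuffle

theorem leaves_map (f : A → L) (t : BTree G A) : (t.map f).leaves = t.leaves.map f := by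
  induction t with
  | leaf a => rfl
  | node g s t hs ht => simp [map, leaves, hs, ht]

theorem map_id' (t : BTree G L) : t.map (fun l => l) = t := by
  induction t with
  | leaf a => rfl
  | node g s t hs ht => simp [map, hs, ht]

theorem map_map {B : Type} (f : A → L) (h : B → A) (t : BTree G B) :
    (t.map h).map f = t.map (fun b => f (h b)) := by
  induction t with
  | leaf a => rfl
  | node g s t hs ht => simp [map, hs, ht]

theorem leaves_bind (s : A → BTree G L) (t : BTree G A) :
    (t.bind s).leaves = t.leaves.flatMap (fun a => (s a).leaves) := by
  induction t with
  | leaf a => simp [bind, leaves]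
  | node g t t' h h' => simp [bind, leaves, h, h']

theorem HasColour.map {σ : Signature I} {ψ : A → I} {χ : L → I} (f : A → L)
    (hf : ∀ a, χ (f a) = ψ a) {t : BTree σ.Gen A} {c : I} (h : t.HasColour σ ψ c) :
    (t.map f).HasColour σ χ c := by
  induction t generalizing c with
  | leaf a => exact (hf a).trans h
  | node g s t hs ht => exact ⟨h.1, hs h.2.1, ht h.2.2⟩

theorem HasColour.bind {σ : Signature I} {ψ : A → I} {χ : L → I} {s : A → BTree σ.Gen L}
    (hs : ∀ a, (s a).HasColour σ χ (ψ a)) {t : BTree σ.Gen A} {c : I}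
    (h : t.HasColour σ ψ c) : (t.bind s).HasColour σ χ c := by
  induction t generalizing c with
  | leaf a => have h : ψ a = c := h; subst h; exact hs a
  | node g s t hs ht => exact ⟨h.1, hs h.2.1, ht h.2.2⟩

end BTree

variable {I : Type}

/-- Tree monomials of the free operad on a signature: the well-coloured trees with output colour
`c`, whose leaves are in bijection with the coloured set `(L, χ)`. -/
@[ext]
structure Mon (σ : Signature I) {L : Type} (χ : L → I) (c : I) where
  tree : BTree σ.Gen L
  coloured : tree.HasColour σ χ c
  nodup : tree.leaves.Nodup
  mem : ∀ l, l ∈ tree.leaves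

/-- Shuffle tree monomials on an ordered coloured set `(L, χ)`. -/
@[ext]
structure ShMon (σ : Signature I) {L : Type} [LinearOrder L] (χ : L → I) (c : I)
    extends Mon σ χ c where
  shuffle : tree.IsShuffle

namespace Mon

variable {σ : Signature I} {L L' A : Type} {χ : L → I} {χ' : L' → I} {ψ : A → I} {c c' : I}

/-- Relabelling along an isomorphism of coloured sets. -/
def relabel (e : L ≃ L') (h : ∀ l, χ' (e l) = χ l) (hc : c = c') (t : Mon σ χ c) :
    Mon σ χ' c' where
  tree := t.tree.map e
  coloured := hc ▸ t.coloured.map e h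
  nodup := by rw [BTree.leaves_map]; exact t.nodup.map e.injective
  mem l := by
    rw [BTree.leaves_map, List.mem_map]
    exact ⟨e.symm l, t.mem _, e.apply_symm_apply l⟩

/-- Operadic composition `T(t_a : a ∈ A)`: given `π : L → A`, the monomial `t a`, whose inputs are
the fibre of `π` over `a`, is grafted on the input `a` of `T`. -/
def comp (T : Mon σ ψ c) (π : L → A)
    (t : ∀ a, Mon σ (fun l : {l : L // π l = a} => χ l) (ψ a)) : Mon σ χ c where
  tree := T.tree.bind (fun a => (t a).tree.map Subtype.val)
  coloured := T.coloured.bind (fun a => (t a).coloured.map Subtype.val (fun _ => rfl))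
  nodup := by
    rw [BTree.leaves_bind, List.nodup_flatMap]
    refine ⟨fun a _ => ?_, T.nodup.imp ?_⟩
    · rw [BTree.leaves_map]
      exact (t a).nodup.map Subtype.val_injective
    · intro a b hab l hl hl'
      simp only [BTree.leaves_map, List.mem_map] at hl hl'
      obtain ⟨x, -, rfl⟩ := hl
      obtain ⟨y, -, hy⟩ := hl'
      exact hab (x.2.symm.trans (hy ▸ y.2))
  mem l := by
    rw [BTree.leaves_bind, List.mem_flatMap]
    refine ⟨π l, T.mem _, ?_⟩
    rw [BTree.leaves_map, List.mem_map]
    exact ⟨⟨l, rfl⟩, (t (π l)).mem _, rfl⟩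

end Mon

/-- A map of ordered sets is shuffling if the minima of its fibres increase. -/
def Shuffling {L A : Type} [LinearOrder L] [LinearOrder A] (π : L → A) : Prop :=
  ∀ a a', a < a' → ∃ l, π l = a ∧ ∀ l', π l' = a' → l < l'

namespace BTree

variable {G L A : Type} [LinearOrder L] [LinearOrder A]

theorem IsShuffle.map {f : A → L} (hf : StrictMono f) {t : BTree G A} (h : t.IsShuffle) :
    (t.map f).IsShuffle := by
  induction t with
  | leaf a => trivial
  | node g s t hs ht =>
    obtain ⟨⟨l, hl, hlt⟩, h1, h2⟩ := h
    refine ⟨⟨f l, ?_, ?_⟩, hs h1, ht h2⟩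
    · rw [leaves_map]; exact List.mem_map_of_mem hl
    · intro l' hl'
      rw [leaves_map, List.mem_map] at hl'
      obtain ⟨x, hx, rfl⟩ := hl'
      exact hf (hlt x hx)

theorem IsShuffle.bind {π : L → A} (hπ : Shuffling π) {s : A → BTree G L}
    (hs : ∀ a, (s a).IsShuffle) (hmem : ∀ a l, l ∈ (s a).leaves ↔ π l = a)
    {t : BTree G A} (h : t.IsShuffle) : (t.bind s).IsShuffle := by
  induction t with
  | leaf a => exact hs a
  | node g u v hu hv =>
    obtain ⟨⟨a, ha, hlt⟩, h1, h2⟩ := h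
    refine ⟨?_, hu h1, hv h2⟩
    have hv' : ∃ b, b ∈ v.leaves := by
      clear hlt hv h2
      induction v with
      | leaf b => exact ⟨b, by simp [leaves]⟩
      | node g x y hx _ => obtain ⟨b, hb⟩ := hx; exact ⟨b, by simp [leaves, hb]⟩
    have hne : (π ⁻¹' {a}).Nonempty := by
      obtain ⟨b, hb⟩ := hv'
      obtain ⟨l, hl, -⟩ := hπ a b (hlt b hb)
      exact ⟨l, hl⟩
    have hfin : (π ⁻¹' {a}).Finite := by
      refine (s a).leaves.finite_toSet.subset ?_
      intro l hl
      exact (hmem a l).2 hl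
    obtain ⟨m, hm, hmin⟩ := Set.exists_min_image _ id hfin hne
    refine ⟨m, ?_, ?_⟩
    · rw [leaves_bind, List.mem_flatMap]
      exact ⟨a, ha, (hmem a m).2 hm⟩
    · intro l' hl'
      rw [leaves_bind, List.mem_flatMap] at hl'
      obtain ⟨b, hb, hl'⟩ := hl'
      obtain ⟨l, hl, hll⟩ := hπ a b (hlt b hb)
      exact (hmin l hl).trans_lt (hll l' ((hmem b l').1 hl'))

end BTree

namespace ShMon

variable {σ : Signature I} {L L' A : Type} [LinearOrder L] [LinearOrder L'] [LinearOrder A]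
  {χ : L → I} {χ' : L' → I} {ψ : A → I} {c c' : I}

/-- Relabelling along an isomorphism of ordered coloured sets. -/
def relabel (e : L ≃o L') (h : ∀ l, χ' (e l) = χ l) (hc : c = c') (t : ShMon σ χ c) :
    ShMon σ χ' c' where
  toMon := t.toMon.relabel e.toEquiv h hc
  shuffle := t.shuffle.map e.strictMono

/-- Shuffle composition: composition along a shuffling map `π`. -/
def comp (T : ShMon σ ψ c) (π : L → A) (hπ : Shuffling π)
    (t : ∀ a, ShMon σ (fun l : {l : L // π l = a} => χ l) (ψ a)) : ShMon σ χ c where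
  toMon := T.toMon.comp π (fun a => (t a).toMon)
  shuffle := by
    refine T.shuffle.bind hπ (fun a => (t a).shuffle.map (f := Subtype.val) (fun _ _ h => h)) ?_
    intro a l
    rw [BTree.leaves_map, List.mem_map]
    constructor
    · rintro ⟨x, -, rfl⟩; exact x.2
    · intro h; exact ⟨⟨l, h⟩, (t a).mem _, rfl⟩

end ShMon

/-! ### Free operads and operadic ideals -/

section Ideals

variable (σ : Signature I) (k : Type u) [Field k]

/-- The component, with inputs `(L, χ)` and output colour `c`, of the free symmetric coloured
operad generated by `σ`. -/
abbrev Free {L : Type} (χ : L → I) (c : I) : Type u := Mon σ χ c →₀ k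

/-- The component, with inputs `(L, χ)` and output colour `c`, of the free shuffle coloured
operad generated by `σ`. -/
abbrev ShFree {L : Type} [LinearOrder L] (χ : L → I) (c : I) : Type u := ShMon σ χ c →₀ k

/-- A family of subspaces of the components of the free symmetric operad. -/
abbrev Family : Type (max 1 u) :=
  ∀ (L : Type) (χ : L → I) (c : I), Submodule k (Free σ k χ c)

/-- A family of subspaces of the components of the free shuffle operad. -/
abbrev ShFamily : Type (max 1 u) :=
  ∀ (L : Type) [LinearOrder L] (χ : L → I) (c : I), Submodule k (ShFree σ k χ c)

/-- An element of a component of the free symmetric operad with inputs `{0, …, n - 1}`. -/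
structure Rel where
  n : ℕ
  χ : Fin n → I
  c : I
  elt : Free σ k χ c

/-- An element of a component of the free shuffle operad with inputs `{0, …, n - 1}`. -/
structure ShRel where
  n : ℕ
  χ : Fin n → I
  c : I
  elt : ShFree σ k χ c

variable {σ k}

open Classical in
/-- Operadic ideals of a free symmetric operad: stable under relabelling, and a composition
`T(t_a : a ∈ A)` lies in the ideal as soon as one of the composed elements does. By multilinearity
it suffices to let the other factors be tree monomials. -/
structure IsIdeal (J : Family σ k) : Prop where
  relabel_mem : ∀ {L L' : Type} {χ : L → I} {χ' : L' → I} {c : I} (e : L ≃ L')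
    (h : ∀ l, χ' (e l) = χ l) (f : Free σ k χ c), f ∈ J L χ c →
    Finsupp.lmapDomain k k (Mon.relabel e h rfl) f ∈ J L' χ' c
  comp_root_mem : ∀ {L A : Type} {χ : L → I} {ψ : A → I} {c : I} (π : L → A)
    (t : ∀ a, Mon σ (fun l : {l : L // π l = a} => χ l) (ψ a)) (f : Free σ k ψ c), f ∈ J A ψ c →
    Finsupp.lmapDomain k k (fun T => T.comp π t) f ∈ J L χ c
  comp_input_mem : ∀ {L A : Type} {χ : L → I} {ψ : A → I} {c : I} (π : L → A)
    (T : Mon σ ψ c) (t : ∀ a, Mon σ (fun l : {l : L // π l = a} => χ l) (ψ a)) (a : A)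
    (f : Free σ k (fun l : {l : L // π l = a} => χ l) (ψ a)), f ∈ J _ _ (ψ a) →
    Finsupp.lmapDomain k k (fun s => T.comp π (Function.update t a s)) f ∈ J L χ c

open Classical in
/-- Operadic ideals of a free shuffle operad: the same for shuffle compositions and
order-preserving relabellings. -/
structure IsShIdeal (J : ShFamily σ k) : Prop where
  relabel_mem : ∀ {L L' : Type} [LinearOrder L] [LinearOrder L'] {χ : L → I} {χ' : L' → I} {c : I}
    (e : L ≃o L') (h : ∀ l, χ' (e l) = χ l) (f : ShFree σ k χ c), f ∈ J L χ c →
    Finsupp.lmapDomain k k (ShMon.relabel e h rfl) f ∈ J L' χ' c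
  comp_root_mem : ∀ {L A : Type} [LinearOrder L] [LinearOrder A] {χ : L → I} {ψ : A → I} {c : I}
    (π : L → A) (hπ : Shuffling π)
    (t : ∀ a, ShMon σ (fun l : {l : L // π l = a} => χ l) (ψ a)) (f : ShFree σ k ψ c),
    f ∈ J A ψ c →
    Finsupp.lmapDomain k k (fun T => T.comp π hπ t) f ∈ J L χ c
  comp_input_mem : ∀ {L A : Type} [LinearOrder L] [LinearOrder A] {χ : L → I} {ψ : A → I} {c : I}
    (π : L → A) (hπ : Shuffling π) (T : ShMon σ ψ c)
    (t : ∀ a, ShMon σ (fun l : {l : L // π l = a} => χ l) (ψ a)) (a : A)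
    (f : ShFree σ k (fun l : {l : L // π l = a} => χ l) (ψ a)), f ∈ J _ _ (ψ a) →
    Finsupp.lmapDomain k k (fun s => T.comp π hπ (Function.update t a s)) f ∈ J L χ c

/-- The operadic ideal generated by a set of elements: the smallest ideal containing it. -/
noncomputable def idealSpan (R : Set (Rel σ k)) : Family σ k := fun L χ c =>
  ⨅ (J : Family σ k) (_ : IsIdeal J) (_ : ∀ r ∈ R, r.elt ∈ J _ r.χ r.c), J L χ c

/-- The shuffle operadic ideal generated by a set of elements. -/
noncomputable def shIdealSpan (R : Set (ShRel σ k)) : ShFamily σ k := fun L _ χ c =>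
  ⨅ (J : ShFamily σ k) (_ : IsShIdeal J) (_ : ∀ r ∈ R, r.elt ∈ J _ r.χ r.c), J L χ c

theorem mem_idealSpan {R : Set (Rel σ k)} {L : Type} {χ : L → I} {c : I} {f : Free σ k χ c} :
    f ∈ idealSpan R L χ c ↔
      ∀ J : Family σ k, IsIdeal J → (∀ r ∈ R, r.elt ∈ J _ r.χ r.c) → f ∈ J L χ c := by
  simp [idealSpan, Submodule.mem_iInf]

end Ideals

/-! ### Symmetric coloured collections -/

/-- Coloured symmetric collections, given on all coloured sets and their isomorphisms:
`obj L χ c` is the space of operations with inputs `(L, χ)` and output colour `c`. -/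
structure SymCollection (k : Type u) [Field k] (I : Type) where
  obj : (L : Type) → (L → I) → I → Type u
  [addCommGroup : ∀ L χ c, AddCommGroup (obj L χ c)]
  [module : ∀ L χ c, Module k (obj L χ c)]
  map : ∀ {L L' : Type} {χ : L → I} {χ' : L' → I} {c c' : I} (e : L ≃ L'),
    (∀ l, χ' (e l) = χ l) → c = c' → (obj L χ c →ₗ[k] obj L' χ' c')
  map_refl : ∀ {L : Type} {χ : L → I} {c : I} (x : obj L χ c),
    map (χ := χ) (χ' := χ) (Equiv.refl L) (fun _ => rfl) rfl x = x
  map_trans : ∀ {L L' L'' : Type} {χ : L → I} {χ' : L' → I} {χ'' : L'' → I} {c c' c'' : I}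
    (e : L ≃ L') (h : ∀ l, χ' (e l) = χ l) (hc : c = c')
    (e' : L' ≃ L'') (h' : ∀ l, χ'' (e' l) = χ' l) (hc' : c' = c'') (x : obj L χ c),
    map (e.trans e') (fun l => (h' (e l)).trans (h l)) (hc.trans hc') x
      = map e' h' hc' (map e h hc x)

attribute [instance] SymCollection.addCommGroup SymCollection.module

namespace SymCollection

variable {k : Type u} [Field k]

/-- Isomorphisms of coloured symmetric collections: linear isomorphisms on all finite coloured
sets, commuting with relabelling. -/
structure Iso (P Q : SymCollection k I) where
  equiv : ∀ (L : Type) [Finite L] (χ : L → I) (c : I), P.obj L χ c ≃ₗ[k] Q.obj L χ c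
  naturality : ∀ {L L' : Type} [Finite L] [Finite L'] {χ : L → I} {χ' : L' → I} {c c' : I}
    (e : L ≃ L') (h : ∀ l, χ' (e l) = χ l) (hc : c = c') (x : P.obj L χ c),
    equiv L' χ' c' (P.map e h hc x) = Q.map e h hc (equiv L χ c x)

/-- The generating series with output colour `c`:
`∑ₘ dim P(m, c) ∏ᵢ tᵢ ^ mᵢ / mᵢ!`, where `P(m, c)` has `mᵢ` inputs of each colour `i`. -/
noncomputable def genSeries [Fintype I] (P : SymCollection k I) (c : I) : MvPowerSeries I ℚ :=
  fun m => (Module.finrank k (P.obj (Σ i : I, Fin (m i)) Sigma.fst c) : ℚ) /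
    ∏ i, ((m i).factorial : ℚ)

/-! #### Composition of collections -/

section Comp

variable (P Q : SymCollection k I) {L L' L'' : Type}

/-- The set of partitions of `L` with a colouring of the set of blocks. -/
abbrev CPart (I : Type) (L : Type) : Type := Σ r : Setoid L, (Quotient r → I)

/-- The summand `P(blocks) ⊗ ⨂_b Q(b)` of the composition, for one coloured partition. -/
abbrev Summand (χ : L → I) (c : I) (i : CPart I L) : Type u :=
  P.obj (Quotient i.1) i.2 c ⊗[k]
    PiTensorProduct k (fun b : Quotient i.1 =>
      Q.obj {l : L // Quotient.mk i.1 l = b} (fun l => χ l) (i.2 b))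

variable {P Q}
variable {χ : L → I} {χ' : L' → I} {χ'' : L'' → I} {c c' c'' : I}

/-- The bijection between two corresponding blocks of two corresponding partitions. -/
def fibreEquiv (e : L ≃ L') {r : Setoid L} {r' : Setoid L'} (q : Quotient r ≃ Quotient r')
    (hq : ∀ l, q (Quotient.mk r l) = Quotient.mk r' (e l)) (b : Quotient r') :
    {l : L // Quotient.mk r l = q.symm b} ≃ {l' : L' // Quotient.mk r' l' = b} :=
  e.subtypeEquiv (fun l => by rw [← hq l, Equiv.eq_symm_apply])

/-- The map of summands induced by an isomorphism `e` of coloured sets, where `q` is the induced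
bijection between the blocks. -/
noncomputable def summandMap (e : L ≃ L') (h : ∀ l, χ' (e l) = χ l) (hc : c = c')
    (i : CPart I L) (i' : CPart I L') (q : Quotient i.1 ≃ Quotient i'.1)
    (hq : ∀ l, q (Quotient.mk i.1 l) = Quotient.mk i'.1 (e l)) (hi : ∀ b, i'.2 (q b) = i.2 b) :
    Summand P Q χ c i →ₗ[k] Summand P Q χ' c' i' :=
  TensorProduct.map (P.map q hi hc)
    (PiTensorProduct.map (fun b => Q.map (fibreEquiv e q hq b) (fun l => h l)
        (by rw [← hi, Equiv.apply_symm_apply])) ∘ₗ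
      (PiTensorProduct.reindex k
        (fun b : Quotient i.1 => Q.obj {l : L // Quotient.mk i.1 l = b} (fun l => χ l) (i.2 b))
        q).toLinearMap)

/-- The image of a coloured partition under a bijection. -/
def CPart.transport (e : L ≃ L') (i : CPart I L) : CPart I L' :=
  ⟨Setoid.comap e.symm i.1, fun b => i.2 (Quotient.map' e.symm (fun _ _ h => h) b)⟩

/-- The bijection between the blocks of a partition and those of its image. -/
def CPart.blockEquiv (e : L ≃ L') (i : CPart I L) : Quotient i.1 ≃ Quotient (i.transport e).1 :=
  Quotient.congr e (fun a b => by
    change i.1.r a b ↔ i.1.r (e.symm (e a)) (e.symm (e b))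
    rw [e.symm_apply_apply, e.symm_apply_apply])

theorem CPart.blockEquiv_mk (e : L ≃ L') (i : CPart I L) (l : L) :
    i.blockEquiv e (Quotient.mk i.1 l) = Quotient.mk (i.transport e).1 (e l) := rfl

theorem CPart.transport_snd (e : L ≃ L') (i : CPart I L) (b : Quotient i.1) :
    (i.transport e).2 (i.blockEquiv e b) = i.2 b := by
  induction b using Quotient.inductionOn with
  | h l =>
    change i.2 (Quotient.mk i.1 (e.symm (e l))) = _
    rw [e.symm_apply_apply]

theorem CPart.ext_of_equiv (e : L ≃ L') (i : CPart I L) (i' j' : CPart I L')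
    (q : Quotient i.1 ≃ Quotient i'.1)
    (hq : ∀ l, q (Quotient.mk i.1 l) = Quotient.mk i'.1 (e l)) (hi : ∀ b, i'.2 (q b) = i.2 b)
    (p : Quotient i.1 ≃ Quotient j'.1)
    (hp : ∀ l, p (Quotient.mk i.1 l) = Quotient.mk j'.1 (e l)) (hj : ∀ b, j'.2 (p b) = i.2 b) :
    i' = j' := by
  obtain ⟨r, f⟩ := i'
  obtain ⟨s, g⟩ := j'
  have hrs : r = s := by
    ext a b
    obtain ⟨a, rfl⟩ := e.surjective a
    obtain ⟨b, rfl⟩ := e.surjective b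
    have h1 : r (e a) (e b) ↔ i.1 a b := by
      rw [← Quotient.eq (r := r), ← Quotient.eq (r := i.1)]
      exact ⟨fun h => q.injective ((hq a).trans (h.trans (hq b).symm)),
        fun h => (hq a).symm.trans ((congrArg q h).trans (hq b))⟩
    have h2 : s (e a) (e b) ↔ i.1 a b := by
      rw [← Quotient.eq (r := s), ← Quotient.eq (r := i.1)]
      exact ⟨fun h => p.injective ((hp a).trans (h.trans (hp b).symm)),
        fun h => (hp a).symm.trans ((congrArg p h).trans (hp b))⟩
    exact h1.trans h2.symm
  subst hrs
  have hfg : f = g := by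
    funext b
    induction b using Quotient.inductionOn with
    | h l =>
      obtain ⟨l, rfl⟩ := e.surjective l
      exact ((congrArg f (hq l)).symm.trans ((hi _).trans (hj _).symm)).trans (congrArg g (hp l))
  rw [hfg]

open Classical in
theorem lof_summandMap_eq (e : L ≃ L') (h : ∀ l, χ' (e l) = χ l) (hc : c = c')
    (i : CPart I L) (i' j' : CPart I L')
    (q : Quotient i.1 ≃ Quotient i'.1)
    (hq : ∀ l, q (Quotient.mk i.1 l) = Quotient.mk i'.1 (e l)) (hi : ∀ b, i'.2 (q b) = i.2 b)
    (p : Quotient i.1 ≃ Quotient j'.1)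
    (hp : ∀ l, p (Quotient.mk i.1 l) = Quotient.mk j'.1 (e l)) (hj : ∀ b, j'.2 (p b) = i.2 b)
    (x : Summand P Q χ c i) :
    DirectSum.lof k (CPart I L') (Summand P Q χ' c') i' (summandMap e h hc i i' q hq hi x) =
      DirectSum.lof k (CPart I L') (Summand P Q χ' c') j' (summandMap e h hc i j' p hp hj x) := by
  obtain rfl := CPart.ext_of_equiv e i i' j' q hq hi p hp hj
  have hqp : q = p := by
    ext b
    induction b using Quotient.inductionOn with
    | h l => exact (hq l).trans (hp l).symm
  subst hqp
  rfl

theorem summandMap_refl (i : CPart I L) (x : Summand P Q χ c i) :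
    summandMap (χ := χ) (χ' := χ) (Equiv.refl L) (fun _ => rfl) rfl i i (Equiv.refl _)
      (fun _ => rfl) (fun _ => rfl) x = x := by
  induction x using TensorProduct.induction_on with
  | zero => exact map_zero _
  | add x y hx hy => rw [map_add, hx, hy]
  | tmul p y =>
    refine (TensorProduct.map_tmul _ _ _ _).trans ?_
    congr 1
    · exact P.map_refl p
    · induction y using PiTensorProduct.induction_on with
      | add x y hx hy => rw [map_add, hx, hy]
      | smul_tprod r y =>
        rw [map_smul, LinearMap.comp_apply, LinearEquiv.coe_coe, PiTensorProduct.reindex_tprod,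
          PiTensorProduct.map_tprod]
        congr 2
        funext b
        exact Q.map_refl (y b)

theorem summandMap_trans (e : L ≃ L') (h : ∀ l, χ' (e l) = χ l) (hc : c = c')
    (e' : L' ≃ L'') (h' : ∀ l, χ'' (e' l) = χ' l) (hc' : c' = c'')
    (i : CPart I L) (i' : CPart I L') (i'' : CPart I L'')
    (q : Quotient i.1 ≃ Quotient i'.1)
    (hq : ∀ l, q (Quotient.mk i.1 l) = Quotient.mk i'.1 (e l)) (hi : ∀ b, i'.2 (q b) = i.2 b)
    (q' : Quotient i'.1 ≃ Quotient i''.1)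
    (hq' : ∀ l, q' (Quotient.mk i'.1 l) = Quotient.mk i''.1 (e' l))
    (hi' : ∀ b, i''.2 (q' b) = i'.2 b) (x : Summand P Q χ c i) :
    summandMap (e.trans e') (fun l => (h' (e l)).trans (h l)) (hc.trans hc') i i'' (q.trans q')
        (fun l => (congrArg q' (hq l)).trans (hq' (e l))) (fun b => (hi' (q b)).trans (hi b)) x
      = summandMap e' h' hc' i' i'' q' hq' hi' (summandMap e h hc i i' q hq hi x) := by
  induction x using TensorProduct.induction_on with
  | zero => simp only [map_zero]
  | add x y hx hy => simp only [map_add, hx, hy]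
  | tmul p y =>
    simp only [summandMap, TensorProduct.map_tmul]
    congr 1
    · exact P.map_trans q hi hc q' hi' hc' p
    · induction y using PiTensorProduct.induction_on with
      | add x y hx hy => simp only [map_add, hx, hy]
      | smul_tprod r y =>
        simp only [map_smul, LinearMap.comp_apply, LinearEquiv.coe_coe,
          PiTensorProduct.reindex_tprod, PiTensorProduct.map_tprod]
        congr 2
        funext b
        exact Q.map_trans (fibreEquiv e q hq (q'.symm b)) (fun l => h l) _
          (fibreEquiv e' q' hq' b) (fun l => h' l) _ (y (q.symm (q'.symm b)))

variable (P Q)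

open Classical in
/-- The action of isomorphisms of coloured sets on the composition. -/
noncomputable def compMap (e : L ≃ L') (h : ∀ l, χ' (e l) = χ l) (hc : c = c') :
    (⨁ i : CPart I L, Summand P Q χ c i) →ₗ[k] ⨁ i : CPart I L', Summand P Q χ' c' i :=
  DirectSum.toModule k (CPart I L) _ (fun i =>
    DirectSum.lof k (CPart I L') (Summand P Q χ' c') (i.transport e) ∘ₗ
      summandMap e h hc i (i.transport e) (i.blockEquiv e) (i.blockEquiv_mk e)
        (i.transport_snd e))

open Classical in
theorem compMap_lof (e : L ≃ L') (h : ∀ l, χ' (e l) = χ l) (hc : c = c')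
    (i : CPart I L) (i' : CPart I L') (q : Quotient i.1 ≃ Quotient i'.1)
    (hq : ∀ l, q (Quotient.mk i.1 l) = Quotient.mk i'.1 (e l)) (hi : ∀ b, i'.2 (q b) = i.2 b)
    (x : Summand P Q χ c i) :
    compMap P Q e h hc (DirectSum.lof k (CPart I L) (Summand P Q χ c) i x) =
      DirectSum.lof k (CPart I L') (Summand P Q χ' c') i' (summandMap e h hc i i' q hq hi x) := by
  refine (DirectSum.toModule_lof k i x).trans ?_
  exact lof_summandMap_eq e h hc i _ _ _ _ _ _ _ _ x

open Classical in
/-- Composition of coloured symmetric collections: `(P ∘ Q)(L)` is the direct sum, over all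
partitions of `L` into blocks and all colourings of the set of blocks, of
`P(blocks) ⊗ ⨂_b Q(b)`. -/
noncomputable def comp : SymCollection k I where
  obj L χ c := ⨁ i : CPart I L, Summand P Q χ c i
  map e h hc := compMap P Q e h hc
  map_refl := by
    intro L χ c x
    induction x using DirectSum.induction_on with
    | zero => exact map_zero _
    | add x y hx hy => exact (map_add _ _ _).trans (congrArg₂ _ hx hy)
    | of i x =>
      exact (compMap_lof P Q (Equiv.refl L) (fun _ => rfl) rfl i i (Equiv.refl _) (fun _ => rfl)
        (fun _ => rfl) x).trans
        (congrArg (DirectSum.lof k (CPart I L) (Summand P Q χ c) i) (summandMap_refl i x))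
  map_trans := by
    intro L L' L'' χ χ' χ'' c c' c'' e h hc e' h' hc' x
    induction x using DirectSum.induction_on with
    | zero => simp only [map_zero]
    | add x y hx hy => simp only [map_add, hx, hy]
    | of i x =>
      have h1 := compMap_lof P Q e h hc i (i.transport e) (i.blockEquiv e) (i.blockEquiv_mk e)
        (i.transport_snd e) x
      have h2 := compMap_lof P Q e' h' hc' (i.transport e) ((i.transport e).transport e')
        ((i.transport e).blockEquiv e') ((i.transport e).blockEquiv_mk e')
        ((i.transport e).transport_snd e')
        (summandMap e h hc i (i.transport e) (i.blockEquiv e) (i.blockEquiv_mk e)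
          (i.transport_snd e) x)
      rw [← summandMap_trans] at h2
      exact (compMap_lof P Q (e.trans e') _ _ i _ _ _ _ x).trans
        (((congrArg _ h1).trans h2).symm)

end Comp

end SymCollection

/-! ### Operads presented by generators and relations -/

section Presented

variable {σ : Signature I} {k : Type u} [Field k]

theorem idealSpan_relabel (R : Set (Rel σ k)) {L L' : Type} {χ : L → I} {χ' : L' → I} {c c' : I}
    (e : L ≃ L') (h : ∀ l, χ' (e l) = χ l) (hc : c = c') :
    idealSpan R L χ c ≤
      (idealSpan R L' χ' c').comap (Finsupp.lmapDomain k k (Mon.relabel (σ := σ) e h hc)) := by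
  subst hc
  intro f hf
  rw [Submodule.mem_comap, mem_idealSpan]
  intro J hJ hR
  exact hJ.relabel_mem e h f (mem_idealSpan.1 hf J hJ hR)

/-- The underlying symmetric collection of the coloured operad with generators `σ` and relations
`R`: the quotient of the free operad by the ideal generated by `R`. -/
noncomputable def presented (R : Set (Rel σ k)) : SymCollection k I where
  obj L χ c := Free σ k χ c ⧸ idealSpan R L χ c
  map e h hc := Submodule.mapQ _ _ (Finsupp.lmapDomain k k (Mon.relabel e h hc))
    (idealSpan_relabel R e h hc)
  map_refl := by
    intro L χ c x
    induction x using Submodule.Quotient.induction_on with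
    | H x =>
      rw [Submodule.mapQ_apply]
      congr 1
      have : Mon.relabel (σ := σ) (χ := χ) (χ' := χ) (c := c) (Equiv.refl L) (fun _ => rfl) rfl
          = id := by
        funext t; ext1; exact BTree.map_id' t.tree
      rw [this, Finsupp.lmapDomain_id, LinearMap.id_apply]
  map_trans := by
    intro L L' L'' χ χ' χ'' c c' c'' e h hc e' h' hc' x
    induction x using Submodule.Quotient.induction_on with
    | H x =>
      simp only [Submodule.mapQ_apply]
      congr 1
      rw [← LinearMap.comp_apply, ← Finsupp.lmapDomain_comp]
      congr 2
      funext t; ext1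
      exact (BTree.map_map e' e t.tree).symm

end Presented

/-! ### The operads `Com`, `F(d)` and `DCom`

The colours are `0` (elements of the algebra, the first colour) and `1` (derivations, the second
colour). -/

section Operads

inductive ComGen | al
inductive DerGen | d
inductive DComGen | al | d

open BTree

/-- One operation `α` of colours `(0, 0; 0)`. -/
def comSig : Signature (Fin 2) := ⟨ComGen, fun _ => 0, fun _ => 0, fun _ => 0⟩

/-- One operation `d` of colours `(0, 1; 0)`, without symmetries. -/
def derSig : Signature (Fin 2) := ⟨DerGen, fun _ => 0, fun _ => 1, fun _ => 0⟩

/-- Two operations: `α` of colours `(0, 0; 0)` and `d` of colours `(0, 1; 0)`. -/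
def dcomSig : Signature (Fin 2) where
  Gen := DComGen
  in₁ _ := 0
  in₂ | .al => 0 | .d => 1
  out _ := 0

variable (k : Type u) [Field k]

/-- `α(0,1) = α(1,0)`. -/
noncomputable def comComm : Rel comSig k where
  n := 2
  χ := ![0, 0]
  c := 0
  elt :=
    Finsupp.single ⟨node .al (leaf 0) (leaf 1),
      by simp [HasColour, comSig], by simp [leaves], by decide⟩ 1
    - Finsupp.single ⟨node .al (leaf 1) (leaf 0),
      by simp [HasColour, comSig], by simp [leaves], by decide⟩ 1

/-- `α(α(0,1),2) = α(0,α(1,2))`. -/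
noncomputable def comAssoc : Rel comSig k where
  n := 3
  χ := ![0, 0, 0]
  c := 0
  elt :=
    Finsupp.single ⟨node .al (node .al (leaf 0) (leaf 1)) (leaf 2),
      by simp [HasColour, comSig], by simp [leaves], by decide⟩ 1
    - Finsupp.single ⟨node .al (leaf 0) (node .al (leaf 1) (leaf 2)),
      by simp [HasColour, comSig], by simp [leaves], by decide⟩ 1

/-- The operad of commutative associative algebras as a `2`-coloured operad, all its generating
operations being of the first colour. -/
noncomputable def Com : SymCollection k (Fin 2) := presented {comComm k, comAssoc k}

/-- The free `2`-coloured operad generated by `d`. -/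
noncomputable def FreeD : SymCollection k (Fin 2) := presented (σ := derSig) (∅ : Set (Rel derSig k))

/-- `α(0,1) = α(1,0)`. -/
noncomputable def dcomComm : Rel dcomSig k where
  n := 2
  χ := ![0, 0]
  c := 0
  elt :=
    Finsupp.single ⟨node .al (leaf 0) (leaf 1),
      by simp [HasColour, dcomSig], by simp [leaves], by decide⟩ 1
    - Finsupp.single ⟨node .al (leaf 1) (leaf 0),
      by simp [HasColour, dcomSig], by simp [leaves], by decide⟩ 1

/-- `α(α(0,1),2) = α(0,α(1,2))`. -/
noncomputable def dcomAssoc : Rel dcomSig k where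
  n := 3
  χ := ![0, 0, 0]
  c := 0
  elt :=
    Finsupp.single ⟨node .al (node .al (leaf 0) (leaf 1)) (leaf 2),
      by simp [HasColour, dcomSig], by simp [leaves], by decide⟩ 1
    - Finsupp.single ⟨node .al (leaf 0) (node .al (leaf 1) (leaf 2)),
      by simp [HasColour, dcomSig], by simp [leaves], by decide⟩ 1

/-- The Leibniz rule `d(α(0,1),2) = α(0,d(1,2)) + α(d(0,2),1)`. -/
noncomputable def dcomLeibniz : Rel dcomSig k where
  n := 3
  χ := ![0, 0, 1]
  c := 0
  elt :=
    Finsupp.single ⟨node .d (node .al (leaf 0) (leaf 1)) (leaf 2),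
      by simp [HasColour, dcomSig], by simp [leaves], by decide⟩ 1
    - (Finsupp.single ⟨node .al (leaf 0) (node .d (leaf 1) (leaf 2)),
        by simp [HasColour, dcomSig], by simp [leaves], by decide⟩ 1
      + Finsupp.single ⟨node .al (node .d (leaf 0) (leaf 2)) (leaf 1),
        by simp [HasColour, dcomSig], by simp [leaves], by decide⟩ 1)

def dcomRels : Set (Rel dcomSig k) := {dcomComm k, dcomAssoc k, dcomLeibniz k}

/-- The `2`-coloured operad of pairs (commutative algebra, space of its derivations). -/
noncomputable def DCom : SymCollection k (Fin 2) := presented (dcomRels k)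

end Operads

/-! ### The shuffle operad associated with `DCom` -/

section Shuffle

/-- The generators of the shuffle operad: `α`, `d`, and `e(x,y) = d(y,x)`. -/
inductive ShGen | al | d | e

def shSig : Signature (Fin 2) where
  Gen := ShGen
  in₁ | .al => 0 | .d => 0 | .e => 1
  in₂ | .al => 0 | .d => 1 | .e => 0
  out _ := 0

/-- The operation given by a tree in `α`, `d`, `e`, where `e(x,y)` stands for `d(y,x)`. -/
def symTree {L : Type} : BTree ShGen L → BTree DComGen L
  | .leaf l => .leaf l
  | .node .al a b => .node .al (symTree a) (symTree b)
  | .node .d a b => .node .d (symTree a) (symTree b)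
  | .node .e a b => .node .d (symTree b) (symTree a)

theorem symTree_perm {L : Type} (t : BTree ShGen L) : (symTree t).leaves.Perm t.leaves := by
  induction t with
  | leaf l => exact List.Perm.refl _
  | node g a b ha hb =>
    cases g with
    | al => exact ha.append hb
    | d => exact ha.append hb
    | e => exact (hb.append ha).trans List.perm_append_comm

theorem symTree_coloured {L : Type} {χ : L → Fin 2} {c : Fin 2} {t : BTree ShGen L}
    (h : BTree.HasColour shSig χ t c) : BTree.HasColour dcomSig χ (symTree t) c := by
  induction t generalizing c with
  | leaf l => exact h
  | node g a b ha hb =>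
    cases g with
    | al => exact ⟨h.1, ha h.2.1, hb h.2.2⟩
    | d => exact ⟨h.1, ha h.2.1, hb h.2.2⟩
    | e => exact ⟨h.1, hb h.2.2, ha h.2.1⟩

def symMon {L : Type} [LinearOrder L] {χ : L → Fin 2} {c : Fin 2} (t : ShMon shSig χ c) :
    Mon dcomSig χ c where
  tree := symTree t.tree
  coloured := symTree_coloured t.coloured
  nodup := (symTree_perm t.tree).nodup_iff.2 t.nodup
  mem l := (symTree_perm t.tree).mem_iff.2 (t.mem l)

variable (k : Type u) [Field k]

/-- The canonical map from the free shuffle operad on `α`, `d`, `e` to (the shuffle operad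
associated with) `DCom`. -/
noncomputable def shToDCom {L : Type} [LinearOrder L] (χ : L → Fin 2) (c : Fin 2) :
    ShFree shSig k χ c →ₗ[k] (DCom k).obj L χ c :=
  (idealSpan (dcomRels k) L χ c).mkQ ∘ₗ Finsupp.lmapDomain k k symMon

/-- The ideal of relations of the shuffle operad associated with `DCom`. -/
noncomputable def dcomShIdeal : ShFamily shSig k := fun _ _ χ c => LinearMap.ker (shToDCom k χ c)

end Shuffle

/-! ### Gröbner bases -/

section Groebner

variable (σ : Signature I) {k : Type u} [Field k]

/-- A choice of a total order of the shuffle tree monomials with inputs `{0, …, n - 1}`, for each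
number of inputs, colouring of the inputs and colour of the output. -/
abbrev MonOrder : Type :=
  ∀ (n : ℕ) (χ : Fin n → I) (c : I), LinearOrder (ShMon σ χ c)

variable {σ}

/-- `m` is the leading term of `f`. -/
def IsLeadingTerm (ord : MonOrder σ) {n : ℕ} {χ : Fin n → I} {c : I} (f : ShFree σ k χ c)
    (m : ShMon σ χ c) : Prop :=
  m ∈ f.support ∧ ∀ m' ∈ f.support, (ord n χ c).le m' m

/-- `α` is divisible by `β`: the tree of `α` contains a copy of `β`, at whose inputs, numbered by
their smallest descendants, the subtrees `t 0, t 1, …` of `α` grow. -/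
def Divides {m n : ℕ} {ψ : Fin m → I} {b : I} {χ : Fin n → I} {c : I}
    (β : ShMon σ ψ b) (α : ShMon σ χ c) : Prop :=
  ∃ t : Fin m → BTree σ.Gen (Fin n),
    (β.tree.bind t).IsSubtree α.tree ∧ (∀ i, (t i).HasColour σ χ (ψ i)) ∧
      ∀ i j, i < j → (t i).MinLT (t j)

/-- `G` is a Gröbner basis of the family of subspaces `M`: it generates `M` as an operadic ideal,
and the leading term of each element of `M` is divisible by the leading term of an element of
`G`. -/
structure IsGroebnerBasis (ord : MonOrder σ) (M : ShFamily σ k) (G : Set (ShRel σ k)) : Prop where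
  generates : ∀ (L : Type) [LinearOrder L] (χ : L → I) (c : I), shIdealSpan G L χ c = M L χ c
  divides : ∀ (n : ℕ) (χ : Fin n → I) (c : I) (f : ShFree σ k χ c), f ∈ M (Fin n) χ c →
    ∀ m, IsLeadingTerm ord f m →
      ∃ g ∈ G, ∃ m', IsLeadingTerm ord g.elt m' ∧ Divides m' m

/-- All tree monomials of `g` have exactly two vertices. -/
def ShRel.IsQuadratic (g : ShRel σ k) : Prop := ∀ m ∈ g.elt.support, m.tree.size = 2

end Groebner

/-! ### The QM-ordering with `x = α` and `y = d, e` -/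

section QM

/-- The quantum monomial `x ^ a * y ^ b * q ^ c`. -/
@[ext]
structure QMon where
  a : ℕ
  b : ℕ
  c : ℕ

namespace QMon

/-- Multiplication of quantum monomials, where `y * x = x * y * q` and `q` is central, so that
`y ^ b * x ^ a = x ^ a * y ^ b * q ^ (b * a)`. -/
def mul (u v : QMon) : QMon := ⟨u.a + v.a, u.b + v.b, u.c + v.c + u.b * v.a⟩

def LT (u v : QMon) : Prop :=
  u.a > v.a ∨ (u.a = v.a ∧ u.b < v.b) ∨ (u.a = v.a ∧ u.b = v.b ∧ u.c < v.c)

/-- The quantum variable that corresponds to a generator. -/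
def ofGen : ShGen → QMon
  | .al => ⟨1, 0, 0⟩
  | .d => ⟨0, 1, 0⟩
  | .e => ⟨0, 1, 0⟩

end QMon

/-- The product of the variables along the path from the root to the leaf labelled `l`. -/
def pathQ {L : Type} [DecidableEq L] : BTree ShGen L → L → QMon
  | .leaf _, _ => ⟨0, 0, 0⟩
  | .node g s t, l => (QMon.ofGen g).mul (if l ∈ s.leaves then pathQ s l else pathQ t l)

/-- The QM-ordering (a partial order) of monomials with the same inputs and output: the vectors of
path monomials are compared lexicographically. -/
def QMLT {L : Type} [LinearOrder L] {χ : L → Fin 2} {c : Fin 2} (s t : ShMon shSig χ c) : Prop :=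
  ∃ i : L, (∀ j, j < i → pathQ s.tree j = pathQ t.tree j) ∧
    (pathQ s.tree i).LT (pathQ t.tree i)

/-- Compatibility of the QM-ordering with all shuffle compositions (in each factor). -/
def QMAdmissible : Prop :=
  (∀ {L A : Type} [LinearOrder L] [LinearOrder A] {χ : L → Fin 2} {ψ : A → Fin 2} {c : Fin 2}
    (π : L → A) (hπ : Shuffling π) (T T' : ShMon shSig ψ c)
    (t : ∀ a, ShMon shSig (fun l : {l : L // π l = a} => χ l) (ψ a)),
    QMLT T T' → QMLT (T.comp π hπ t) (T'.comp π hπ t)) ∧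
  (∀ {L A : Type} [LinearOrder L] [LinearOrder A] {χ : L → Fin 2} {ψ : A → Fin 2} {c : Fin 2}
    (π : L → A) (hπ : Shuffling π) (T : ShMon shSig ψ c)
    (t : ∀ a, ShMon shSig (fun l : {l : L // π l = a} => χ l) (ψ a)) (a : A)
    (s s' : ShMon shSig (fun l : {l : L // π l = a} => χ l) (ψ a)),
    QMLT s s' → QMLT (T.comp π hπ (Function.update t a s)) (T.comp π hπ (Function.update t a s')))

/-- The total order `ord` refines the QM-ordering. -/
def ExtendsQM (ord : MonOrder shSig) : Prop :=
  ∀ (n : ℕ) (χ : Fin n → Fin 2) (c : Fin 2) (s t : ShMon shSig χ c), QMLT s t → (ord n χ c).lt s t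

end QM

end ColOp

/-! Operations of `DCom` act on every commutative algebra with derivations. The universal test
object is the polynomial algebra `DPoly k L` on symbols w(x), where x is in L, w is a word in L, and
the letter l acts by the derivation w(x) ↦ (lw)(x). Evaluation there gives a linear map `dcomEval`
on each component of `DCom`, and everything follows once its kernel and its image are known.

Kernel. Five quadratic rules (`Rule`), which hold in `DCom`, replace α(0,α(1,2)), α(α(0,2),1) and
the three shuffle forms of a derivation of a product by QM-smaller monomials. A shuffle monomial to
which no rule applies is a left comb of chains w(x), sorted by their smallest leaves
(`reducible_or_isNormal`). The QM-ordering is compatible with compositions, and it is well founded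
because there are finitely many monomials on given inputs; hence the normal monomials span modulo
the rules (`exists_normal_form`). Their values are pairwise distinct monomials of `DPoly k L`, so
they are linearly independent already in `DCom` (`eq_zero_of_normal`). Spanning modulo the rules
together with independence modulo the larger ideal M shows that the rules generate M, and that no
normal monomial is a leading term of an element of M (`isNormal_not_isLeadingTerm`). The concrete
model thus takes the place of a check of S-polynomials. The same two facts make `dcomEval`
injective.

Image. The image is spanned by the monomials whose factors w(x) use every input exactly once, with
the right colours (`IsFactorSet`). An operation of `Com ∘ F(d)` also has a value in `DPoly k L`: an
operation of F(d) is a word applied to an element, and all monomials of `Com` on the same inputs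
represent one operation, so the value is the product of the words of the blocks. This map `compEval`
is injective with the same image, and both maps commute with relabelling; this gives `dcomIso`.

Dimensions. With p > 0 inputs of the first colour and q of the second, a factor set distributes q
letters into p ordered words, in q! · multichoose(p, q) ways. Division by p! q! leaves
multichoose(p, q) / p!, the coefficient in (t₁/(1 - t₂))^p / p!. For p = 0 there is nothing, whence
the term -1. -/

namespace ColOp

/-! ### Trees and grafting -/

namespace BTree

variable {G L A B I : Type}

theorem leaves_ne_nil (t : BTree G L) : t.leaves ≠ [] := by
  induction t with
  | leaf l => simp [leaves]
  | node g a b ha hb => simp [leaves, ha]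

theorem exists_mem_leaves (t : BTree G L) : ∃ l, l ∈ t.leaves :=
  List.exists_mem_of_ne_nil _ t.leaves_ne_nil

theorem size_map (f : A → L) (t : BTree G A) : (t.map f).size = t.size := by
  induction t with
  | leaf a => rfl
  | node g s t hs ht => simp [map, size, hs, ht]

theorem length_leaves (t : BTree G L) : t.leaves.length = t.size + 1 := by
  induction t with
  | leaf a => rfl
  | node g s t hs ht => simp only [leaves, List.length_append, hs, ht, size]; omega

theorem map_bind (f : L → B) (s : A → BTree G L) (t : BTree G A) :
    (t.bind s).map f = t.bind (fun a => (s a).map f) := by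
  induction t with
  | leaf a => rfl
  | node g t t' h h' => simp [map, bind, h, h']

theorem map_injective {f : A → L} (hf : Function.Injective f) :
    Function.Injective (map (G := G) f) := by
  intro s t h
  induction s generalizing t with
  | leaf a =>
    cases t with
    | leaf b => simp only [map, leaf.injEq] at h; rw [hf h]
    | node => simp [map] at h
  | node g a b ha hb =>
    cases t with
    | leaf b => simp [map] at h
    | node g' a' b' =>
      simp only [map, node.injEq] at h
      rw [h.1, ha h.2.1, hb h.2.2]

theorem exists_map_eq (π : L → Prop) (t : BTree G L) (h : ∀ l ∈ t.leaves, π l) :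
    ∃ t' : BTree G {l // π l}, t'.map Subtype.val = t := by
  induction t with
  | leaf l => exact ⟨leaf ⟨l, h l (by simp [leaves])⟩, rfl⟩
  | node g a b ha hb =>
    obtain ⟨a', rfl⟩ := ha (fun l hl => h l (by simp [leaves, hl]))
    obtain ⟨b', rfl⟩ := hb (fun l hl => h l (by simp [leaves, hl]))
    exact ⟨node g a' b', rfl⟩

theorem HasColour.of_map {σ : Signature I} {ψ : A → I} {χ : L → I} (f : A → L)
    (hf : ∀ a, χ (f a) = ψ a) {t : BTree σ.Gen A} {c : I} (h : (t.map f).HasColour σ χ c) :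
    t.HasColour σ ψ c := by
  induction t generalizing c with
  | leaf a => exact (hf a).symm.trans h
  | node g s t hs ht => exact ⟨h.1, hs h.2.1, ht h.2.2⟩

theorem HasColour.of_bind {σ : Signature I} {ψ : A → I} {χ : L → I} {s : A → BTree σ.Gen L}
    {t : BTree σ.Gen A} {c : I} (ht : t.HasColour σ ψ c) (h : (t.bind s).HasColour σ χ c) :
    ∀ a ∈ t.leaves, (s a).HasColour σ χ (ψ a) := by
  induction t generalizing c with
  | leaf a =>
    intro a' ha'
    have hc : ψ a = c := ht
    simp only [leaves, List.mem_singleton] at ha'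
    subst ha' hc
    exact h
  | node g x y hx hy =>
    intro a ha
    rcases List.mem_append.1 ha with ha | ha
    · exact hx ht.2.1 h.2.1 a ha
    · exact hy ht.2.2 h.2.2 a ha

theorem IsShuffle.of_bind [LinearOrder L] {s : A → BTree G L} {t : BTree G A} (h : (t.bind s).IsShuffle) :
    ∀ a ∈ t.leaves, (s a).IsShuffle := by
  induction t with
  | leaf a =>
    intro a' ha'
    simp only [leaves, List.mem_singleton] at ha'
    subst ha'
    exact h
  | node g x y hx hy =>
    intro a ha
    rcases List.mem_append.1 ha with ha | ha
    · exact hx h.2.1 a ha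
    · exact hy h.2.2 a ha

/-! ### Smallest leaves and the shuffle condition -/

section Order

variable [LinearOrder L] [LinearOrder A]

theorem MinLT.trans {a b c : BTree G L} (h : a.MinLT b) (h' : b.MinLT c) : a.MinLT c := by
  obtain ⟨l, hl, h⟩ := h
  obtain ⟨l', hl', h'⟩ := h'
  exact ⟨l, hl, fun x hx => (h l' hl').trans (h' x hx)⟩

theorem MinLT.asymm {a b : BTree G L} (h : a.MinLT b) (h' : b.MinLT a) : False := by
  obtain ⟨l, hl, h⟩ := h.trans h'
  exact lt_irrefl l (h l hl)

theorem exists_min_leaf (t : BTree G L) : ∃ l ∈ t.leaves, ∀ l' ∈ t.leaves, l ≤ l' := by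
  obtain ⟨l, hl, h⟩ := Set.exists_min_image _ id t.leaves.finite_toSet t.exists_mem_leaves
  exact ⟨l, hl, h⟩

theorem minLT_or_minLT {a b : BTree G L} (h : a.leaves.Disjoint b.leaves) :
    a.MinLT b ∨ b.MinLT a := by
  obtain ⟨l, hl, h1⟩ := a.exists_min_leaf
  obtain ⟨m, hm, h2⟩ := b.exists_min_leaf
  rcases lt_trichotomy l m with hlm | hlm | hlm
  · exact Or.inl ⟨l, hl, fun x hx => hlm.trans_le (h2 x hx)⟩
  · subst hlm; exact (h hl hm).elim
  · exact Or.inr ⟨m, hm, fun x hx => hlm.trans_le (h1 x hx)⟩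

theorem MinLT.map {f : A → L} (hf : StrictMono f) {s t : BTree G A} (h : s.MinLT t) :
    (s.map f).MinLT (t.map f) := by
  obtain ⟨l, hl, h⟩ := h
  refine ⟨f l, by rw [leaves_map]; exact List.mem_map_of_mem hl, fun x hx => ?_⟩
  rw [leaves_map, List.mem_map] at hx
  obtain ⟨y, hy, rfl⟩ := hx
  exact hf (h y hy)

theorem MinLT.of_map {f : A → L} (hf : StrictMono f) {s t : BTree G A}
    (h : (s.map f).MinLT (t.map f)) : s.MinLT t := by
  obtain ⟨l, hl, h⟩ := h
  rw [leaves_map, List.mem_map] at hl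
  obtain ⟨y, hy, rfl⟩ := hl
  refine ⟨y, hy, fun x hx => hf.lt_iff_lt.1 (h _ ?_)⟩
  rw [leaves_map]; exact List.mem_map_of_mem hx

/-- The smallest leaf of a shuffle node lies in its first branch. -/
theorem MinLT.of_node_left {g : G} {a b c : BTree G L} (h : (node g a b).MinLT c)
    (hab : a.MinLT b) : a.MinLT c := by
  obtain ⟨l, hl, h⟩ := h
  rcases List.mem_append.1 hl with hl | hl
  · exact ⟨l, hl, h⟩
  · obtain ⟨m, hm, h'⟩ := hab
    exact ⟨m, hm, fun x hx => (h' l hl).trans (h x hx)⟩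

theorem MinLT.of_node_right {g : G} {a b c : BTree G L} (h : a.MinLT (node g b c)) :
    a.MinLT b := by
  obtain ⟨l, hl, h⟩ := h
  exact ⟨l, hl, fun x hx => h x (List.mem_append_left _ hx)⟩

theorem IsShuffle.of_map {f : A → L} (hf : StrictMono f) {t : BTree G A}
    (h : (t.map f).IsShuffle) : t.IsShuffle := by
  induction t with
  | leaf a => trivial
  | node g s t hs ht => exact ⟨MinLT.of_map hf h.1, hs h.2.1, ht h.2.2⟩

end Order

end BTree

/-! ### Decomposition of a monomial as an operadic composition -/

variable {I : Type} {σ : Signature I} {L A : Type} {χ : L → I} {ψ : A → I} {c : I}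

theorem Mon.comp_tree (T : Mon σ ψ c) (π : L → A)
    (t : ∀ a, Mon σ (fun l : {l : L // π l = a} => χ l) (ψ a)) (s : A → BTree σ.Gen L)
    (h : ∀ a, (t a).tree.map Subtype.val = s a) : (T.comp π t).tree = T.tree.bind s := by
  change T.tree.bind _ = _
  congr 1
  funext a
  exact h a

/-- A family of trees with disjoint sets of leaves that cover `L` consists of monomials on the
fibres of a map. -/
theorem exists_fibres (s : A → BTree σ.Gen L) (hc : ∀ a, (s a).HasColour σ χ (ψ a))
    (hn : ∀ a, (s a).leaves.Nodup) (hd : ∀ a a' l, l ∈ (s a).leaves → l ∈ (s a').leaves → a = a')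
    (hm : ∀ l, ∃ a, l ∈ (s a).leaves) :
    ∃ π : L → A, (∀ a l, l ∈ (s a).leaves ↔ π l = a) ∧
      ∃ t : ∀ a, Mon σ (fun l : {l : L // π l = a} => χ l) (ψ a),
        ∀ a, (t a).tree.map Subtype.val = s a := by
  -- The map π sends a letter to the index of the tree in which it occurs; disjointness leaves no
  -- other choice.
  choose π hπ using hm
  have hπ' : ∀ a l, l ∈ (s a).leaves ↔ π l = a :=
    fun a l => ⟨fun h => hd _ _ l (hπ l) h, fun h => h ▸ hπ l⟩
  refine ⟨π, hπ', ?_⟩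
  have key : ∀ a, ∃ t : Mon σ (fun l : {l : L // π l = a} => χ l) (ψ a),
      t.tree.map Subtype.val = s a := by
    intro a
    obtain ⟨t, ht⟩ := BTree.exists_map_eq (fun l => π l = a) (s a) (fun l hl => (hπ' a l).1 hl)
    refine ⟨⟨t, ?_, ?_, ?_⟩, ht⟩
    · exact BTree.HasColour.of_map Subtype.val (fun _ => rfl) (ht ▸ hc a)
    · have := hn a
      rw [← ht, BTree.leaves_map] at this
      exact this.of_map _
    · intro l
      have := (hπ' a l).2 l.2
      rw [← ht, BTree.leaves_map, List.mem_map] at this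
      obtain ⟨l', hl', h⟩ := this
      rwa [← Subtype.ext h]
  exact ⟨fun a => (key a).choose, fun a => (key a).choose_spec⟩

/-- The components of a decomposed monomial. -/
theorem exists_fibres_of_bind (T : Mon σ ψ c) (s : A → BTree σ.Gen L)
    (hc : (T.tree.bind s).HasColour σ χ c) (hn : (T.tree.bind s).leaves.Nodup)
    (hm : ∀ l, l ∈ (T.tree.bind s).leaves) :
    ∃ π : L → A, (∀ a l, l ∈ (s a).leaves ↔ π l = a) ∧
      ∃ t : ∀ a, Mon σ (fun l : {l : L // π l = a} => χ l) (ψ a),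
        ∀ a, (t a).tree.map Subtype.val = s a := by
  rw [BTree.leaves_bind, List.nodup_flatMap] at hn
  refine exists_fibres s (fun a => BTree.HasColour.of_bind T.coloured hc a (T.mem a))
    (fun a => hn.1 a (T.mem a)) ?_ ?_
  · intro a a' l h h'
    by_contra hne
    have : Std.Symm (Function.onFun List.Disjoint fun a => (s a).leaves) := ⟨fun _ _ h => h.symm⟩
    exact hn.2.forall (T.mem a) (T.mem a') hne h h'
  · intro l
    have := hm l
    rw [BTree.leaves_bind, List.mem_flatMap] at this
    obtain ⟨a, -, h⟩ := this
    exact ⟨a, h⟩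

/-- The order of the smallest leaves of the grafted trees is exactly what makes the fibre map
shuffling, and each piece inherits the shuffle condition from the whole tree. It converts
substitution of trees into shuffle composition. -/
theorem exists_shuffle_fibres [LinearOrder L] [LinearOrder A] (T : ShMon σ ψ c)
    (s : A → BTree σ.Gen L) (t : ShMon σ χ c) (ht : t.tree = T.tree.bind s)
    (hlt : ∀ a a', a < a' → (s a).MinLT (s a')) :
    ∃ (π : L → A) (hπ : Shuffling π)
      (u : ∀ a, ShMon σ (fun l : {l : L // π l = a} => χ l) (ψ a)),
        (∀ a, (u a).tree.map Subtype.val = s a) ∧ T.comp π hπ u = t := by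
  obtain ⟨π, hπ, u, hu⟩ := exists_fibres_of_bind T.toMon s (χ := χ) (ht ▸ t.coloured)
    (ht ▸ t.nodup) (ht ▸ t.mem)
  refine ⟨π, ?_, fun a => ⟨u a, ?_⟩, hu, ?_⟩
  · intro a a' h
    obtain ⟨l, hl, h⟩ := hlt a a' h
    exact ⟨l, (hπ a l).1 hl, fun l' hl' => h l' ((hπ a' l').2 hl')⟩
  · refine BTree.IsShuffle.of_map (f := Subtype.val) (fun _ _ h => h) ?_
    rw [hu]
    exact BTree.IsShuffle.of_bind (t := T.tree) (ht ▸ t.shuffle) a (T.mem a)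
  · refine ShMon.ext ?_
    exact (Mon.comp_tree T.toMon π u s hu).trans ht.symm

/-! ### Ideals -/

section Ideals

variable {k : Type u} [Field k]

theorem lmapDomain_sub_single {α β : Type*} (F : α → β) (t : α) (h : α →₀ k) :
    Finsupp.lmapDomain k k F (Finsupp.single t 1 - h) =
      Finsupp.single (F t) 1 - Finsupp.lmapDomain k k F h := by
  rw [map_sub, Finsupp.lmapDomain_apply, Finsupp.mapDomain_single]

theorem isIdeal_idealSpan (R : Set (Rel σ k)) : IsIdeal (idealSpan R) where
  relabel_mem e h f hf := mem_idealSpan.2 fun J hJ hR =>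
    hJ.relabel_mem e h f (mem_idealSpan.1 hf J hJ hR)
  comp_root_mem π t f hf := mem_idealSpan.2 fun J hJ hR =>
    hJ.comp_root_mem π t f (mem_idealSpan.1 hf J hJ hR)
  comp_input_mem π T t a f hf := mem_idealSpan.2 fun J hJ hR =>
    hJ.comp_input_mem π T t a f (mem_idealSpan.1 hf J hJ hR)

theorem elt_mem_idealSpan {R : Set (Rel σ k)} {r : Rel σ k} (hr : r ∈ R) :
    r.elt ∈ idealSpan R _ r.χ r.c :=
  mem_idealSpan.2 fun _ _ hR => hR r hr

theorem mem_shIdealSpan {R : Set (ShRel σ k)} [LinearOrder L] {f : ShFree σ k χ c} :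
    f ∈ shIdealSpan R L χ c ↔
      ∀ J : ShFamily σ k, IsShIdeal J → (∀ r ∈ R, r.elt ∈ J _ r.χ r.c) → f ∈ J L χ c := by
  simp [shIdealSpan, Submodule.mem_iInf]

theorem isShIdeal_shIdealSpan (R : Set (ShRel σ k)) : IsShIdeal (shIdealSpan R) where
  relabel_mem e h f hf := mem_shIdealSpan.2 fun J hJ hR =>
    hJ.relabel_mem e h f (mem_shIdealSpan.1 hf J hJ hR)
  comp_root_mem π hπ t f hf := mem_shIdealSpan.2 fun J hJ hR =>
    hJ.comp_root_mem π hπ t f (mem_shIdealSpan.1 hf J hJ hR)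
  comp_input_mem π hπ T t a f hf := mem_shIdealSpan.2 fun J hJ hR =>
    hJ.comp_input_mem π hπ T t a f (mem_shIdealSpan.1 hf J hJ hR)

theorem elt_mem_shIdealSpan {R : Set (ShRel σ k)} {r : ShRel σ k} (hr : r ∈ R) :
    r.elt ∈ shIdealSpan R _ r.χ r.c :=
  mem_shIdealSpan.2 fun _ _ hR => hR r hr

/-- Two monomials are equivalent if they represent the same operation of the presented operad. -/
def Eqv (R : Set (Rel σ k)) (t t' : Mon σ χ c) : Prop :=
  Finsupp.single t (1 : k) - Finsupp.single t' 1 ∈ idealSpan R L χ c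

namespace Eqv

variable {R : Set (Rel σ k)}

theorem refl (t : Mon σ χ c) : Eqv R t t := by
  simp [Eqv]

theorem symm {t t' : Mon σ χ c} (h : Eqv R t t') : Eqv R t' t := by
  rw [Eqv, ← neg_sub]; exact Submodule.neg_mem _ h

theorem trans {t t' t'' : Mon σ χ c} (h : Eqv R t t') (h' : Eqv R t' t'') : Eqv R t t'' := by
  have := Submodule.add_mem _ h h'
  rwa [sub_add_sub_cancel] at this

theorem of_tree_eq {t t' : Mon σ χ c} (h : t.tree = t'.tree) : Eqv R t t' := by
  rw [Mon.ext h]; exact refl t'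

theorem comp_root {T T' : Mon σ ψ c} (h : Eqv R T T') (π : L → A)
    (t : ∀ a, Mon σ (fun l : {l : L // π l = a} => χ l) (ψ a)) :
    Eqv R (T.comp π t) (T'.comp π t) := by
  have := (isIdeal_idealSpan R).comp_root_mem π t _ h
  rwa [lmapDomain_sub_single, Finsupp.lmapDomain_apply, Finsupp.mapDomain_single] at this

open Classical in
theorem comp_input (T : Mon σ ψ c) (π : L → A)
    (t : ∀ a, Mon σ (fun l : {l : L // π l = a} => χ l) (ψ a)) (a : A)
    {s s' : Mon σ (fun l : {l : L // π l = a} => χ l) (ψ a)} (h : Eqv R s s') :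
    Eqv R (T.comp π (Function.update t a s)) (T.comp π (Function.update t a s')) := by
  have := (isIdeal_idealSpan R).comp_input_mem π T t a _ h
  rwa [lmapDomain_sub_single, Finsupp.lmapDomain_apply, Finsupp.mapDomain_single] at this

-- The ideal axioms change one factor at a time, so the inputs are exchanged one after the other;
-- this is where finiteness of `A` enters.
open Classical in
theorem comp_inputs [Finite A] (T : Mon σ ψ c) (π : L → A)
    (t t' : ∀ a, Mon σ (fun l : {l : L // π l = a} => χ l) (ψ a)) (h : ∀ a, Eqv R (t a) (t' a)) :
    Eqv R (T.comp π t) (T.comp π t') := by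
  have := Fintype.ofFinite A
  suffices H : ∀ s : Finset A, Eqv R (T.comp π t) (T.comp π (fun a => if a ∈ s then t' a else t a)) by
    simpa using H Finset.univ
  intro s
  induction s using Finset.induction_on with
  | empty => simpa using refl _
  | insert a s ha ih =>
    refine ih.trans ?_
    have := comp_input (R := R) T π (fun a => if a ∈ s then t' a else t a) a (h a)
    convert this using 2
    · refine (Function.update_eq_self_iff.2 ?_).symm
      simp [ha]
    · funext b
      by_cases hb : b = a
      · subst hb; simp
      · simp [hb]

/-- Substitution into an equivalence. -/
theorem of_bind {x y : Mon σ ψ c} (h : Eqv R x y) (s : A → BTree σ.Gen L) {t t' : Mon σ χ c}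
    (ht : t.tree = x.tree.bind s) (ht' : t'.tree = y.tree.bind s) : Eqv R t t' := by
  obtain ⟨π, -, u, hu⟩ := exists_fibres_of_bind x s (χ := χ) (ht ▸ t.coloured) (ht ▸ t.nodup)
    (ht ▸ t.mem)
  have := h.comp_root π u
  rwa [Mon.ext ((Mon.comp_tree x π u s hu).trans ht.symm),
    Mon.ext ((Mon.comp_tree y π u s hu).trans ht'.symm)] at this

end Eqv

/-! ### Operations of presented operads -/

/-- The canonical map from the free operad. -/
noncomputable def presentedMk (R : Set (Rel σ k)) (χ : L → I) (c : I) :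
    Free σ k χ c →ₗ[k] (presented R).obj L χ c :=
  (idealSpan R L χ c).mkQ

theorem presentedMk_surjective (R : Set (Rel σ k)) (χ : L → I) (c : I) :
    Function.Surjective (presentedMk R χ c) :=
  Submodule.mkQ_surjective _

theorem presentedMk_eq_zero {R : Set (Rel σ k)} {f : Free σ k χ c} :
    presentedMk R χ c f = 0 ↔ f ∈ idealSpan R L χ c :=
  Submodule.Quotient.mk_eq_zero _

/-- The operation represented by a monomial. -/
noncomputable def op (R : Set (Rel σ k)) (t : Mon σ χ c) : (presented R).obj L χ c :=
  presentedMk R χ c (Finsupp.single t 1)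

theorem Eqv.op_eq {R : Set (Rel σ k)} {t t' : Mon σ χ c} (h : Eqv R t t') : op R t = op R t' := by
  rw [← sub_eq_zero, op, op, ← map_sub]
  exact presentedMk_eq_zero.2 h

theorem span_range_op (R : Set (Rel σ k)) (χ : L → I) (c : I) :
    Submodule.span k (Set.range (op R (χ := χ) (c := c))) = ⊤ := by
  have h : Set.range (op R (χ := χ) (c := c)) =
      presentedMk R χ c '' Set.range (fun t => Finsupp.single t (1 : k)) := by
    rw [← Set.range_comp]; rfl
  have h' : Submodule.span k (Set.range (fun t : Mon σ χ c => Finsupp.single t (1 : k))) = ⊤ := by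
    have := (Finsupp.basisSingleOne (R := k) (ι := Mon σ χ c)).span_eq
    rwa [Finsupp.coe_basisSingleOne] at this
  rw [h, ← Submodule.map_span, h', Submodule.map_top, LinearMap.range_eq_top]
  exact presentedMk_surjective R χ c

theorem presented_map_op {L' : Type} {χ' : L' → I} {c' : I} (R : Set (Rel σ k)) (e : L ≃ L')
    (h : ∀ l, χ' (e l) = χ l) (hc : c = c') (t : Mon σ χ c) :
    (presented R).map e h hc (op R t) = op R (t.relabel e h hc) := by
  refine Eq.trans (b := presentedMk R χ' c'
    (Finsupp.lmapDomain k k (Mon.relabel e h hc) (Finsupp.single t 1))) rfl ?_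
  rw [Finsupp.lmapDomain_apply, Finsupp.mapDomain_single]
  rfl

/-- A linear map on a presented operad from its values on monomials. -/
noncomputable def opLift {W : Type*} [AddCommGroup W] [Module k W] (R : Set (Rel σ k))
    (φ : Mon σ χ c → W)
    (h : ∀ f ∈ idealSpan R L χ c, Finsupp.linearCombination k φ f = 0) :
    (presented R).obj L χ c →ₗ[k] W :=
  (idealSpan R L χ c).liftQ (Finsupp.linearCombination k φ) h

theorem opLift_op {W : Type*} [AddCommGroup W] [Module k W] (R : Set (Rel σ k))
    (φ : Mon σ χ c → W)
    (h : ∀ f ∈ idealSpan R L χ c, Finsupp.linearCombination k φ f = 0) (t : Mon σ χ c) :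
    opLift R φ h (op R t) = φ t := by
  refine (Submodule.liftQ_apply _ _ _).trans ?_
  rw [Finsupp.linearCombination_single, one_smul]

theorem op_induction {R : Set (Rel σ k)} {p : (presented R).obj L χ c → Prop}
    (hop : ∀ t, p (op R t)) (h0 : p 0) (hadd : ∀ x y, p x → p y → p (x + y))
    (hsmul : ∀ (r : k) x, p x → p (r • x)) (x : (presented R).obj L χ c) : p x := by
  have hx : x ∈ Submodule.span k (Set.range (op R (χ := χ) (c := c))) :=
    span_range_op R χ c ▸ Submodule.mem_top
  induction hx using Submodule.span_induction with
  | mem x hx => obtain ⟨t, rfl⟩ := hx; exact hop t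
  | zero => exact h0
  | add x y _ _ hx hy => exact hadd x y hx hy
  | smul r x _ hx => exact hsmul r x hx

end Ideals

/-! ### Commutative algebras with derivations as models of `DCom` -/

section Model

variable {k : Type u} [Field k] {L B : Type}
variable (A : Type*) [CommRing A] [Algebra k A]

variable (k) in
/-- The value of a tree in a commutative algebra with all its derivations. A pair of an element and
a derivation serves as a value for both colours. -/
noncomputable def evalTree (v : L → A × Derivation k A A) :
    BTree DComGen L → A × Derivation k A A
  | .leaf l => v l
  | .node .al a b => ((evalTree v a).1 * (evalTree v b).1, 0)
  | .node .d a b => ((evalTree v b).2 (evalTree v a).1, 0)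

variable {A}

theorem evalTree_map (f : B → L) (v : L → A × Derivation k A A) (t : BTree DComGen B) :
    evalTree k A v (t.map f) = evalTree k A (fun b => v (f b)) t := by
  induction t with
  | leaf a => rfl
  | node g a b ha hb => cases g <;> simp [BTree.map, evalTree, ha, hb]

theorem evalTree_bind (s : B → BTree DComGen L) (v : L → A × Derivation k A A)
    (t : BTree DComGen B) :
    evalTree k A v (t.bind s) = evalTree k A (fun b => evalTree k A v (s b)) t := by
  induction t with
  | leaf a => rfl
  | node g a b ha hb => cases g <;> simp [BTree.bind, evalTree, ha, hb]

theorem evalTree_congr {v w : L → A × Derivation k A A} {t : BTree DComGen L}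
    (h : ∀ l ∈ t.leaves, v l = w l) : evalTree k A v t = evalTree k A w t := by
  induction t with
  | leaf a => exact h a (by simp [BTree.leaves])
  | node g a b ha hb =>
    have h1 := ha (fun l hl => h l (List.mem_append_left _ hl))
    have h2 := hb (fun l hl => h l (List.mem_append_right _ hl))
    cases g <;> simp [evalTree, h1, h2]

/-- Every vertex is bilinear, and since a label occurs only once, one of its two branches does not
depend on the varied value. This is what makes `evalIdeal` stable under composition in an input. -/
theorem isLinearMap_evalTree (w : (A × Derivation k A A) → L → A × Derivation k A A)
    {t : BTree DComGen L} (a : L) (hn : t.leaves.Nodup) (ha : a ∈ t.leaves)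
    (hw : ∀ z, w z a = z) (hw' : ∀ z z' l, l ≠ a → w z l = w z' l) :
    IsLinearMap k (fun z => evalTree k A (w z) t) := by
  induction t with
  | leaf l =>
    simp only [BTree.leaves, List.mem_singleton] at ha
    subst ha
    simp only [evalTree, hw]
    exact ⟨fun _ _ => rfl, fun _ _ => rfl⟩
  | node g x y hx hy =>
    have hn' : x.leaves.Nodup ∧ y.leaves.Nodup ∧ x.leaves.Disjoint y.leaves := by
      simpa [BTree.leaves, List.nodup_append'] using hn
    rcases List.mem_append.1 ha with ha | ha
    · obtain ⟨h1, h2⟩ := hx hn'.1 ha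
      have hy0 : ∀ z, evalTree k A (w z) y = evalTree k A (w 0) y := fun z =>
        evalTree_congr fun l hl => hw' _ _ _ (by rintro rfl; exact hn'.2.2 ha hl)
      constructor
      · intro z z'
        cases g <;> simp [evalTree, h1, hy0 z, hy0 z', hy0 (z + z'), add_mul]
      · intro r z
        cases g <;> simp [evalTree, h2, hy0 z, hy0 (r • z)]
    · obtain ⟨h1, h2⟩ := hy hn'.2.1 ha
      have hx0 : ∀ z, evalTree k A (w z) x = evalTree k A (w 0) x := fun z =>
        evalTree_congr fun l hl => hw' _ _ _ (by rintro rfl; exact hn'.2.2 hl ha)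
      constructor
      · intro z z'
        cases g <;> simp [evalTree, h1, hx0 z, hx0 z', hx0 (z + z'), mul_add]
      · intro r z
        cases g <;> simp [evalTree, h2, hx0 z, hx0 (r • z)]

/-- The value of an element of the free operad. -/
noncomputable def evalFree (v : L → A × Derivation k A A) (χ : L → Fin 2) (c : Fin 2) :
    Free dcomSig k χ c →ₗ[k] A × Derivation k A A :=
  Finsupp.linearCombination k (fun t => evalTree k A v t.tree)

theorem evalFree_single {χ : L → Fin 2} {c : Fin 2} (v : L → A × Derivation k A A)
    (t : Mon dcomSig χ c) :
    evalFree v χ c (Finsupp.single t 1) = evalTree k A v t.tree := by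
  rw [evalFree, Finsupp.linearCombination_single, one_smul]

theorem evalFree_lmapDomain {χ : L → Fin 2} {c : Fin 2} {χ' : B → Fin 2} {c' : Fin 2}
    (v : L → A × Derivation k A A) (F : Mon dcomSig χ' c' → Mon dcomSig χ c)
    (f : Free dcomSig k χ' c') :
    evalFree v χ c (Finsupp.lmapDomain k k F f) =
      Finsupp.linearCombination k (fun t => evalTree k A v (F t).tree) f := by
  rw [evalFree, Finsupp.lmapDomain_apply, Finsupp.linearCombination_mapDomain]
  rfl

variable (k A) in
/-- The relations that hold in the algebra `A` and its derivations. -/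
noncomputable def evalIdeal : Family dcomSig k := fun L χ c =>
  ⨅ v : L → A × Derivation k A A, LinearMap.ker (evalFree v χ c)

theorem mem_evalIdeal {χ : L → Fin 2} {c : Fin 2} {f : Free dcomSig k χ c} :
    f ∈ evalIdeal k A L χ c ↔ ∀ v : L → A × Derivation k A A, evalFree v χ c f = 0 := by
  simp [evalIdeal, Submodule.mem_iInf]

theorem evalTree_comp {χ : L → Fin 2} {ψ : B → Fin 2} {c : Fin 2} (v : L → A × Derivation k A A)
    (T : Mon dcomSig ψ c) (π : L → B)
    (t : ∀ a, Mon dcomSig (fun l : {l : L // π l = a} => χ l) (ψ a)) :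
    evalTree k A v (T.comp π t).tree =
      evalTree k A (fun a => evalTree k A (fun l : {l : L // π l = a} => v l) (t a).tree)
        T.tree := by
  refine (evalTree_bind _ _ _).trans ?_
  congr 1
  funext a
  exact evalTree_map _ _ _

-- Evaluation turns composition into substitution of values. For relabelling and for composition at
-- the root this only changes the valuation; composition in an input needs linearity of the value in
-- that input.
variable (k A) in
theorem isIdeal_evalIdeal : IsIdeal (evalIdeal k A) where
  relabel_mem e h f hf := by
    rw [mem_evalIdeal] at hf ⊢
    intro v
    rw [evalFree_lmapDomain, ← hf (fun l => v (e l))]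
    exact congrArg (fun φ => Finsupp.linearCombination k φ f)
      (funext fun t => evalTree_map e v t.tree)
  comp_root_mem π t f hf := by
    rw [mem_evalIdeal] at hf ⊢
    intro v
    rw [evalFree_lmapDomain]
    simp only [evalTree_comp]
    exact hf _
  comp_input_mem := by
    intro L B χ ψ c π T t a f hf
    rw [mem_evalIdeal] at hf ⊢
    intro v
    rw [evalFree_lmapDomain]
    simp only [evalTree_comp]
    classical
    -- The values at the inputs of `T` when the factor at `a` has the value `z` and the other
    -- factors are fixed.
    let w : (A × Derivation k A A) → B → A × Derivation k A A := fun z b =>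
      if b = a then z else evalTree k A (fun l : {l : L // π l = b} => v l) (t b).tree
    have hlin := isLinearMap_evalTree w (t := T.tree) a T.nodup (T.mem a) (by simp [w])
      (fun z z' l hl => by simp [w, hl])
    have key : ∀ s : Mon dcomSig (fun l : {l : L // π l = a} => χ l) (ψ a),
        (fun b => evalTree k A (fun l : {l : L // π l = b} => v l)
          (Function.update t a s b).tree) =
        w (evalTree k A (fun l : {l : L // π l = a} => v l) s.tree) := by
      intro s
      funext b
      by_cases hb : b = a
      · subst hb; simp [w]
      · simp [w, hb]
    have h0 := hf (fun l => v l)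
    -- The value of `f` vanishes, and the value of the composition is a linear function of it.
    have h1 := congrArg (IsLinearMap.mk' _ hlin) h0
    rw [map_zero, evalFree, Finsupp.linearCombination_apply, map_finsuppSum] at h1
    rw [Finsupp.linearCombination_apply, ← h1]
    refine Finsupp.sum_congr fun s _ => ?_
    rw [map_smul]
    congr 1
    refine Eq.trans ?_ (congrArg (fun w => evalTree k A w T.tree) (key s))
    congr!

theorem dcomRels_evalIdeal (r : Rel dcomSig k) (hr : r ∈ dcomRels k) :
    r.elt ∈ evalIdeal k A _ r.χ r.c := by
  rw [mem_evalIdeal]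
  intro v
  rcases hr with rfl | rfl | rfl
  · refine (map_sub (evalFree v _ _) _ _).trans ?_
    refine (congrArg₂ _ (evalFree_single v _) (evalFree_single v _)).trans (sub_eq_zero.2 ?_)
    exact Prod.ext (mul_comm _ _) rfl
  · refine (map_sub (evalFree v _ _) _ _).trans ?_
    refine (congrArg₂ _ (evalFree_single v _) (evalFree_single v _)).trans (sub_eq_zero.2 ?_)
    exact Prod.ext (mul_assoc _ _ _) rfl
  · refine (map_sub (evalFree v _ _) _ _).trans ?_
    refine (congrArg₂ _ (evalFree_single v _) ((map_add (evalFree v _ _) _ _).trans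
      (congrArg₂ _ (evalFree_single v _) (evalFree_single v _)))).trans (sub_eq_zero.2 ?_)
    refine Prod.ext ?_ (add_zero _).symm
    refine (Derivation.leibniz _ _ _).trans ?_
    exact congrArg₂ _ rfl (mul_comm _ _)

theorem evalFree_eq_zero {χ : L → Fin 2} {c : Fin 2} (v : L → A × Derivation k A A)
    {f : Free dcomSig k χ c} (hf : f ∈ idealSpan (dcomRels k) L χ c) : evalFree v χ c f = 0 :=
  mem_evalIdeal.1 (mem_idealSpan.1 hf _ (isIdeal_evalIdeal k A) dcomRels_evalIdeal) v

end Model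

/-! ### The universal differential algebra -/

section Universal

variable (k : Type u) [Field k] {L L' : Type}

/-- The polynomial algebra on the symbols `w(x)`, where `w` is a word in derivations. -/
abbrev DPoly (L : Type) : Type u := MvPolynomial (L × List L) k

/-- The derivation named `l`. -/
noncomputable def letterDer (l : L) : Derivation k (DPoly k L) (DPoly k L) :=
  MvPolynomial.mkDerivation k (fun p => MvPolynomial.X (p.1, l :: p.2))

/-- A valuation ignores colours, so each letter gets both an element and a derivation. The first
component also keeps the identity operation of the second colour visible to `dcomEval`, which
forgets the derivation. -/
noncomputable def stdVal (l : L) : DPoly k L × Derivation k (DPoly k L) (DPoly k L) :=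
  (MvPolynomial.X (l, []), letterDer k l)

/-- Renaming of letters. -/
noncomputable def letterMap (f : L → L') : DPoly k L →ₐ[k] DPoly k L' :=
  MvPolynomial.rename (Prod.map f (List.map f))

/-- Both sides are additive in `p` and obey the same Leibniz rule along the algebra map `letterMap k
f`, so it is enough that they agree on constants and variables. -/
theorem letterMap_letterDer (f : L → L') (l : L) (p : DPoly k L) :
    letterMap k f (letterDer k l p) = letterDer k (f l) (letterMap k f p) := by
  induction p using MvPolynomial.induction_on with
  | C a => simp [letterMap]
  | add p q hp hq => simp only [map_add, hp, hq]
  | mul_X p i hp =>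
    have hX : letterMap k f (letterDer k l (MvPolynomial.X i)) =
        letterDer k (f l) (letterMap k f (MvPolynomial.X i)) := by
      simp [letterMap, letterDer, MvPolynomial.mkDerivation_X]
    simp only [Derivation.leibniz, map_mul, map_add, smul_eq_mul, hp, hX]

/-- The polynomial at a vertex `d` involves the derivation given by its second branch, so the two
components must go through the induction together. The derivations live on different algebras and
can only be compared by intertwining. -/
theorem evalTree_stdVal_map (f : L → L') (t : BTree DComGen L) :
    (evalTree k _ (stdVal k) (t.map f)).1 = letterMap k f (evalTree k _ (stdVal k) t).1 ∧
    ∀ p, letterMap k f ((evalTree k _ (stdVal k) t).2 p) =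
      (evalTree k _ (stdVal k) (t.map f)).2 (letterMap k f p) := by
  induction t with
  | leaf l =>
    refine ⟨by simp [evalTree, BTree.map, stdVal, letterMap], fun p => ?_⟩
    exact letterMap_letterDer k f l p
  | node g a b ha hb =>
    cases g with
    | al => simp [evalTree, BTree.map, ha.1, hb.1]
    | d => simp [evalTree, BTree.map, ha.1, hb.2]

/-- The value in the universal differential algebra. -/
noncomputable def dcomEval (L : Type) (χ : L → Fin 2) (c : Fin 2) :
    (presented (dcomRels k)).obj L χ c →ₗ[k] DPoly k L :=
  opLift (dcomRels k) (fun t => (evalTree k _ (stdVal k) t.tree).1) (fun f hf => by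
    have := congrArg (LinearMap.fst k (DPoly k L) (Derivation k (DPoly k L) (DPoly k L)))
      (evalFree_eq_zero (stdVal k) hf)
    rw [map_zero, evalFree, Finsupp.linearCombination_apply, map_finsuppSum] at this
    rw [Finsupp.linearCombination_apply, ← this]
    rfl)

theorem dcomEval_op {χ : L → Fin 2} {c : Fin 2} (t : Mon dcomSig χ c) :
    dcomEval k L χ c (op (dcomRels k) t) = (evalTree k _ (stdVal k) t.tree).1 :=
  opLift_op _ _ _ _

theorem dcomEval_map {χ : L → Fin 2} {χ' : L' → Fin 2} {c c' : Fin 2} (e : L ≃ L')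
    (h : ∀ l, χ' (e l) = χ l) (hc : c = c') (x : (presented (dcomRels k)).obj L χ c) :
    dcomEval k L' χ' c' ((presented (dcomRels k)).map e h hc x) =
      letterMap k e (dcomEval k L χ c x) := by
  induction x using op_induction with
  | h0 => simp only [map_zero]
  | hadd x y hx hy => simp only [map_add, hx, hy]
  | hsmul r x hx => simp only [map_smul, hx]
  | hop t =>
    rw [presented_map_op, dcomEval_op, dcomEval_op]
    exact (evalTree_stdVal_map k e t.tree).1

/-- The monomial with a given multiset of factors. -/
noncomputable def mono (S : Multiset (L × List L)) : DPoly k L := (S.map MvPolynomial.X).prod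

theorem mono_eq_monomial (S : Multiset (L × List L)) [DecidableEq (L × List L)] :
    mono k S = MvPolynomial.monomial (Multiset.toFinsupp S) 1 := by
  induction S using Multiset.induction_on with
  | empty => simp [mono]
  | cons a S ih =>
    rw [mono, Multiset.map_cons, Multiset.prod_cons, ← mono, ih, ← Multiset.singleton_add,
      map_add, Multiset.toFinsupp_singleton, MvPolynomial.X, MvPolynomial.monomial_mul, one_mul]

theorem linearIndependent_mono : LinearIndependent k (mono k (L := L)) := by
  classical
  have : mono k (L := L) = MvPolynomial.basisMonomials (L × List L) k ∘ Multiset.toFinsupp := by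
    funext S
    simp [mono_eq_monomial]
  rw [this]
  exact (MvPolynomial.basisMonomials _ k).linearIndependent.comp _ Multiset.toFinsupp.injective

end Universal

/-! ### Linear maps that are monomial on a spanning family -/

/-- By `hb`, keeping one index for each value of `b` loses no vector of the spanning family, and the
vectors kept have independent images. The criterion serves both `DCom` and `Com ∘ F(d)`. -/
theorem injective_of_span {k V W J β : Type*} [Field k] [AddCommGroup V] [Module k V]
    [AddCommGroup W] [Module k W] (v : J → V) (hv : Submodule.span k (Set.range v) = ⊤)
    (ev : V →ₗ[k] W) (b : J → β) (m : β → W) (hm : LinearIndependent k m)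
    (h : ∀ j, ev (v j) = m (b j)) (hb : ∀ j j', b j = b j' → v j = v j') :
    Function.Injective ev := by
  choose sec hsec using fun s : Set.range b => s.2
  have hspan : Submodule.span k (Set.range fun s => v (sec s)) = ⊤ := by
    rw [← hv]
    congr 1
    ext x
    constructor
    · rintro ⟨s, rfl⟩; exact ⟨_, rfl⟩
    · rintro ⟨j, rfl⟩
      exact ⟨⟨b j, j, rfl⟩, hb _ _ (hsec ⟨b j, j, rfl⟩)⟩
  rw [injective_iff_map_eq_zero]
  intro x hx
  have hx' : x ∈ Submodule.span k (Set.range fun s => v (sec s)) := hspan ▸ Submodule.mem_top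
  rw [Finsupp.mem_span_range_iff_exists_finsupp] at hx'
  obtain ⟨a, rfl⟩ := hx'
  have : a = 0 := by
    have hm' : LinearIndependent k (fun s : Set.range b => m s) :=
      hm.comp _ Subtype.val_injective
    refine linearIndependent_iff.1 hm' a ?_
    rw [Finsupp.linearCombination_apply, ← hx, map_finsuppSum]
    refine Finsupp.sum_congr fun s _ => ?_
    rw [map_smul, h, hsec]
  simp [this]

theorem range_of_span {k V W J : Type*} [Field k] [AddCommGroup V] [Module k V]
    [AddCommGroup W] [Module k W] (v : J → V) (hv : Submodule.span k (Set.range v) = ⊤)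
    (ev : V →ₗ[k] W) (S : Set W) (h : ∀ j, ev (v j) ∈ S) (h' : ∀ w ∈ S, ∃ x, ev x = w) :
    LinearMap.range ev = Submodule.span k S := by
  refine le_antisymm ?_ (Submodule.span_le.2 fun w hw => h' w hw)
  rw [LinearMap.range_eq_map, ← hv, Submodule.map_span, Submodule.span_le]
  rintro _ ⟨_, ⟨j, rfl⟩, rfl⟩
  exact Submodule.subset_span (h j)

/-! ### The QM-ordering -/

namespace QMon

theorem LT.trans {u v w : QMon} (h : u.LT v) (h' : v.LT w) : u.LT w := by
  unfold QMon.LT at *; omega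

theorem LT.irrefl (u : QMon) : ¬ u.LT u := by
  unfold QMon.LT; omega

/-- Exponents of x and y add, and the cross term enters only the exponent of q. That exponent is
compared when the other two agree, and then the cross terms agree as well. -/
theorem LT.mul_right {u v : QMon} (h : u.LT v) (w : QMon) : (u.mul w).LT (v.mul w) := by
  obtain ⟨a, b, c⟩ := u
  obtain ⟨a', b', c'⟩ := v
  simp only [QMon.LT, mul] at *
  rcases h with h | ⟨rfl, h⟩ | ⟨rfl, rfl, h⟩ <;> omega

theorem LT.mul_left {u v : QMon} (h : u.LT v) (w : QMon) : (w.mul u).LT (w.mul v) := by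
  obtain ⟨a, b, c⟩ := u
  obtain ⟨a', b', c'⟩ := v
  simp only [QMon.LT, mul] at *
  rcases h with h | ⟨rfl, h⟩ | ⟨rfl, rfl, h⟩ <;> omega

theorem mul_assoc (u v w : QMon) : (u.mul v).mul w = u.mul (v.mul w) := by
  ext <;> simp only [mul] <;> ring

theorem one_mul (u : QMon) : mul ⟨0, 0, 0⟩ u = u := by
  ext <;> simp [mul]

end QMon

section

variable {L A : Type}

theorem pathQ_map [DecidableEq L] [DecidableEq A] {f : A → L} (hf : Function.Injective f)
    (t : BTree ShGen A) (a : A) : pathQ (t.map f) (f a) = pathQ t a := by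
  induction t with
  | leaf b => rfl
  | node g s t hs ht =>
    have : f a ∈ (s.map f).leaves ↔ a ∈ s.leaves := by
      rw [BTree.leaves_map, List.mem_map_of_injective hf]
    simp only [BTree.map, pathQ, hs, ht, this]

/-- The path to `l` in the grafted tree is the path to `π l` in `T` followed by the path inside the
tree grafted there, and `QMon.mul` is associative. -/
theorem pathQ_bind [DecidableEq L] [DecidableEq A] {π : L → A} {s : A → BTree ShGen L}
    (h : ∀ a l, l ∈ (s a).leaves ↔ π l = a) (T : BTree ShGen A) (l : L) (hl : π l ∈ T.leaves) :
    pathQ (T.bind s) l = (pathQ T (π l)).mul (pathQ (s (π l)) l) := by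
  induction T with
  | leaf a =>
    simp only [BTree.leaves, List.mem_singleton] at hl
    simp [BTree.bind, pathQ, QMon.one_mul, hl]
  | node g u v hu hv =>
    have hmem : l ∈ (u.bind s).leaves ↔ π l ∈ u.leaves := by
      rw [BTree.leaves_bind, List.mem_flatMap]
      simp [h]
    simp only [BTree.bind, pathQ, hmem]
    by_cases h' : π l ∈ u.leaves
    · simp only [h', if_true, hu h', QMon.mul_assoc]
    · simp only [h', if_false, hv ((List.mem_append.1 hl).resolve_left h'), QMon.mul_assoc]

theorem pathQ_comp [LinearOrder L] [LinearOrder A] {χ : L → Fin 2} {ψ : A → Fin 2} {c : Fin 2}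
    (T : ShMon shSig ψ c) (π : L → A) (hπ : Shuffling π)
    (t : ∀ a, ShMon shSig (fun l : {l : L // π l = a} => χ l) (ψ a)) (l : L) :
    pathQ (T.comp π hπ t).tree l =
      (pathQ T.tree (π l)).mul (pathQ (t (π l)).tree ⟨l, rfl⟩) := by
  have h : ∀ a l, l ∈ ((t a).tree.map Subtype.val).leaves ↔ π l = a := by
    intro a l
    rw [BTree.leaves_map, List.mem_map]
    exact ⟨fun ⟨x, _, hx⟩ => hx ▸ x.2, fun h => ⟨⟨l, h⟩, (t a).mem _, rfl⟩⟩
  refine (pathQ_bind h T.tree l (T.mem _)).trans ?_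
  exact congrArg _ (pathQ_map Subtype.val_injective (t (π l)).tree ⟨l, rfl⟩)

/-- A first difference at the input `i` moves to the smallest leaf of the factor grafted at `i`.
Because π is shuffling, every smaller leaf lies over an input smaller than `i`, where the two paths
coincide. -/
theorem QMLT.comp_root [LinearOrder L] [LinearOrder A] {χ : L → Fin 2} {ψ : A → Fin 2} {c : Fin 2}
    {T T' : ShMon shSig ψ c} (h : QMLT T T') (π : L → A) (hπ : Shuffling π)
    (t : ∀ a, ShMon shSig (fun l : {l : L // π l = a} => χ l) (ψ a)) :
    QMLT (T.comp π hπ t) (T'.comp π hπ t) := by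
  obtain ⟨i, h1, h2⟩ := h
  obtain ⟨l, -, hmin⟩ := (t i).tree.exists_min_leaf
  refine ⟨l, fun j hj => ?_, ?_⟩
  · rw [pathQ_comp, pathQ_comp, h1]
    by_contra hij
    rcases (not_lt.1 hij).eq_or_lt with h | h
    · exact (hmin ⟨j, h.symm⟩ ((t i).mem _)).not_gt hj
    · obtain ⟨m, hm, hlt⟩ := hπ _ _ h
      have := hmin ⟨m, hm⟩ ((t i).mem _)
      exact (hlt j rfl).not_ge ((le_of_lt hj).trans this)
  · rw [pathQ_comp, pathQ_comp]
    have hl : π l = i := l.2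
    exact QMon.LT.mul_right (by rw [hl]; exact h2) _

/-- Paths to leaves outside the fibre over `a` do not change; on the fibre the common path in `T`
multiplies from the left. -/
theorem QMLT.comp_input [LinearOrder L] [LinearOrder A] {χ : L → Fin 2} {ψ : A → Fin 2}
    {c : Fin 2} (π : L → A) (hπ : Shuffling π) (T : ShMon shSig ψ c)
    (t : ∀ a, ShMon shSig (fun l : {l : L // π l = a} => χ l) (ψ a)) (a : A)
    {s s' : ShMon shSig (fun l : {l : L // π l = a} => χ l) (ψ a)} (h : QMLT s s') :
    QMLT (T.comp π hπ (Function.update t a s)) (T.comp π hπ (Function.update t a s')) := by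
  obtain ⟨⟨i, rfl⟩, h1, h2⟩ := h
  refine ⟨i, fun j hj => ?_, ?_⟩
  · rw [pathQ_comp, pathQ_comp]
    congr 1
    by_cases hji : π j = π i
    · have key : ∀ a (ha : π j = a) (u u' : ShMon shSig (fun l : {l : L // π l = a} => χ l) (ψ a)),
          pathQ u.tree ⟨j, ha⟩ = pathQ u'.tree ⟨j, ha⟩ →
          pathQ (Function.update t a u (π j)).tree ⟨j, rfl⟩ =
            pathQ (Function.update t a u' (π j)).tree ⟨j, rfl⟩ := by
        rintro a rfl u u' h
        simpa using h
      exact key (π i) hji s s' (h1 ⟨j, hji⟩ hj)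
    · rw [Function.update_of_ne hji, Function.update_of_ne hji]
  · rw [pathQ_comp, pathQ_comp]
    refine QMon.LT.mul_left ?_ _
    rw [Function.update_self, Function.update_self]
    exact h2

theorem qmAdmissible : QMAdmissible :=
  ⟨fun π hπ _ _ t h => h.comp_root π hπ t, fun π hπ T t a _ _ h => h.comp_input π hπ T t a⟩

variable [LinearOrder L] {χ : L → Fin 2} {c : Fin 2}

theorem QMLT.irrefl (s : ShMon shSig χ c) : ¬ QMLT s s :=
  fun ⟨_, _, h⟩ => QMon.LT.irrefl _ h

theorem QMLT.trans {s t u : ShMon shSig χ c} (h : QMLT s t) (h' : QMLT t u) : QMLT s u := by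
  obtain ⟨i, h1, h2⟩ := h
  obtain ⟨j, h3, h4⟩ := h'
  rcases lt_trichotomy i j with hij | rfl | hij
  · exact ⟨i, fun m hm => (h1 m hm).trans (h3 m (hm.trans hij)), h3 i hij ▸ h2⟩
  · exact ⟨i, fun m hm => (h1 m hm).trans (h3 m hm), h2.trans h4⟩
  · exact ⟨j, fun m hm => (h1 m (hm.trans hij)).trans (h3 m hm), h1 j hij ▸ h4⟩

end

/-! ### Finiteness of the sets of monomials -/

section Finiteness

variable {I : Type} {σ : Signature I} {L : Type} {χ : L → I} {c : I}

theorem BTree.finite_size_le {G : Type} [Finite G] [Finite L] (n : ℕ) :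
    {t : BTree G L | t.size ≤ n}.Finite := by
  induction n with
  | zero =>
    refine (Set.finite_range BTree.leaf).subset ?_
    rintro (l | ⟨g, a, b⟩) ht
    · exact ⟨l, rfl⟩
    · simp [BTree.size] at ht
  | succ n ih =>
    refine ((Set.finite_range BTree.leaf).union
      (((Set.finite_univ (α := G)).prod (ih.prod ih)).image
        (fun p => BTree.node p.1 p.2.1 p.2.2))).subset ?_
    rintro (l | ⟨g, a, b⟩) ht
    · exact Or.inl ⟨l, rfl⟩
    · simp only [BTree.size, Set.mem_ofPred_eq] at ht
      refine Or.inr ⟨(g, a, b), ⟨trivial, ?_, ?_⟩, rfl⟩ <;> simp only [Set.mem_ofPred_eq] <;> omega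

theorem Mon.finite_inputs (t : Mon σ χ c) : Finite L :=
  Set.finite_univ_iff.1 (t.tree.leaves.finite_toSet.subset fun l _ => t.mem l)

theorem Mon.size_eq (t : Mon σ χ c) : t.tree.size + 1 = Nat.card L := by
  classical
  have := t.finite_inputs
  have := Fintype.ofFinite L
  rw [← BTree.length_leaves, Nat.card_eq_fintype_card, ← List.toFinset_card_of_nodup t.nodup,
    ← Finset.card_univ]
  congr 1
  ext l
  simp [t.mem]

instance [Finite σ.Gen] [Finite L] : Finite (Mon σ χ c) := by
  have := (BTree.finite_size_le (G := σ.Gen) (L := L) (Nat.card L)).to_subtype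
  refine Finite.of_injective
    (fun t : Mon σ χ c => (⟨t.tree, by have := t.size_eq; simp only [Set.mem_ofPred_eq]; omega⟩ :
      {t : BTree σ.Gen L | t.size ≤ Nat.card L})) ?_
  intro t t' h
  exact Mon.ext (congrArg Subtype.val h)

instance [LinearOrder L] [Finite σ.Gen] [Finite L] : Finite (ShMon σ χ c) :=
  Finite.of_injective ShMon.toMon fun _ _ h => ShMon.ext (congrArg Mon.tree h)

instance : Finite shSig.Gen :=
  Finite.of_injective (β := Fin 3) (fun | .al => 0 | .d => 1 | .e => 2)
    (by intro a b; cases a <;> cases b <;> first | exact fun _ => rfl | simp)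

instance : Finite dcomSig.Gen :=
  Finite.of_injective (β := Fin 2) (fun | .al => 0 | .d => 1)
    (by intro a b; cases a <;> cases b <;> first | exact fun _ => rfl | simp)

/-- The number of inputs fixes the number of vertices, so there are finitely many monomials, and a
transitive irreflexive relation on a finite set is well founded. -/
theorem wellFounded_QMLT [LinearOrder L] [Finite L] {χ : L → Fin 2} {c : Fin 2} :
    WellFounded (QMLT (χ := χ) (c := c)) := by
  have : IsTrans (ShMon shSig χ c) QMLT := ⟨fun _ _ _ => QMLT.trans⟩
  have : Std.Irrefl (α := ShMon shSig χ c) QMLT := ⟨QMLT.irrefl⟩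
  exact Finite.wellFounded_of_trans_of_irrefl _

end Finiteness

open BTree

/-! ### The quadratic rewriting rules -/

section Rules

/-- The quadratic monomials that are rewritten:
`α(0, α(1, 2))`, `α(α(0, 2), 1)`, `d(α(0, 1), 2)`, `d(α(0, 2), 1)` and `e(0, α(1, 2))`. -/
inductive Rule | assoc | comm | leibLast | leibMid | leibFirst

namespace Rule

def col : Rule → Fin 3 → Fin 2
  | assoc => ![0, 0, 0]
  | comm => ![0, 0, 0]
  | leibLast => ![0, 0, 1]
  | leibMid => ![0, 1, 0]
  | leibFirst => ![1, 0, 0]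

def lhsTree : Rule → BTree ShGen (Fin 3)
  | assoc => node .al (leaf 0) (node .al (leaf 1) (leaf 2))
  | comm => node .al (node .al (leaf 0) (leaf 2)) (leaf 1)
  | leibLast => node .d (node .al (leaf 0) (leaf 1)) (leaf 2)
  | leibMid => node .d (node .al (leaf 0) (leaf 2)) (leaf 1)
  | leibFirst => node .e (leaf 0) (node .al (leaf 1) (leaf 2))

def lhs (r : Rule) : ShMon shSig r.col 0 where
  tree := r.lhsTree
  coloured := by cases r <;> simp [HasColour, shSig, lhsTree, col]
  nodup := by cases r <;> simp [leaves, lhsTree]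
  mem := by cases r <;> decide
  shuffle := by cases r <;> simp [IsShuffle, MinLT, leaves, lhsTree]

def rhsTree₁ : Rule → BTree ShGen (Fin 3)
  | assoc => node .al (node .al (leaf 0) (leaf 1)) (leaf 2)
  | comm => node .al (node .al (leaf 0) (leaf 1)) (leaf 2)
  | leibLast => node .al (leaf 0) (node .d (leaf 1) (leaf 2))
  | leibMid => node .al (leaf 0) (node .e (leaf 1) (leaf 2))
  | leibFirst => node .al (node .e (leaf 0) (leaf 2)) (leaf 1)

def rhs₁ (r : Rule) : ShMon shSig r.col 0 where
  tree := r.rhsTree₁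
  coloured := by cases r <;> simp [HasColour, shSig, rhsTree₁, col]
  nodup := by cases r <;> simp [leaves, rhsTree₁]
  mem := by cases r <;> decide
  shuffle := by cases r <;> simp [IsShuffle, MinLT, leaves, rhsTree₁]

/-- The second term of the right hand side of the Leibniz rules. -/
def rhsTree₂ : Rule → BTree ShGen (Fin 3)
  | leibLast => node .al (node .d (leaf 0) (leaf 2)) (leaf 1)
  | leibMid => node .al (node .d (leaf 0) (leaf 1)) (leaf 2)
  | leibFirst => node .al (node .e (leaf 0) (leaf 1)) (leaf 2)
  | r => r.rhsTree₁

def rhs₂ (r : Rule) : ShMon shSig r.col 0 where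
  tree := r.rhsTree₂
  coloured := by cases r <;> simp [HasColour, shSig, rhsTree₂, rhsTree₁, col]
  nodup := by cases r <;> simp [leaves, rhsTree₂, rhsTree₁]
  mem := by cases r <;> decide
  shuffle := by cases r <;> simp [IsShuffle, MinLT, leaves, rhsTree₂, rhsTree₁]

/-- For `comm` the paths to leaf 0 are both x², and leaf 1 decides: x² against x. For the other
rules leaf 0 decides: x² against x for `assoc`, xy against y for `leibFirst`, and x against yx = xyq
for the remaining two. -/
theorem rhs₁_lt (r : Rule) : QMLT r.rhs₁ r.lhs := by
  cases r with
  | comm =>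
    refine ⟨1, ?_, ?_⟩
    · intro j hj
      obtain rfl : j = 0 := by omega
      simp [rhs₁, lhs, rhsTree₁, lhsTree, pathQ, leaves]
    · simp [rhs₁, lhs, rhsTree₁, lhsTree, pathQ, leaves, QMon.LT, QMon.mul, QMon.ofGen]
  | _ =>
    refine ⟨0, fun j hj => absurd hj (by omega), ?_⟩
    simp [rhs₁, lhs, rhsTree₁, lhsTree, pathQ, leaves, QMon.LT, QMon.mul, QMon.ofGen]

/-- In `leibLast` and `leibMid` leaf 0 has the path xy against yx = xyq, so only the exponent of q
tells the two sides apart; this is why quantum variables are needed. In `leibFirst` it is xy against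
y. -/
theorem rhs₂_lt (r : Rule) : QMLT r.rhs₂ r.lhs := by
  cases r with
  | assoc => exact rhs₁_lt .assoc
  | comm => exact rhs₁_lt .comm
  | _ =>
    refine ⟨0, fun j hj => absurd hj (by omega), ?_⟩
    simp [rhs₂, lhs, rhsTree₂, lhsTree, pathQ, leaves, QMon.LT, QMon.mul, QMon.ofGen]

variable (k : Type u) [Field k]

/-- The right hand side of a rule. -/
noncomputable def rhs : (r : Rule) → ShFree shSig k r.col 0
  | assoc => Finsupp.single (rhs₁ assoc) 1
  | comm => Finsupp.single (rhs₁ comm) 1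
  | leibLast => Finsupp.single (rhs₁ leibLast) 1 + Finsupp.single (rhs₂ leibLast) 1
  | leibMid => Finsupp.single (rhs₁ leibMid) 1 + Finsupp.single (rhs₂ leibMid) 1
  | leibFirst => Finsupp.single (rhs₁ leibFirst) 1 + Finsupp.single (rhs₂ leibFirst) 1

theorem eq_of_mem_rhs {r : Rule} {m : ShMon shSig r.col 0} (hm : m ∈ (r.rhs k).support) :
    m = r.rhs₁ ∨ m = r.rhs₂ := by
  classical
  have key : ∀ {m a b : ShMon shSig r.col 0},
      m ∈ (Finsupp.single a (1 : k) + Finsupp.single b 1).support → m = a ∨ m = b := by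
    intro m a b h
    rcases Finset.mem_union.1 (Finsupp.support_add h) with h | h
    · exact Or.inl (Finset.mem_singleton.1 (Finsupp.support_single_subset h))
    · exact Or.inr (Finset.mem_singleton.1 (Finsupp.support_single_subset h))
  cases r with
  | assoc => exact Or.inl (Finset.mem_singleton.1 (Finsupp.support_single_subset hm))
  | comm => exact Or.inl (Finset.mem_singleton.1 (Finsupp.support_single_subset hm))
  | _ => exact key hm

/-- The relation that belongs to a rule. -/
noncomputable def rel (r : Rule) : ShRel shSig k where
  n := 3
  χ := r.col
  c := 0
  elt := Finsupp.single r.lhs 1 - r.rhs k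

theorem lt_of_mem_rhs {r : Rule} {m : ShMon shSig r.col 0} (hm : m ∈ (r.rhs k).support) :
    QMLT m r.lhs := by
  rcases eq_of_mem_rhs k hm with rfl | rfl
  · exact r.rhs₁_lt
  · exact r.rhs₂_lt

theorem eq_or_mem_of_mem_rel {r : Rule} {m : ShMon shSig r.col 0}
    (hm : m ∈ (r.rel k).elt.support) : m = r.lhs ∨ m ∈ (r.rhs k).support := by
  classical
  rcases Finset.mem_union.1 (Finsupp.support_sub hm) with h | h
  · exact Or.inl (Finset.mem_singleton.1 (Finsupp.support_single_subset h))
  · exact Or.inr h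

theorem isQuadratic_rel (r : Rule) : (r.rel k).IsQuadratic := by
  intro m hm
  rcases eq_or_mem_of_mem_rel k hm with rfl | h
  · cases r <;> rfl
  · rcases eq_of_mem_rhs k h with rfl | rfl <;> cases r <;> rfl

theorem isLeadingTerm_lhs (r : Rule) {ord : MonOrder shSig} (h : ExtendsQM ord) :
    IsLeadingTerm ord (r.rel k).elt r.lhs := by
  constructor
  · have h0 : r.rhs k r.lhs = 0 := by
      by_contra h0
      exact QMLT.irrefl _ (lt_of_mem_rhs k (Finsupp.mem_support_iff.2 h0))
    refine Finsupp.mem_support_iff.2 ?_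
    change Finsupp.single r.lhs (1 : k) r.lhs - r.rhs k r.lhs ≠ 0
    rw [h0, Finsupp.single_eq_same, sub_zero]
    exact one_ne_zero
  · intro m hm
    let _ := ord 3 r.col 0
    rcases eq_or_mem_of_mem_rel k hm with rfl | hm
    · exact le_refl r.lhs
    · exact le_of_lt (h 3 r.col 0 m r.lhs (lt_of_mem_rhs k hm))

end Rule

end Rules

/-! ### Normal trees -/

section Normal

theorem exists_eq_leaf {L : Type} {χ : L → Fin 2} {t : BTree ShGen L} (h : t.HasColour shSig χ 1) :
    ∃ l, t = leaf l := by
  cases t with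
  | leaf l => exact ⟨l, rfl⟩
  | node g a b => exact absurd h.1 (by simp [shSig])

theorem IsSubtree.map {G A L : Type} {f : A → L} {s t : BTree G A} (h : s.IsSubtree t) :
    (s.map f).IsSubtree (t.map f) := by
  induction t with
  | leaf a =>
    have h : s = leaf a := h
    subst h; exact rfl
  | node g a b ha hb =>
    rcases h with h | h | h
    · subst h; exact Or.inl rfl
    · exact Or.inr (Or.inl (ha h))
    · exact Or.inr (Or.inr (hb h))

variable {L L' : Type} [LinearOrder L] [LinearOrder L']

open Classical in
/-- The shuffle tree of the word `w` in derivations applied to `x`. -/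
noncomputable def chainTree (x : L) : List L → BTree ShGen L
  | [] => leaf x
  | δ :: w =>
    if (leaf δ).MinLT (chainTree x w) then node .e (leaf δ) (chainTree x w)
    else node .d (chainTree x w) (leaf δ)

/-- The left comb with the given factors, the last factor first. -/
noncomputable def combTree (p : L × List L) : List (L × List L) → BTree ShGen L
  | [] => chainTree p.1 p.2
  | q :: ps => node .al (combTree q ps) (chainTree p.1 p.2)

/-- Lists of factors are read from the root inwards: the head is the right branch at the root and
must have the largest of the minimal leaves. Hence the reversal. -/
def FactorLT (p q : L × List L) : Prop :=
  (chainTree q.1 q.2).MinLT (chainTree p.1 p.2)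

def IsNormal (t : BTree ShGen L) : Prop :=
  ∃ p ps, t = combTree p ps ∧ (p :: ps).Pairwise FactorLT

theorem chainTree_map {f : L → L'} (hf : StrictMono f) (x : L) (w : List L) :
    (chainTree x w).map f = chainTree (f x) (w.map f) := by
  induction w with
  | nil => rfl
  | cons δ w ih =>
    have h : (leaf (f δ)).MinLT (chainTree (f x) (w.map f)) ↔ (leaf δ).MinLT (chainTree x w) := by
      rw [← ih]
      exact ⟨MinLT.of_map (s := leaf δ) hf, MinLT.map (s := leaf δ) hf⟩
    rw [chainTree, List.map_cons, chainTree]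
    by_cases hc : (leaf δ).MinLT (chainTree x w)
    · rw [if_pos hc, if_pos (h.2 hc), BTree.map, ih, BTree.map]
    · rw [if_neg hc, if_neg (mt h.1 hc), BTree.map, ih, BTree.map]

theorem combTree_map {f : L → L'} (hf : StrictMono f) (p : L × List L) (ps : List (L × List L)) :
    (combTree p ps).map f =
      combTree (Prod.map f (List.map f) p) (ps.map (Prod.map f (List.map f))) := by
  induction ps generalizing p with
  | nil => exact chainTree_map hf _ _
  | cons q ps ih => simp [combTree, BTree.map, ih, chainTree_map hf]

theorem IsNormal.map {f : L → L'} (hf : StrictMono f) {t : BTree ShGen L} (h : IsNormal t) :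
    IsNormal (t.map f) := by
  obtain ⟨p, ps, rfl, h⟩ := h
  refine ⟨_, _, combTree_map hf p ps, ?_⟩
  rw [← List.map_cons, List.pairwise_map]
  refine h.imp fun {a b} hab => ?_
  have := MinLT.map hf hab
  rw [chainTree_map hf, chainTree_map hf] at this
  exact this

/-- A list sorted by an asymmetric relation is determined by its multiset of entries, so a normal
tree is determined by its factors, that is, by its value in `DPoly`. -/
theorem IsNormal.eq_of_perm {t t' : BTree ShGen L} {p p' : L × List L} {ps ps' : List (L × List L)}
    (ht : t = combTree p ps) (h : (p :: ps).Pairwise FactorLT) (ht' : t' = combTree p' ps')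
    (h' : (p' :: ps').Pairwise FactorLT) (hp : (p :: ps).Perm (p' :: ps')) : t = t' := by
  have := List.Perm.eq_of_pairwise (fun a b _ _ hab hba => (MinLT.asymm hab hba).elim) h h' hp
  simp only [List.cons.injEq] at this
  rw [ht, ht', this.1, this.2]

theorem leaves_chainTree (x : L) (w : List L) : (chainTree x w).leaves.Perm (x :: w) := by
  induction w with
  | nil => exact List.Perm.refl _
  | cons δ w ih =>
    have : (δ :: (chainTree x w).leaves).Perm (x :: δ :: w) :=
      (ih.cons δ).trans (List.Perm.swap _ _ _)
    rw [chainTree]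
    split_ifs
    · exact this
    · exact (List.perm_append_comm (l₁ := (chainTree x w).leaves)).trans this

theorem leaves_combTree (p : L × List L) (ps : List (L × List L)) :
    (combTree p ps).leaves.Perm ((p :: ps).flatMap (fun q => q.1 :: q.2)) := by
  induction ps generalizing p with
  | nil => simpa [combTree] using leaves_chainTree p.1 p.2
  | cons q ps ih =>
    rw [List.flatMap_cons]
    exact (List.perm_append_comm.trans ((leaves_chainTree p.1 p.2).append (ih q)))

end Normal

/-! ### Reduction of shuffle monomials -/

section Reduction

variable (k : Type u) [Field k]

/-- The quadratic Gröbner basis. -/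
noncomputable def qmBasis : Set (ShRel shSig k) := Set.range (Rule.rel k)

variable {L A : Type} [LinearOrder L] [LinearOrder A] {χ : L → Fin 2} {ψ : A → Fin 2} {c : Fin 2}

/-- The monomial can be replaced, modulo the quadratic relations, by QM-smaller ones. -/
def HasReduct (t : ShMon shSig χ c) : Prop :=
  ∃ h : ShFree shSig k χ c, Finsupp.single t 1 - h ∈ shIdealSpan (qmBasis k) L χ c ∧
    ∀ m ∈ h.support, QMLT m t

/-- The tree contains a copy of the left hand side of a rule. -/
def HasRedex (χ : L → Fin 2) (t : BTree ShGen L) : Prop :=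
  ∃ (r : Rule) (s : Fin 3 → BTree ShGen L), (r.lhsTree.bind s).IsSubtree t ∧
    (∀ i, (s i).HasColour shSig χ (r.col i)) ∧ ∀ i j, i < j → (s i).MinLT (s j)

variable {k}

/-- Both halves of `HasReduct` pass to the composition: membership by the ideal axiom, the
inequality by compatibility of the QM-ordering. -/
theorem HasReduct.comp_input (T : ShMon shSig ψ c) (π : L → A) (hπ : Shuffling π)
    (u : ∀ a, ShMon shSig (fun l : {l : L // π l = a} => χ l) (ψ a)) (a : A)
    (h : HasReduct k (u a)) : HasReduct k (T.comp π hπ u) := by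
  obtain ⟨f, hf, hlt⟩ := h
  have h1 := (isShIdeal_shIdealSpan (qmBasis k)).comp_input_mem π hπ T u a _ hf
  rw [lmapDomain_sub_single, Function.update_eq_self] at h1
  refine ⟨_, h1, fun m hm => ?_⟩
  classical
  obtain ⟨s, hs, rfl⟩ := Finset.mem_image.1 (Finsupp.mapDomain_support hm)
  have := (hlt s hs).comp_input π hπ T u a
  rwa [Function.update_eq_self] at this

theorem HasReduct.of_lhs (r : Rule) (s : Fin 3 → BTree ShGen L) (t : ShMon shSig χ 0)
    (ht : t.tree = r.lhsTree.bind s) (hlt : ∀ i j, i < j → (s i).MinLT (s j)) :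
    HasReduct k t := by
  obtain ⟨π, hπ, u, -, rfl⟩ := exists_shuffle_fibres r.lhs s t ht hlt
  have h0 : Finsupp.single r.lhs 1 - r.rhs k ∈ shIdealSpan (qmBasis k) (Fin 3) r.col 0 :=
    elt_mem_shIdealSpan (R := qmBasis k) (r := r.rel k) ⟨r, rfl⟩
  have h1 := (isShIdeal_shIdealSpan (qmBasis k)).comp_root_mem π hπ u _ h0
  have h2 := (lmapDomain_sub_single (fun T : ShMon shSig r.col 0 => T.comp π hπ u) r.lhs (r.rhs k)) ▸ h1
  refine ⟨_, h2, fun m hm => ?_⟩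
  classical
  obtain ⟨s, hs, rfl⟩ := Finset.mem_image.1 (Finsupp.mapDomain_support hm)
  exact (Rule.lt_of_mem_rhs k hs).comp_root π hπ u

theorem HasRedex.of_lhs (r : Rule) (s : Fin 3 → BTree ShGen L) (t : ShMon shSig χ 0)
    (ht : t.tree = r.lhsTree.bind s) (hlt : ∀ i j, i < j → (s i).MinLT (s j)) :
    HasRedex χ t.tree := by
  refine ⟨r, s, ?_, fun i => HasColour.of_bind r.lhs.coloured (ht ▸ t.coloured) i (r.lhs.mem i), hlt⟩
  rw [ht]
  cases r <;> exact Or.inl rfl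

theorem HasRedex.map {f : A → L} (hf : StrictMono f) (hχ : ∀ a, χ (f a) = ψ a)
    {t : BTree ShGen A} (h : HasRedex ψ t) : HasRedex χ (t.map f) := by
  obtain ⟨r, s, h1, h2, h3⟩ := h
  refine ⟨r, fun i => (s i).map f, ?_, fun i => HasColour.map (σ := shSig) f hχ (h2 i),
    fun i j hij => MinLT.map hf (h3 i j hij)⟩
  rw [← map_bind]
  exact IsSubtree.map h1

theorem forall_lt_fin3 {p : Fin 3 → Fin 3 → Prop} (ht : ∀ i j l, p i j → p j l → p i l)
    (h1 : p 0 1) (h2 : p 1 2) : ∀ i j, i < j → p i j := by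
  intro i j hij
  have h3 := ht _ _ _ h1 h2
  fin_cases i <;> fin_cases j <;> first | assumption | (exact absurd hij (by decide))

/-- With normal branches only the root can be at fault. A product whose right branch is a product
matches `assoc`, and one whose new factor is out of order matches `comm`. The derivation input of
`d` or `e` has colour 1 and is therefore a leaf; if the other input is a single chain the result is
a longer chain, otherwise a Leibniz rule applies. -/
theorem reducible_or_isNormal_root {g : ShGen} {a b : BTree ShGen L} (t : ShMon shSig χ c)
    (ht : t.tree = node g a b) (ha : IsNormal a) (hb : IsNormal b) :
    (HasReduct k t ∧ HasRedex χ t.tree) ∨ IsNormal t.tree := by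
  have hcol := t.coloured
  have hsh := t.shuffle
  have hnd := t.nodup
  rw [ht] at hcol hsh hnd
  obtain ⟨hc, hca, hcb⟩ := hcol
  obtain ⟨hab, hsa, hsb⟩ := hsh
  have hc : 0 = c := hc
  subst hc
  have hdis : a.leaves.Disjoint b.leaves := List.disjoint_of_nodup_append hnd
  have red : ∀ (r : Rule) (s : Fin 3 → BTree ShGen L), node g a b = r.lhsTree.bind s →
      (s 0).MinLT (s 1) → (s 1).MinLT (s 2) →
      (HasReduct k t ∧ HasRedex χ t.tree) ∨ IsNormal t.tree := by
    intro r s h h1 h2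
    have hlt := forall_lt_fin3 (p := fun i j => (s i).MinLT (s j))
      (fun _ _ _ => MinLT.trans) h1 h2
    exact Or.inl ⟨HasReduct.of_lhs r s t (ht.trans h) hlt, HasRedex.of_lhs r s t (ht.trans h) hlt⟩
  obtain ⟨p, ps, rfl, hp⟩ := ha
  obtain ⟨q, qs, rfl, hq⟩ := hb
  cases g with
  | al =>
    cases qs with
    | cons q' qs =>
      exact red .assoc ![combTree p ps, combTree q' qs, chainTree q.1 q.2] rfl
        hab.of_node_right hsb.1
    | nil =>
      have normal : (chainTree p.1 p.2).MinLT (chainTree q.1 q.2) → IsNormal t.tree := by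
        intro h
        refine ⟨q, p :: ps, ht, List.pairwise_cons.2 ⟨?_, hp⟩⟩
        intro r hr
        rcases List.mem_cons.1 hr with rfl | hr
        · exact h
        · exact MinLT.trans (List.rel_of_pairwise_cons hp hr) h
      cases ps with
      | nil => exact Or.inr (normal hab)
      | cons p' ps =>
        -- The new factor is compared with the last factor of the left comb, the only place where
        -- sortedness can fail.
        rcases minLT_or_minLT (a := chainTree p.1 p.2) (b := combTree q [])
          (fun l hl => hdis (List.mem_append_right _ hl)) with h | h
        · exact Or.inr (normal h)
        · exact red .comm ![combTree p' ps, combTree q [], chainTree p.1 p.2] rfl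
            (hab.of_node_left hsa.1) h
  | d =>
    obtain ⟨δ, hδ⟩ := exists_eq_leaf hcb
    rw [hδ] at hab hdis ht red
    cases ps with
    | nil =>
      refine Or.inr ⟨(p.1, δ :: p.2), [], ?_, List.pairwise_singleton _ _⟩
      rw [ht]
      simp only [combTree, chainTree]
      rw [if_neg fun h => h.asymm hab]
    | cons p' ps =>
      -- The position of δ relative to the last factor decides which of the two shuffle forms of the
      -- Leibniz rule is matched.
      rcases minLT_or_minLT (a := chainTree p.1 p.2) (b := leaf δ)
          (fun l hl => hdis (List.mem_append_right _ hl)) with h | h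
      · exact red .leibLast ![combTree p' ps, chainTree p.1 p.2, leaf δ] rfl hsa.1 h
      · exact red .leibMid ![combTree p' ps, leaf δ, chainTree p.1 p.2] rfl
          (hab.of_node_left hsa.1) h
  | e =>
    obtain ⟨δ, hδ⟩ := exists_eq_leaf hca
    rw [hδ] at hab hdis ht red
    cases qs with
    | nil =>
      refine Or.inr ⟨(q.1, δ :: q.2), [], ?_, List.pairwise_singleton _ _⟩
      rw [ht]
      simp only [combTree, chainTree]
      rw [if_pos]
      exact hab
    | cons q' qs =>
      exact red .leibFirst ![leaf δ, combTree q' qs, chainTree q.1 q.2] rfl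
        hab.of_node_right hsb.1

theorem HasRedex.node_left {g : ShGen} {a b : BTree ShGen L} (h : HasRedex χ a) :
    HasRedex χ (node g a b) := by
  obtain ⟨r, s, h1, h2⟩ := h
  exact ⟨r, s, Or.inr (Or.inl h1), h2⟩

theorem HasRedex.node_right {g : ShGen} {a b : BTree ShGen L} (h : HasRedex χ b) :
    HasRedex χ (node g a b) := by
  obtain ⟨r, s, h1, h2⟩ := h
  exact ⟨r, s, Or.inr (Or.inr h1), h2⟩

/-- The corolla of a generator. -/
def corolla (g : ShGen) : ShMon shSig ![shSig.in₁ g, shSig.in₂ g] (shSig.out g) where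
  tree := node g (leaf 0) (leaf 1)
  coloured := ⟨rfl, rfl, rfl⟩
  nodup := by simp [leaves]
  mem := by intro l; fin_cases l <;> simp [leaves]
  shuffle := ⟨⟨0, by simp [leaves], by simp [leaves]⟩, trivial, trivial⟩

/-- Induction on the number of vertices. The monomial is a composition of a corolla with its two
branches, so a reduction or redex in a branch yields one of the whole; if both branches are normal,
the root is examined. -/
theorem reducible_or_isNormal (t : ShMon shSig χ c) :
    (HasReduct k t ∧ HasRedex χ t.tree) ∨ IsNormal t.tree := by
  obtain ⟨n, hn⟩ : ∃ n, t.tree.size = n := ⟨_, rfl⟩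
  induction n using Nat.strong_induction_on generalizing L c with
  | _ n ih =>
    cases htree : t.tree with
    | leaf l => exact Or.inr ⟨(l, []), [], rfl, List.pairwise_singleton _ _⟩
    | node g a b =>
      have hcol := t.coloured
      have hsh := t.shuffle
      rw [htree] at hcol hsh
      obtain rfl : shSig.out g = c := hcol.1
      obtain ⟨π, hπ, u, hu, hcomp⟩ := exists_shuffle_fibres (corolla g) ![a, b] t htree (by
        intro i j hij
        fin_cases i <;> fin_cases j <;> first | exact hsh.1 | exact absurd hij (by decide))
      have ha : (u 0).tree.map Subtype.val = a := hu 0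
      have hb : (u 1).tree.map Subtype.val = b := hu 1
      have hsize : a.size + b.size + 1 = n := by rw [← hn, htree]; rfl
      have hval : ∀ i : Fin 2, StrictMono (Subtype.val : {l : L // π l = i} → L) :=
        fun i _ _ h => h
      have iha := ih (u 0).tree.size (by rw [← size_map Subtype.val, ha]; omega) (u 0) rfl
      have ihb := ih (u 1).tree.size (by rw [← size_map Subtype.val, hb]; omega) (u 1) rfl
      rcases iha with ⟨h1, h2⟩ | iha
      · refine Or.inl ⟨hcomp ▸ h1.comp_input _ π hπ u 0, HasRedex.node_left ?_⟩
        rw [← ha]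
        exact h2.map (hval 0) (fun _ => rfl)
      rcases ihb with ⟨h1, h2⟩ | ihb
      · refine Or.inl ⟨hcomp ▸ h1.comp_input _ π hπ u 1, HasRedex.node_right ?_⟩
        rw [← hb]
        exact h2.map (hval 1) (fun _ => rfl)
      rw [← htree]
      exact reducible_or_isNormal_root t htree (ha ▸ iha.map (hval 0)) (hb ▸ ihb.map (hval 1))

variable (k) in
/-- Modulo the quadratic relations, a monomial is a combination of normal monomials, which are
QM-smaller unless the monomial is normal itself. -/
theorem exists_normal_form (t : ShMon shSig χ c) :
    ∃ h : ShFree shSig k χ c, Finsupp.single t 1 - h ∈ shIdealSpan (qmBasis k) L χ c ∧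
      ∀ m ∈ h.support, IsNormal m.tree ∧ (m = t ∨ QMLT m t) := by
  have := t.finite_inputs
  apply wellFounded_QMLT.induction t
  intro t ih
  rcases reducible_or_isNormal (k := k) t with ⟨⟨f, hf, hlt⟩, -⟩ | hn
  -- The induction hypothesis concerns single monomials below `t`; it is extended here to their
  -- linear combinations.
  · have key : ∀ f : ShFree shSig k χ c, (∀ m ∈ f.support, QMLT m t) →
        ∃ h : ShFree shSig k χ c, f - h ∈ shIdealSpan (qmBasis k) L χ c ∧
          ∀ m ∈ h.support, IsNormal m.tree ∧ QMLT m t := by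
      classical
      intro f
      induction f using Finsupp.induction with
      | zero => exact fun _ => ⟨0, by simp, by simp⟩
      | single_add m r f hm hr ihf =>
        intro hlt
        have hsupp := Finsupp.support_single_add hm hr
        obtain ⟨h, h1, h2⟩ := ihf (fun m' hm' => hlt m' (by rw [hsupp]; simp [hm']))
        have hmt : QMLT m t := hlt m (by rw [hsupp]; simp)
        obtain ⟨h', h1', h2'⟩ := ih m hmt
        refine ⟨r • h' + h, ?_, ?_⟩
        · have := Submodule.add_mem _ (Submodule.smul_mem _ r h1') h1
          rw [smul_sub, Finsupp.smul_single, smul_eq_mul, mul_one] at this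
          convert this using 1
          abel
        · intro m' hm'
          rcases Finset.mem_union.1 (Finsupp.support_add hm') with hm' | hm'
          · obtain ⟨hn, h⟩ := h2' m' (Finsupp.support_smul hm')
            exact ⟨hn, h.elim (fun h => h ▸ hmt) (fun h => h.trans hmt)⟩
          · exact h2 m' hm'
    obtain ⟨h, h1, h2⟩ := key f hlt
    refine ⟨h, ?_, fun m hm => ⟨(h2 m hm).1, Or.inr (h2 m hm).2⟩⟩
    have := Submodule.add_mem _ hf h1
    rwa [sub_add_sub_cancel] at this
  · refine ⟨Finsupp.single t 1, by simp, fun m hm => ?_⟩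
    obtain rfl := Finset.mem_singleton.1 (Finsupp.support_single_subset hm)
    exact ⟨hn, Or.inl rfl⟩

end Reduction

/-! ### Monomials with a root vertex -/

section Node

variable {I : Type} {σ : Signature I} {L : Type} {χ : L → I} {c : I}

/-- A tree with the same leaves as a monomial. -/
def Mon.ofPerm (t : Mon σ χ c) (x : BTree σ.Gen L) (hx : x.HasColour σ χ c)
    (hp : x.leaves.Perm t.tree.leaves) : Mon σ χ c where
  tree := x
  coloured := hx
  nodup := hp.nodup_iff.2 t.nodup
  mem l := hp.mem_iff.2 (t.mem l)

def Mon.corolla (g : σ.Gen) : Mon σ ![σ.in₁ g, σ.in₂ g] (σ.out g) where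
  tree := node g (leaf 0) (leaf 1)
  coloured := ⟨rfl, rfl, rfl⟩
  nodup := by simp [leaves]
  mem := by intro l; fin_cases l <;> simp [leaves]

/-- The branches at the root, as monomials, can be replaced by equivalent ones. -/
theorem exists_branches {t : Mon σ χ c} {g : σ.Gen} {a b : BTree σ.Gen L}
    (ht : t.tree = node g a b) :
    ∃ (π : L → Fin 2) (u₀ : Mon σ (fun l : {l : L // π l = 0} => χ l) (σ.in₁ g))
      (u₁ : Mon σ (fun l : {l : L // π l = 1} => χ l) (σ.in₂ g)),
      u₀.tree.map Subtype.val = a ∧ u₁.tree.map Subtype.val = b ∧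
      ∀ {k : Type u} [Field k] (R : Set (Rel σ k)) (v₀ : Mon σ _ _) (v₁ : Mon σ _ _),
        Eqv R u₀ v₀ → Eqv R u₁ v₁ → ∃ t' : Mon σ χ c,
          t'.tree = node g (v₀.tree.map Subtype.val) (v₁.tree.map Subtype.val) ∧ Eqv R t t' := by
  have hcol := t.coloured
  have hnd := t.nodup
  have hmem := t.mem
  rw [ht] at hcol hnd hmem
  obtain rfl : σ.out g = c := hcol.1
  obtain ⟨π, -, u, hu⟩ := exists_fibres_of_bind (Mon.corolla g) ![a, b] (χ := χ) hcol hnd hmem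
  refine ⟨π, u 0, u 1, hu 0, hu 1, fun R v₀ v₁ h₀ h₁ => ?_⟩
  let v : ∀ i, Mon σ (fun l : {l : L // π l = i} => χ l) (![σ.in₁ g, σ.in₂ g] i) :=
    Fin.cons v₀ (Fin.cons v₁ finZeroElim)
  refine ⟨(Mon.corolla g).comp π v, rfl, ?_⟩
  have : t = (Mon.corolla g).comp π u :=
    Mon.ext (ht.trans (Mon.comp_tree (Mon.corolla g) π u ![a, b] hu).symm)
  rw [this]
  refine Eqv.comp_inputs _ _ _ _ ?_
  intro i
  fin_cases i
  · exact h₀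
  · exact h₁

end Node

/-! ### The relations of the shuffle operad associated with `DCom` -/

section Relations

variable {k : Type u} [Field k] {L A : Type} {χ : L → Fin 2} {ψ : A → Fin 2} {c : Fin 2}

theorem symTree_map (f : A → L) (t : BTree ShGen A) : symTree (t.map f) = (symTree t).map f := by
  induction t with
  | leaf a => rfl
  | node g a b ha hb => cases g <;> simp [BTree.map, symTree, ha, hb]

theorem symTree_bind (s : A → BTree ShGen L) (t : BTree ShGen A) :
    symTree (t.bind s) = (symTree t).bind (fun a => symTree (s a)) := by
  induction t with
  | leaf a => rfl
  | node g a b ha hb => cases g <;> simp [BTree.bind, symTree, ha, hb]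

theorem symMon_comp [LinearOrder L] [LinearOrder A] (T : ShMon shSig ψ c) (π : L → A)
    (hπ : Shuffling π) (t : ∀ a, ShMon shSig (fun l : {l : L // π l = a} => χ l) (ψ a)) :
    symMon (T.comp π hπ t) = (symMon T).comp π (fun a => symMon (t a)) := by
  refine Mon.ext ((symTree_bind _ _).trans ?_)
  exact congrArg (fun s => BTree.bind s (symTree T.tree)) (funext fun a => symTree_map _ _)

theorem mem_dcomShIdeal [LinearOrder L] {f : ShFree shSig k χ c} :
    f ∈ dcomShIdeal k L χ c ↔
      Finsupp.lmapDomain k k symMon f ∈ idealSpan (dcomRels k) L χ c :=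
  Submodule.Quotient.mk_eq_zero _

-- Since `symMon` carries shuffle compositions to compositions, the inverse image of an ideal of the
-- free symmetric operad is a shuffle ideal.
variable (k) in
theorem isShIdeal_dcomShIdeal : IsShIdeal (dcomShIdeal k) where
  relabel_mem e h f hf := by
    rw [mem_dcomShIdeal] at hf ⊢
    have := (isIdeal_idealSpan (dcomRels k)).relabel_mem e.toEquiv h _ hf
    rw [← LinearMap.comp_apply, ← Finsupp.lmapDomain_comp] at this ⊢
    convert this using 3
    funext t
    exact Mon.ext (symTree_map _ _)
  comp_root_mem π hπ t f hf := by
    rw [mem_dcomShIdeal] at hf ⊢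
    have := (isIdeal_idealSpan (dcomRels k)).comp_root_mem π (fun a => symMon (t a)) _ hf
    rw [← LinearMap.comp_apply, ← Finsupp.lmapDomain_comp] at this ⊢
    convert this using 3
    funext T
    exact symMon_comp _ _ _ _
  comp_input_mem π hπ T t a f hf := by
    rw [mem_dcomShIdeal] at hf ⊢
    have := (isIdeal_idealSpan (dcomRels k)).comp_input_mem π (symMon T)
      (fun a => symMon (t a)) a _ hf
    rw [← LinearMap.comp_apply, ← Finsupp.lmapDomain_comp] at this ⊢
    convert this using 3
    funext s
    refine (symMon_comp _ _ _ _).trans (congrArg _ ?_)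
    funext b
    by_cases hb : b = a
    · subst hb; simp
    · simp [hb]

theorem eqv_comm {a b : BTree DComGen L} {t t' : Mon dcomSig χ c}
    (ht : t.tree = node .al a b) (ht' : t'.tree = node .al b a) : Eqv (dcomRels k) t t' := by
  obtain rfl : (0 : Fin 2) = c := by
    have := t.coloured; rw [ht] at this; exact this.1
  let x : Mon dcomSig ![0, 0] 0 := ⟨node .al (leaf 0) (leaf 1),
    by simp [HasColour, dcomSig], by simp [leaves], by decide⟩
  let y : Mon dcomSig ![0, 0] 0 := ⟨node .al (leaf 1) (leaf 0),
    by simp [HasColour, dcomSig], by simp [leaves], by decide⟩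
  have h : Eqv (dcomRels k) x y :=
    elt_mem_idealSpan (R := dcomRels k) (r := dcomComm k) (Or.inl rfl)
  exact h.of_bind ![a, b] ht ht'

theorem eqv_assoc {a b d : BTree DComGen L} {t t' : Mon dcomSig χ c}
    (ht : t.tree = node .al (node .al a b) d) (ht' : t'.tree = node .al a (node .al b d)) :
    Eqv (dcomRels k) t t' := by
  obtain rfl : (0 : Fin 2) = c := by
    have := t.coloured; rw [ht] at this; exact this.1
  let x : Mon dcomSig ![0, 0, 0] 0 := ⟨node .al (node .al (leaf 0) (leaf 1)) (leaf 2),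
    by simp [HasColour, dcomSig], by simp [leaves], by decide⟩
  let y : Mon dcomSig ![0, 0, 0] 0 := ⟨node .al (leaf 0) (node .al (leaf 1) (leaf 2)),
    by simp [HasColour, dcomSig], by simp [leaves], by decide⟩
  have h : Eqv (dcomRels k) x y :=
    elt_mem_idealSpan (R := dcomRels k) (r := dcomAssoc k) (Or.inr (Or.inl rfl))
  exact h.of_bind ![a, b, d] ht ht'

theorem op_leibniz {a b d : BTree DComGen L} {t t₁ t₂ : Mon dcomSig χ c}
    (ht : t.tree = node .d (node .al a b) d) (ht₁ : t₁.tree = node .al a (node .d b d))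
    (ht₂ : t₂.tree = node .al (node .d a d) b) :
    op (dcomRels k) t = op (dcomRels k) t₁ + op (dcomRels k) t₂ := by
  obtain rfl : (0 : Fin 2) = c := by
    have := t.coloured; rw [ht] at this; exact this.1
  let x : Mon dcomSig ![0, 0, 1] 0 := ⟨node .d (node .al (leaf 0) (leaf 1)) (leaf 2),
    by simp [HasColour, dcomSig], by simp [leaves], by decide⟩
  let y : Mon dcomSig ![0, 0, 1] 0 := ⟨node .al (leaf 0) (node .d (leaf 1) (leaf 2)),
    by simp [HasColour, dcomSig], by simp [leaves], by decide⟩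
  let z : Mon dcomSig ![0, 0, 1] 0 := ⟨node .al (node .d (leaf 0) (leaf 2)) (leaf 1),
    by simp [HasColour, dcomSig], by simp [leaves], by decide⟩
  have h : Finsupp.single x (1 : k) - (Finsupp.single y 1 + Finsupp.single z 1) ∈
      idealSpan (dcomRels k) _ _ _ :=
    elt_mem_idealSpan (R := dcomRels k) (r := dcomLeibniz k) (Or.inr (Or.inr rfl))
  obtain ⟨π, -, u, hu⟩ := exists_fibres_of_bind x ![a, b, d] (χ := χ) (c := 0)
    (by have := t.coloured; rw [ht] at this; exact this)
    (by have := t.nodup; rw [ht] at this; exact this)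
    (by have := t.mem; rw [ht] at this; exact this)
  have h1 := (isIdeal_idealSpan (dcomRels k)).comp_root_mem π u _ h
  rw [lmapDomain_sub_single (fun T : Mon dcomSig ![0, 0, 1] 0 => T.comp π u), map_add,
    Finsupp.lmapDomain_apply, Finsupp.lmapDomain_apply, Finsupp.mapDomain_single,
    Finsupp.mapDomain_single] at h1
  rw [Mon.ext ((Mon.comp_tree x π u _ hu).trans ht.symm),
    Mon.ext ((Mon.comp_tree y π u _ hu).trans ht₁.symm),
    Mon.ext ((Mon.comp_tree z π u _ hu).trans ht₂.symm)] at h1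
  have h2 := presentedMk_eq_zero.2 h1
  rw [map_sub, map_add, sub_eq_zero] at h2
  exact h2

/-- Commutativity inside a product. -/
theorem eqv_comm_right {a b d : BTree DComGen L} {t t' : Mon dcomSig χ c}
    (ht : t.tree = node .al a (node .al b d)) (ht' : t'.tree = node .al a (node .al d b)) :
    Eqv (dcomRels k) t t' := by
  obtain rfl : (0 : Fin 2) = c := by
    have := t.coloured; rw [ht] at this; exact this.1
  obtain ⟨π, u₀, u₁, h₀, h₁, h⟩ := exists_branches.{u} ht
  have hu : ∃ b' d', u₁.tree = node .al b' d' ∧ b'.map Subtype.val = b ∧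
      d'.map Subtype.val = d := by
    cases hx : u₁.tree with
    | leaf l => rw [hx] at h₁; simp [BTree.map] at h₁
    | node g b' d' =>
      rw [hx] at h₁
      obtain ⟨rfl, h₁, h₂⟩ := BTree.node.inj h₁
      exact ⟨b', d', rfl, h₁, h₂⟩
  obtain ⟨b', d', hu, rfl, rfl⟩ := hu
  have hcol := u₁.coloured
  rw [hu] at hcol
  let v := u₁.ofPerm (node DComGen.al d' b') ⟨hcol.1, hcol.2.2, hcol.2.1⟩
    (by rw [hu]; exact List.perm_append_comm)
  obtain ⟨t'', ht'', h⟩ := h (dcomRels k) u₀ v (Eqv.refl _) (eqv_comm hu rfl)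
  refine h.trans (Eqv.of_tree_eq ?_)
  rw [ht', ht'', h₀]
  rfl

variable (k)

/-- The rules hold in `DCom`. For `comm`: α(α(0,2),1) = α(0,α(2,1)) = α(0,α(1,2)) = α(α(0,1),2). The
three Leibniz rules are the Leibniz relation with renamed inputs, and `leibFirst` needs one further
commutation. -/
theorem lmapDomain_symMon_rel_mem (r : Rule) :
    Finsupp.lmapDomain k k symMon (r.rel k).elt ∈ idealSpan (dcomRels k) _ r.col 0 := by
  have h1 := lmapDomain_sub_single (k := k) (symMon (χ := r.col) (c := 0)) r.lhs (r.rhs k)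
  refine (congrArg (· ∈ idealSpan (dcomRels k) _ r.col 0) h1).mpr ?_
  rw [← presentedMk_eq_zero, map_sub, sub_eq_zero]
  change op _ _ = _
  have hs : ∀ m : ShMon shSig r.col 0, presentedMk (dcomRels k) r.col 0
      (Finsupp.lmapDomain k k symMon (Finsupp.single m 1)) = op _ (symMon m) := by
    intro m
    rw [Finsupp.lmapDomain_apply, Finsupp.mapDomain_single]
    rfl
  cases r with
  | assoc => exact (Eqv.op_eq (eqv_assoc rfl rfl).symm).trans (hs _).symm
  | comm =>
    let x : Mon dcomSig ![0, 0, 0] 0 := ⟨node .al (leaf 0) (node .al (leaf 2) (leaf 1)),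
      by simp [HasColour, dcomSig], by simp [leaves], by decide⟩
    let y : Mon dcomSig ![0, 0, 0] 0 := ⟨node .al (leaf 0) (node .al (leaf 1) (leaf 2)),
      by simp [HasColour, dcomSig], by simp [leaves], by decide⟩
    refine (Eqv.op_eq ?_).trans (hs _).symm
    exact (eqv_assoc (t' := x) rfl rfl).trans
      ((eqv_comm_right (t' := y) rfl rfl).trans (eqv_assoc rfl rfl).symm)
  | leibLast =>
    refine (op_leibniz rfl (t₁ := symMon (Rule.rhs₁ .leibLast))
      (t₂ := symMon (Rule.rhs₂ .leibLast)) rfl rfl).trans ?_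
    rw [Rule.rhs, map_add, map_add, hs, hs]
  | leibMid =>
    refine (op_leibniz rfl (t₁ := symMon (Rule.rhs₁ .leibMid))
      (t₂ := symMon (Rule.rhs₂ .leibMid)) rfl rfl).trans ?_
    rw [Rule.rhs, map_add, map_add, hs, hs]
  | leibFirst =>
    let x : Mon dcomSig ![1, 0, 0] 0 := ⟨node .al (leaf 1) (node .d (leaf 2) (leaf 0)),
      by simp [HasColour, dcomSig], by simp [leaves], by decide⟩
    refine (op_leibniz rfl (t₁ := x) (t₂ := symMon (Rule.rhs₂ .leibFirst)) rfl rfl).trans ?_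
    rw [Rule.rhs, map_add, map_add, hs, hs]
    exact congrArg₂ _ (Eqv.op_eq (eqv_comm rfl rfl)) rfl

theorem shIdealSpan_qmBasis_le [LinearOrder L] :
    shIdealSpan (qmBasis k) L χ c ≤ dcomShIdeal k L χ c := by
  intro f hf
  refine mem_shIdealSpan.1 hf _ (isShIdeal_dcomShIdeal k) ?_
  rintro _ ⟨r, rfl⟩
  exact mem_dcomShIdeal.2 (lmapDomain_symMon_rel_mem k r)

end Relations

/-! ### Surjectivity of the canonical map -/

section Surjective

variable (k : Type u) [Field k] {L : Type} [LinearOrder L] {χ : L → Fin 2} {c : Fin 2}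

theorem exists_shMon (t : Mon dcomSig χ c) (x : BTree ShGen L) (hx : x.HasColour shSig χ c)
    (hs : x.IsShuffle) (h : symTree x = t.tree) : ∃ s : ShMon shSig χ c, symMon s = t := by
  have hp := symTree_perm x
  rw [h] at hp
  exact ⟨⟨⟨x, hx, hp.nodup_iff.1 t.nodup, fun l => hp.mem_iff.1 (t.mem l)⟩, hs⟩, Mon.ext h⟩

/-- At each vertex the branches are put in the order of their smallest leaves. An exchange at α is
allowed by commutativity; at `d` it is recorded by writing `e`, which stands for the same tree. -/
theorem exists_shuffle_eqv (t : Mon dcomSig χ c) :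
    ∃ s : ShMon shSig χ c, Eqv (dcomRels k) t (symMon s) := by
  obtain ⟨n, hn⟩ : ∃ n, t.tree.size = n := ⟨_, rfl⟩
  induction n using Nat.strong_induction_on generalizing L c with
  | _ n ih =>
    cases htree : t.tree with
    | leaf l =>
      have hcol := t.coloured
      rw [htree] at hcol
      obtain ⟨s, rfl⟩ := exists_shMon t (leaf l) hcol trivial htree.symm
      exact ⟨s, Eqv.refl _⟩
    | node g a b =>
      have hcol := t.coloured
      rw [htree] at hcol
      obtain rfl : (0 : Fin 2) = c := hcol.1
      obtain ⟨π, u₀, u₁, h₀, h₁, h⟩ := exists_branches.{u} htree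
      have hsize : a.size + b.size + 1 = n := by rw [← hn, htree]; rfl
      obtain ⟨s₀, e₀⟩ := ih u₀.tree.size (by rw [← size_map Subtype.val, h₀]; omega) u₀ rfl
      obtain ⟨s₁, e₁⟩ := ih u₁.tree.size (by rw [← size_map Subtype.val, h₁]; omega) u₁ rfl
      obtain ⟨t', ht', e⟩ := h (dcomRels k) (symMon s₀) (symMon s₁) e₀ e₁
      have lift : ∀ {i : Fin 2} {c' : Fin 2} (s : ShMon shSig (fun l : {l : L // π l = i} => χ l) c'),
          ∃ x : BTree ShGen L, x.HasColour shSig χ c' ∧ x.IsShuffle ∧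
            symTree x = (symMon s).tree.map Subtype.val := fun s =>
        ⟨s.tree.map Subtype.val, HasColour.map (σ := shSig) Subtype.val (fun _ => rfl) s.coloured,
          s.shuffle.map (f := Subtype.val) (fun _ _ h => h), symTree_map _ _⟩
      obtain ⟨x, c₀, sh₀, hx⟩ := lift s₀
      obtain ⟨y, c₁, sh₁, hy⟩ := lift s₁
      rw [← hx, ← hy] at ht'
      have hnd := t'.nodup
      rw [ht'] at hnd
      have hdis : x.leaves.Disjoint y.leaves := by
        have := List.disjoint_of_nodup_append hnd
        exact fun l hl hl' => this ((symTree_perm x).mem_iff.2 hl) ((symTree_perm y).mem_iff.2 hl')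
      rcases minLT_or_minLT hdis with hlt | hlt
      · cases g with
        | al =>
          obtain ⟨s, rfl⟩ := exists_shMon t' (node .al x y) ⟨rfl, c₀, c₁⟩ ⟨hlt, sh₀, sh₁⟩ ht'.symm
          exact ⟨s, e⟩
        | d =>
          obtain ⟨s, rfl⟩ := exists_shMon t' (node .d x y) ⟨rfl, c₀, c₁⟩ ⟨hlt, sh₀, sh₁⟩ ht'.symm
          exact ⟨s, e⟩
      · cases g with
        | al =>
          have hc' := t'.coloured
          rw [ht'] at hc'
          let t'' := t'.ofPerm (node DComGen.al (symTree y) (symTree x)) ⟨rfl, hc'.2.2, hc'.2.1⟩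
            (by rw [ht']; exact List.perm_append_comm)
          obtain ⟨s, hs⟩ := exists_shMon t'' (node .al y x) ⟨rfl, c₁, c₀⟩ ⟨hlt, sh₁, sh₀⟩ rfl
          exact ⟨s, e.trans (hs ▸ eqv_comm ht' rfl)⟩
        | d =>
          obtain ⟨s, rfl⟩ := exists_shMon t' (node .e y x) ⟨rfl, c₁, c₀⟩ ⟨hlt, sh₁, sh₀⟩ ht'.symm
          exact ⟨s, e⟩

theorem shToDCom_single (s : ShMon shSig χ c) :
    shToDCom k χ c (Finsupp.single s 1) = op (dcomRels k) (symMon s) := by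
  refine Eq.trans (b := presentedMk (dcomRels k) χ c
    (Finsupp.lmapDomain k k symMon (Finsupp.single s 1))) rfl ?_
  rw [Finsupp.lmapDomain_apply, Finsupp.mapDomain_single]
  rfl

theorem shToDCom_surjective (χ : L → Fin 2) (c : Fin 2) :
    Function.Surjective (shToDCom k χ c) := by
  rw [← LinearMap.range_eq_top, eq_top_iff]
  refine (span_range_op (dcomRels k) χ c).ge.trans (Submodule.span_le.2 ?_)
  rintro _ ⟨t, rfl⟩
  obtain ⟨s, hs⟩ := exists_shuffle_eqv k t
  exact ⟨Finsupp.single s 1, (shToDCom_single k s).trans hs.op_eq.symm⟩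

end Surjective

/-! ### The Gröbner basis -/

section GB

variable (k : Type u) [Field k] {L : Type} [LinearOrder L] {χ : L → Fin 2} {c : Fin 2}

theorem evalTree_chainTree (x : L) (w : List L) :
    (evalTree k _ (stdVal k) (symTree (chainTree x w))).1 = MvPolynomial.X (x, w) := by
  induction w with
  | nil => rfl
  | cons δ w ih =>
    have : letterDer k δ (MvPolynomial.X (x, w)) = MvPolynomial.X (x, δ :: w) := by
      rw [letterDer, MvPolynomial.mkDerivation_X]
    rw [chainTree]
    split_ifs <;> simp [symTree, evalTree, ih, stdVal, this]

theorem evalTree_combTree (p : L × List L) (ps : List (L × List L)) :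
    (evalTree k _ (stdVal k) (symTree (combTree p ps))).1 =
      mono k (↑(p :: ps) : Multiset (L × List L)) := by
  induction ps generalizing p with
  | nil => simp [combTree, evalTree_chainTree, mono]
  | cons q ps ih =>
    simp only [combTree, symTree, evalTree, ih, evalTree_chainTree, mono, Multiset.map_coe,
      Multiset.prod_coe, List.map_cons, List.prod_cons]
    ring

/-- The factors of a normal tree. -/
noncomputable def IsNormal.factors {t : BTree ShGen L} (h : IsNormal t) : Multiset (L × List L) :=
  ↑(h.choose :: h.choose_spec.choose)

theorem IsNormal.eval {t : BTree ShGen L} (h : IsNormal t) :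
    (evalTree k _ (stdVal k) (symTree t)).1 = mono k h.factors := by
  rw [IsNormal.factors, ← evalTree_combTree, ← h.choose_spec.choose_spec.1]

theorem IsNormal.factors_inj {t t' : BTree ShGen L} (h : IsNormal t) (h' : IsNormal t')
    (heq : h.factors = h'.factors) : t = t' :=
  IsNormal.eq_of_perm h.choose_spec.choose_spec.1 h.choose_spec.choose_spec.2
    h'.choose_spec.choose_spec.1 h'.choose_spec.choose_spec.2 (Multiset.coe_eq_coe.1 heq)

theorem dcomEval_shToDCom_single (s : ShMon shSig χ c) :
    dcomEval k L χ c (shToDCom k χ c (Finsupp.single s 1)) =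
      (evalTree k _ (stdVal k) (symTree s.tree)).1 := by
  rw [shToDCom_single]
  exact dcomEval_op k _

/-- Normal monomials are linearly independent in `DCom`. -/
theorem eq_zero_of_normal {f : ShFree shSig k χ c} (hf : f ∈ dcomShIdeal k L χ c)
    (hn : ∀ m ∈ f.support, IsNormal m.tree) : f = 0 := by
  let ev : ShFree shSig k χ c →ₗ[k] DPoly k L := dcomEval k L χ c ∘ₗ shToDCom k χ c
  have hli : LinearIndependent k (fun t : {t : ShMon shSig χ c | IsNormal t.tree} =>
      ev (Finsupp.single t.1 1)) := by
    have : (fun t : {t : ShMon shSig χ c | IsNormal t.tree} => ev (Finsupp.single t.1 1)) =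
        mono k ∘ fun t => t.2.factors := by
      funext t
      exact (dcomEval_shToDCom_single k t.1).trans (t.2.eval k)
    rw [this]
    refine (linearIndependent_mono k).comp _ ?_
    intro t t' h
    exact Subtype.ext (ShMon.ext (t.2.factors_inj t'.2 h))
  have hli' : LinearIndepOn k (fun t : ShMon shSig χ c => ev (Finsupp.single t 1))
      {t | IsNormal t.tree} := hli
  rw [linearIndepOn_iff] at hli'
  refine hli' f (fun m hm => hn m hm) ?_
  have h0 : ev f = 0 := by
    have h1 : shToDCom k χ c f = 0 := hf
    change dcomEval k L χ c (shToDCom k χ c f) = 0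
    rw [h1]
    exact map_zero (dcomEval k L χ c)
  rw [← h0]
  conv_rhs => rw [← Finsupp.sum_single f]
  rw [Finsupp.linearCombination_apply, map_finsuppSum]
  refine Finsupp.sum_congr fun m _ => ?_
  rw [← map_smul, Finsupp.smul_single, smul_eq_mul, mul_one]

/-- The difference is a combination of normal monomials lying in M, so it vanishes by independence:
a normal monomial is its own normal form. -/
theorem single_sub_normal_form_mem {t : ShMon shSig χ c} {h : ShFree shSig k χ c}
    (hh : Finsupp.single t 1 - h ∈ shIdealSpan (qmBasis k) L χ c)
    (hn : ∀ m ∈ h.support, IsNormal m.tree) (ht : IsNormal t.tree) :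
    h = Finsupp.single t 1 := by
  classical
  refine (sub_eq_zero.1 (eq_zero_of_normal k (shIdealSpan_qmBasis_le k hh) ?_)).symm
  intro m hm
  rcases Finset.mem_union.1 (Finsupp.support_sub hm) with h | h
  · rw [Finset.mem_singleton.1 (Finsupp.support_single_subset h)]; exact ht
  · exact hn m h

open Classical in
/-- Each element is, modulo the quadratic relations, a combination of normal monomials. -/
theorem exists_normal_forms :
    ∃ nf : ShMon shSig χ c → ShFree shSig k χ c,
      (∀ t, Finsupp.single t 1 - nf t ∈ shIdealSpan (qmBasis k) L χ c) ∧
      (∀ t, ∀ m ∈ (nf t).support, IsNormal m.tree ∧ (m = t ∨ QMLT m t)) ∧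
      (∀ f : ShFree shSig k χ c,
        f - Finsupp.linearCombination k nf f ∈ shIdealSpan (qmBasis k) L χ c) ∧
      ∀ f ∈ dcomShIdeal k L χ c, Finsupp.linearCombination k nf f = 0 := by
  choose nf h1 h2 using exists_normal_form k (χ := χ) (c := c)
  have h3 : ∀ f : ShFree shSig k χ c,
        f - Finsupp.linearCombination k nf f ∈ shIdealSpan (qmBasis k) L χ c := by
    intro f
    induction f using Finsupp.induction_linear with
    | zero => simp
    | add f g hf hg =>
      have := Submodule.add_mem _ hf hg
      rwa [sub_add_sub_comm, ← map_add] at this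
    | single t r =>
      have := Submodule.smul_mem _ r (h1 t)
      rwa [smul_sub, Finsupp.smul_single, smul_eq_mul, mul_one,
        ← Finsupp.linearCombination_single] at this
  refine ⟨nf, h1, h2, h3, fun f hf => ?_⟩
  -- The normal form of an element of M differs from it by an element of M, so it lies in M too, and
  -- it involves normal monomials only.
  refine eq_zero_of_normal k ?_ ?_
  · have := Submodule.sub_mem _ hf (shIdealSpan_qmBasis_le k (h3 f))
    rwa [sub_sub_cancel] at this
  · intro m hm
    rw [Finsupp.linearCombination_apply] at hm
    obtain ⟨t, -, ht⟩ := Finset.mem_biUnion.1 (Finsupp.support_finsetSum hm)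
    exact (h2 t m (Finsupp.support_smul ht)).1

theorem shIdealSpan_qmBasis : shIdealSpan (qmBasis k) L χ c = dcomShIdeal k L χ c := by
  refine le_antisymm (shIdealSpan_qmBasis_le k) fun f hf => ?_
  obtain ⟨nf, -, -, h3, h4⟩ := exists_normal_forms k (χ := χ) (c := c)
  have := h3 f
  rwa [h4 f hf, sub_zero] at this

/-- The normal form of `f` is zero; consider its coefficient at `m`. Another monomial m' of `f`
contributes only if `m` is QM-smaller than m', which a leading term excludes. As `m` is its own
normal form, its coefficient in `f` would have to vanish. -/
theorem isNormal_not_isLeadingTerm {ord : MonOrder shSig} (ho : ExtendsQM ord) {n : ℕ}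
    {χ : Fin n → Fin 2} {c : Fin 2} {f : ShFree shSig k χ c} (hf : f ∈ dcomShIdeal k (Fin n) χ c)
    {m : ShMon shSig χ c} (hm : IsLeadingTerm ord f m) : ¬ IsNormal m.tree := by
  intro hn
  obtain ⟨nf, h1, h2, -, h4⟩ := exists_normal_forms k (χ := χ) (c := c)
  have h0 := DFunLike.congr_fun (h4 f hf) m
  rw [Finsupp.linearCombination_apply, Finsupp.sum, Finsupp.finsetSum_apply,
    Finset.sum_eq_single m] at h0
  · rw [single_sub_normal_form_mem k (h1 m) (fun m' hm' => (h2 m m' hm').1) hn] at h0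
    simp only [Finsupp.smul_apply, Finsupp.single_eq_same, smul_eq_mul, mul_one] at h0
    exact Finsupp.mem_support_iff.1 hm.1 h0
  · intro m' hm' hne
    suffices nf m' m = 0 by simp [this]
    by_contra hne'
    rcases (h2 m' m (Finsupp.mem_support_iff.2 hne')).2 with h | h
    · exact hne h.symm
    · let _ := ord n χ c
      exact absurd (hm.2 m' hm') (not_le_of_gt (ho n χ c m m' h))
  · intro h
    exact absurd hm.1 h

theorem HasRedex.exists_divides {n : ℕ} {χ : Fin n → Fin 2} {c : Fin 2} {m : ShMon shSig χ c}
    (h : HasRedex χ m.tree) : ∃ r : Rule, Divides r.lhs m := by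
  obtain ⟨r, s, h⟩ := h
  exact ⟨r, s, h⟩

theorem isGroebnerBasis_qmBasis {ord : MonOrder shSig} (ho : ExtendsQM ord) :
    IsGroebnerBasis ord (dcomShIdeal k) (qmBasis k) where
  generates _ _ _ _ := shIdealSpan_qmBasis k
  divides n χ c f hf m hm := by
    rcases reducible_or_isNormal (k := k) m with ⟨-, h⟩ | h
    · obtain ⟨r, hr⟩ := h.exists_divides
      exact ⟨r.rel k, ⟨r, rfl⟩, r.lhs, r.isLeadingTerm_lhs k ho, hr⟩
    · exact (isNormal_not_isLeadingTerm k ho hf hm h).elim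

theorem span_normal :
    Submodule.span k (Set.range fun t : {t : ShMon shSig χ c | IsNormal t.tree} =>
      op (dcomRels k) (symMon t.1)) = ⊤ := by
  classical
  rw [eq_top_iff, ← span_range_op (dcomRels k) χ c, Submodule.span_le]
  rintro _ ⟨t, rfl⟩
  obtain ⟨s, hs⟩ := exists_shuffle_eqv k t
  obtain ⟨h, h1, h2⟩ := exists_normal_form k s
  have h3 : shToDCom k χ c (Finsupp.single s 1) = shToDCom k χ c h := by
    have : shToDCom k χ c (Finsupp.single s 1 - h) = 0 := shIdealSpan_qmBasis_le k h1
    rwa [map_sub, sub_eq_zero] at this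
  rw [hs.op_eq, ← shToDCom_single, h3]
  rw [← Finsupp.sum_single h, map_finsuppSum]
  refine Submodule.sum_mem _ fun m hm => ?_
  have : Finsupp.single m (h m) = h m • Finsupp.single m 1 := by simp
  have e : shToDCom k χ c (Finsupp.single m (h m)) =
      (h m • op (dcomRels k) (symMon m) : (presented (dcomRels k)).obj L χ c) := by
    rw [this]
    refine (map_smul (shToDCom k χ c) _ _).trans ?_
    rw [shToDCom_single]
    rfl
  refine (congrArg (· ∈ Submodule.span k _) e).mpr ?_
  exact Submodule.smul_mem _ _ (Submodule.subset_span ⟨⟨m, (h2 m hm).1⟩, rfl⟩)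

end GB

/-- Neither `DCom` nor the value refers to an order of the inputs; an arbitrary one is chosen only
to have normal shuffle monomials at hand, which span and have independent values. -/
theorem dcomEval_injective (k : Type u) [Field k] {L : Type} [Finite L] (χ : L → Fin 2)
    (c : Fin 2) : Function.Injective (dcomEval k L χ c) := by
  have := Fintype.ofFinite L
  let _ : LinearOrder L := LinearOrder.lift' (Fintype.equivFin L) (Fintype.equivFin L).injective
  refine injective_of_span _ (span_normal k) _ (fun t => t.2.factors) (mono k)
    (linearIndependent_mono k) ?_ ?_
  · intro t
    exact (dcomEval_op k _).trans (t.2.eval k)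
  · intro t t' h
    have := ShMon.ext (t.2.factors_inj t'.2 h)
    rw [this]

/-! ### The monomials that occur as values of operations -/

section Words

variable {L : Type}

/-- The letters of a factor `w(x)`. -/
abbrev lettersOf (p : L × List L) : List L := p.1 :: p.2

/-- `S` is the set of factors of a normal monomial with inputs `(L, χ)` and output colour `c`. -/
structure IsFactorSet (χ : L → Fin 2) (c : Fin 2) (S : Multiset (L × List L)) : Prop where
  nodup : S.Nodup
  nodup_letters : ∀ p ∈ S, (lettersOf p).Nodup
  eq_of_mem : ∀ p ∈ S, ∀ p' ∈ S, ∀ l, l ∈ lettersOf p → l ∈ lettersOf p' → p = p'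
  cover : ∀ l, ∃ p ∈ S, l ∈ lettersOf p
  colour : (c = 0 ∧ S ≠ 0 ∧ ∀ p ∈ S, χ p.1 = 0 ∧ ∀ δ ∈ p.2, χ δ = 1) ∨
    (c = 1 ∧ ∃ l, S = {(l, [])} ∧ χ l = 1)

theorem nodup_flatMap_letters {P : List (L × List L)} :
    (P.flatMap lettersOf).Nodup ↔ P.Nodup ∧ (∀ p ∈ P, (lettersOf p).Nodup) ∧
      ∀ p ∈ P, ∀ p' ∈ P, ∀ l, l ∈ lettersOf p → l ∈ lettersOf p' → p = p' := by
  rw [List.nodup_flatMap]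
  constructor
  · rintro ⟨h1, h2⟩
    refine ⟨h2.imp ?_, h1, ?_⟩
    · rintro a b h rfl
      exact h (List.mem_cons_self (a := a.1)) List.mem_cons_self
    · intro p hp p' hp' l hl hl'
      by_contra hne
      have : Std.Symm (Function.onFun List.Disjoint (lettersOf (L := L))) :=
        ⟨fun _ _ h => h.symm⟩
      exact h2.forall hp hp' hne hl hl'
  · rintro ⟨h1, h2, h3⟩
    refine ⟨h2, List.Nodup.pairwise_of_forall_ne h1 ?_⟩
    intro p hp p' hp' hne l hl hl'
    exact hne (h3 p hp p' hp' l hl hl')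

theorem IsFactorSet.ne_zero {χ : L → Fin 2} {c : Fin 2} {S : Multiset (L × List L)} (h : IsFactorSet χ c S) :
    S ≠ 0 := by
  rcases h.colour with h | ⟨-, l, rfl, -⟩
  · exact h.2.1
  · simp

section Order

variable [LinearOrder L] {χ : L → Fin 2}

theorem chainTree_hasColour_zero {x : L} {w : List L} :
    HasColour shSig χ (chainTree x w) 0 ↔ χ x = 0 ∧ ∀ δ ∈ w, χ δ = 1 := by
  induction w with
  | nil => simp [chainTree, HasColour]
  | cons δ w ih =>
    rw [List.forall_mem_cons, ← and_assoc, and_comm (a := χ x = 0), and_assoc, ← ih, chainTree]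
    split_ifs
    · exact ⟨fun h => h.2, fun h => ⟨rfl, h⟩⟩
    · exact ⟨fun h => ⟨h.2.2, h.2.1⟩, fun h => ⟨rfl, h.2, h.1⟩⟩

theorem chainTree_hasColour_one {x : L} {w : List L} :
    HasColour shSig χ (chainTree x w) 1 ↔ χ x = 1 ∧ w = [] := by
  cases w with
  | nil => simp [chainTree, HasColour]
  | cons δ w =>
    simp only [reduceCtorEq, and_false, iff_false, chainTree]
    split_ifs <;> exact fun h => absurd h.1 (by simp [shSig])

theorem combTree_hasColour_zero {p : L × List L} {ps : List (L × List L)} :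
    HasColour shSig χ (combTree p ps) 0 ↔ ∀ q ∈ p :: ps, χ q.1 = 0 ∧ ∀ δ ∈ q.2, χ δ = 1 := by
  induction ps generalizing p with
  | nil => simpa [combTree] using chainTree_hasColour_zero
  | cons q ps ih =>
    rw [List.forall_mem_cons, ← ih, ← chainTree_hasColour_zero]
    exact ⟨fun h => ⟨h.2.2, h.2.1⟩, fun h => ⟨rfl, h.2, h.1⟩⟩

theorem combTree_hasColour_one {p : L × List L} {ps : List (L × List L)} :
    HasColour shSig χ (combTree p ps) 1 ↔ χ p.1 = 1 ∧ p.2 = [] ∧ ps = [] := by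
  cases ps with
  | nil => simpa [combTree] using chainTree_hasColour_one
  | cons q ps =>
    simp only [reduceCtorEq, and_false, iff_false, combTree]
    exact fun h => absurd h.1 (by simp [shSig])

/-- Nothing is assumed about the order of the factors: the letters of a comb and its colour
conditions depend only on the multiset of factors, and the disjointness conditions say that the
concatenation of all letters has no repetition. -/
theorem isFactorSet_coe_iff {c : Fin 2} {p : L × List L} {ps : List (L × List L)} :
    IsFactorSet χ c ↑(p :: ps) ↔ HasColour shSig χ (combTree p ps) c ∧
      (combTree p ps).leaves.Nodup ∧ ∀ l, l ∈ (combTree p ps).leaves := by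
  have hperm := leaves_combTree p ps
  rw [hperm.nodup_iff]
  simp only [hperm.mem_iff]
  have hcol : ((c = 0 ∧ (↑(p :: ps) : Multiset (L × List L)) ≠ 0 ∧
      ∀ q ∈ (↑(p :: ps) : Multiset (L × List L)), χ q.1 = 0 ∧ ∀ δ ∈ q.2, χ δ = 1) ∨
      (c = 1 ∧ ∃ l, (↑(p :: ps) : Multiset (L × List L)) = {(l, [])} ∧ χ l = 1)) ↔
      HasColour shSig χ (combTree p ps) c := by
    obtain rfl | rfl : c = 0 ∨ c = 1 := by omega
    · rw [combTree_hasColour_zero]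
      simp
    · rw [combTree_hasColour_one]
      have : ∀ l, ((↑(p :: ps) : Multiset (L × List L)) = {(l, [])} ↔ p = (l, []) ∧ ps = []) := by
        intro l
        rw [← Multiset.coe_singleton, Multiset.coe_eq_coe, List.perm_singleton]
        simp
      simp only [this]
      constructor
      · rintro (h | ⟨-, l, ⟨rfl, h⟩, hl⟩)
        · exact absurd h.1 (by decide)
        · exact ⟨hl, rfl, h⟩
      · rintro ⟨h1, h2, h3⟩
        exact Or.inr ⟨trivial, p.1, ⟨Prod.ext rfl h2, h3⟩, h1⟩
  constructor
  · rintro ⟨h1, h2, h3, h4, h5⟩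
    refine ⟨hcol.1 h5, nodup_flatMap_letters.2 ⟨h1, h2, h3⟩, fun l => ?_⟩
    obtain ⟨q, hq, hl⟩ := h4 l
    exact List.mem_flatMap.2 ⟨q, hq, hl⟩
  · rintro ⟨h1, h2, h3⟩
    obtain ⟨h4, h5, h6⟩ := nodup_flatMap_letters.1 h2
    exact ⟨h4, h5, h6, fun l => List.mem_flatMap.1 (h3 l), hcol.2 h1⟩

theorem isFactorSet_factors {c : Fin 2} (t : ShMon shSig χ c) (h : IsNormal t.tree) :
    IsFactorSet χ c h.factors := by
  have h1 := h.choose_spec.choose_spec.1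
  refine isFactorSet_coe_iff.2 ?_
  rw [← h1]
  exact ⟨t.coloured, t.nodup, t.mem⟩

/-- An unsorted comb need not be a shuffle tree, but it yields a monomial of the symmetric operad,
which suffices to realise the value. -/
theorem IsFactorSet.exists_mon (k : Type u) [Field k] {c : Fin 2} {S : Multiset (L × List L)}
    (h : IsFactorSet χ c S) :
    ∃ t : Mon dcomSig χ c, dcomEval k L χ c (op (dcomRels k) t) = mono k S := by
  induction S using Quotient.inductionOn with
  | h P =>
    cases P with
    | nil => exact absurd rfl h.ne_zero
    | cons p ps =>
      obtain ⟨h1, h2, h3⟩ := isFactorSet_coe_iff.1 h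
      have hp := symTree_perm (combTree p ps)
      refine ⟨⟨symTree (combTree p ps), symTree_coloured h1, hp.nodup_iff.2 h2,
        fun l => hp.mem_iff.2 (h3 l)⟩, ?_⟩
      rw [dcomEval_op]
      exact evalTree_combTree k p ps

end Order

/-- The image is described without reference to trees, so that `compEval` can be shown to have the
same one. -/
theorem range_dcomEval (k : Type u) [Field k] [Finite L] (χ : L → Fin 2) (c : Fin 2) :
    LinearMap.range (dcomEval k L χ c) = Submodule.span k (mono k '' {S | IsFactorSet χ c S}) := by
  have := Fintype.ofFinite L
  let _ : LinearOrder L := LinearOrder.lift' (Fintype.equivFin L) (Fintype.equivFin L).injective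
  refine range_of_span _ (span_normal k) _ _ ?_ ?_
  · intro t
    exact ⟨_, isFactorSet_factors t.1 t.2, ((dcomEval_op k _).trans (t.2.eval k)).symm⟩
  · rintro _ ⟨S, hS, rfl⟩
    obtain ⟨t, ht⟩ := hS.exists_mon k
    exact ⟨_, ht⟩

end Words

/-! ### The operad `Com` -/

section Commutative

variable (k : Type u) [Field k]

def comRels : Set (Rel comSig k) := {comComm k, comAssoc k}

variable {k} {L : Type} {χ : L → Fin 2} {c : Fin 2}

theorem com_eqv_comm {a b : BTree ComGen L} {t t' : Mon comSig χ c}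
    (ht : t.tree = node .al a b) (ht' : t'.tree = node .al b a) : Eqv (comRels k) t t' := by
  obtain rfl : (0 : Fin 2) = c := by
    have := t.coloured; rw [ht] at this; exact this.1
  let x : Mon comSig ![0, 0] 0 := ⟨node .al (leaf 0) (leaf 1),
    by simp [HasColour, comSig], by simp [leaves], by decide⟩
  let y : Mon comSig ![0, 0] 0 := ⟨node .al (leaf 1) (leaf 0),
    by simp [HasColour, comSig], by simp [leaves], by decide⟩
  have h : Eqv (comRels k) x y :=
    elt_mem_idealSpan (R := comRels k) (r := comComm k) (Or.inl rfl)
  exact h.of_bind ![a, b] ht ht'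

theorem com_eqv_assoc {a b d : BTree ComGen L} {t t' : Mon comSig χ c}
    (ht : t.tree = node .al (node .al a b) d) (ht' : t'.tree = node .al a (node .al b d)) :
    Eqv (comRels k) t t' := by
  obtain rfl : (0 : Fin 2) = c := by
    have := t.coloured; rw [ht] at this; exact this.1
  let x : Mon comSig ![0, 0, 0] 0 := ⟨node .al (node .al (leaf 0) (leaf 1)) (leaf 2),
    by simp [HasColour, comSig], by simp [leaves], by decide⟩
  let y : Mon comSig ![0, 0, 0] 0 := ⟨node .al (leaf 0) (node .al (leaf 1) (leaf 2)),
    by simp [HasColour, comSig], by simp [leaves], by decide⟩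
  have h : Eqv (comRels k) x y :=
    elt_mem_idealSpan (R := comRels k) (r := comAssoc k) (Or.inr rfl)
  exact h.of_bind ![a, b, d] ht ht'

/-- Each input can be moved to the front. -/
theorem com_exists_front (t : Mon comSig χ c) (ht : t.tree.size ≠ 0) (l : L) :
    ∃ (y : BTree ComGen L) (t' : Mon comSig χ c),
      t'.tree = node .al (leaf l) y ∧ Eqv (comRels k) t t' := by
  obtain ⟨n, hn⟩ : ∃ n, t.tree.size = n := ⟨_, rfl⟩
  induction n using Nat.strong_induction_on generalizing L c with
  | _ n ih =>
    -- The case of `l` in the left branch: that branch is `l` itself, or `l` is brought to its front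
    -- by induction and associativity is applied. The other case reduces to this one by
    -- commutativity.
    have key : ∀ (t : Mon comSig χ c) (a b : BTree ComGen L), t.tree = node .al a b →
        t.tree.size = n → l ∈ a.leaves → ∃ (y : BTree ComGen L) (t' : Mon comSig χ c),
          t'.tree = node .al (leaf l) y ∧ Eqv (comRels k) t t' := by
      intro t a b hab hn hl
      by_cases ha : a.size = 0
      · cases a with
        | leaf l' =>
          obtain rfl : l = l' := by simpa [leaves] using hl
          exact ⟨b, t, hab, Eqv.refl t⟩
        | node => simp [size] at ha
      · obtain ⟨π, u₀, u₁, h₀, h₁, h⟩ := exists_branches.{u} hab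
        have hl0 : l ∈ (u₀.tree.map Subtype.val).leaves := h₀ ▸ hl
        rw [leaves_map, List.mem_map] at hl0
        obtain ⟨l₀, -, rfl⟩ := hl0
        have hsize : u₀.tree.size = a.size :=
          (size_map Subtype.val u₀.tree).symm.trans (congrArg size h₀)
        have hlt : a.size < n := by
          have : a.size + b.size + 1 = n := by rw [← hn, hab]; rfl
          omega
        obtain ⟨y, t₀, ht₀, e₀⟩ := ih _ hlt u₀ (hsize ▸ ha) l₀ hsize
        obtain ⟨t', ht', e⟩ := h (comRels k) t₀ u₁ e₀ (Eqv.refl _)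
        rw [ht₀] at ht'
        have ht'' : t'.tree = node ComGen.al (node ComGen.al (leaf ↑l₀) (y.map Subtype.val))
          (u₁.tree.map Subtype.val) := ht'
        have hcol := t'.coloured
        rw [ht''] at hcol
        let t'' := t'.ofPerm (node ComGen.al (leaf ↑l₀)
          (node ComGen.al (y.map Subtype.val) (u₁.tree.map Subtype.val)))
          ⟨hcol.1, hcol.2.1.2.1, rfl, hcol.2.1.2.2, hcol.2.2⟩
          (by rw [ht'']; exact List.Perm.of_eq (List.append_assoc _ _ _).symm)
        exact ⟨_, t'', rfl, e.trans (com_eqv_assoc ht'' rfl)⟩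
    cases htree : t.tree with
    | leaf l' => rw [htree] at ht; exact absurd rfl ht
    | node g a b =>
      have hl := t.mem l
      have hcol := t.coloured
      rw [htree] at hl hcol
      rcases List.mem_append.1 hl with hl | hl
      · exact key t a b htree hn hl
      · let t' := t.ofPerm (node ComGen.al b a) ⟨hcol.1, hcol.2.2, hcol.2.1⟩
          (by rw [htree]; exact List.perm_append_comm)
        have hsize : t'.tree.size = n := by
          rw [← hn, htree]
          change b.size + a.size + 1 = a.size + b.size + 1
          omega
        obtain ⟨y, t'', ht'', e⟩ := key t' b a rfl hsize hl
        exact ⟨y, t'', ht'', (com_eqv_comm htree rfl).trans e⟩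

/-- All products of the same elements are equal. -/
theorem com_eqv (t t' : Mon comSig χ c) : Eqv (comRels k) t t' := by
  obtain ⟨n, hn⟩ : ∃ n, t.tree.size = n := ⟨_, rfl⟩
  induction n using Nat.strong_induction_on generalizing L c with
  | _ n ih =>
    have hsize : t'.tree.size = t.tree.size := by
      have := t.size_eq
      have := t'.size_eq
      omega
    by_cases h0 : t.tree.size = 0
    · have hleaf : ∀ x : BTree ComGen L, x.size = 0 → ∃ l, x = leaf l := by
        intro x hx
        cases x with
        | leaf l => exact ⟨l, rfl⟩
        | node => simp [size] at hx
      obtain ⟨l, hl⟩ := hleaf _ h0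
      obtain ⟨l', hl'⟩ := hleaf _ (hsize.trans h0)
      have := t.mem l'
      rw [hl] at this
      obtain rfl : l' = l := by simpa [leaves] using this
      exact Eqv.of_tree_eq (hl.trans hl'.symm)
    -- The same letter is moved to the front of both products; what remains has the same inputs on
    -- both sides and is settled by induction.
    · obtain ⟨l, -⟩ := t.tree.exists_mem_leaves
      obtain ⟨y, s, hs, e⟩ := com_exists_front (k := k) t h0 l
      obtain ⟨y', s', hs', e'⟩ := com_exists_front (k := k) t' (hsize ▸ h0) l
      refine e.trans (Eqv.trans ?_ e'.symm)
      have hperm : y'.leaves.Perm y.leaves := by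
        have h1 := s.nodup
        have h2 := s'.nodup
        have h3 := s.mem
        have h4 := s'.mem
        rw [hs] at h1 h3
        rw [hs'] at h2 h4
        simp only [leaves, List.singleton_append, List.nodup_cons, List.mem_cons] at h1 h2 h3 h4
        refine (List.perm_ext_iff_of_nodup h2.2 h1.2).2 fun m => ?_
        by_cases hm : m = l
        · subst hm; exact ⟨fun h => absurd h h2.1, fun h => absurd h h1.1⟩
        · exact ⟨fun _ => (h3 m).resolve_left hm, fun _ => (h4 m).resolve_left hm⟩
      obtain ⟨π, u₀, u₁, h₀, h₁, h⟩ := exists_branches.{u} hs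
      have hl₁ : y.leaves = u₁.tree.leaves.map Subtype.val :=
        (congrArg leaves h₁).symm.trans (leaves_map _ _)
      have hmem : ∀ m ∈ y'.leaves, π m = 1 := by
        intro m hm
        have := hperm.mem_iff.1 hm
        rw [hl₁, List.mem_map] at this
        obtain ⟨x, -, rfl⟩ := this
        exact x.2
      obtain ⟨z, hz⟩ := exists_map_eq (fun m => π m = 1) y' hmem
      have hcol := s'.coloured
      rw [hs', ← hz] at hcol
      let v₁ := u₁.ofPerm z (HasColour.of_map (σ := comSig) (χ := χ) Subtype.val (fun _ => rfl)
        hcol.2.2) (by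
          have hl' : y'.leaves = z.leaves.map Subtype.val :=
            (congrArg leaves hz).symm.trans (leaves_map _ _)
          rw [hl', hl₁] at hperm
          exact (List.map_perm_map_iff Subtype.val_injective).1 hperm)
      have hlt : u₁.tree.size < n := by
        have h1 := s.size_eq
        have h2 := t.size_eq
        have h3 : s.tree.size = 0 + y.size + 1 := congrArg size hs
        have h4 : u₁.tree.size = y.size :=
          (size_map Subtype.val u₁.tree).symm.trans (congrArg size h₁)
        omega
      obtain ⟨s'', hs'', e''⟩ := h (comRels k) u₀ v₁ (Eqv.refl _) (ih _ hlt u₁ v₁ rfl)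
      refine e''.trans (Eqv.of_tree_eq ?_)
      rw [hs'', hs', h₀, ← hz]
      rfl

theorem exists_comMon {A : Type} [Finite A] [Nonempty A] (f : A → Fin 2) (hf : ∀ a, f a = 0) :
    Nonempty (Mon comSig f 0) := by
  have key : ∀ (a : A) (P : List A), ∃ t : BTree ComGen A, t.leaves = a :: P ∧
      t.HasColour comSig f 0 := by
    intro a P
    induction P generalizing a with
    | nil => exact ⟨leaf a, rfl, hf a⟩
    | cons b P ih =>
      obtain ⟨t, h1, h2⟩ := ih b
      exact ⟨node ComGen.al (leaf a) t, by simp [leaves, h1], rfl, hf a, h2⟩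
  have := Fintype.ofFinite A
  obtain ⟨P, hP⟩ : ∃ P, P = (Finset.univ : Finset A).toList := ⟨_, rfl⟩
  cases P with
  | nil => exact absurd hP.symm (by simp [Finset.univ_eq_empty_iff])
  | cons a P =>
    obtain ⟨t, h1, h2⟩ := key a P
    replace h1 := h1.trans hP
    refine ⟨⟨t, h2, h1 ▸ Finset.nodup_toList _, fun l => ?_⟩⟩
    have : l ∈ (Finset.univ : Finset A).toList := by simp
    rwa [← h1] at this

theorem comSig_colour_zero {A : Type} {f : A → Fin 2} {t : BTree ComGen A}
    (h : t.HasColour comSig f 0) : ∀ a ∈ t.leaves, f a = 0 := by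
  induction t with
  | leaf b =>
    intro a ha
    obtain rfl : a = b := by simpa [leaves] using ha
    exact h
  | node g x y hx hy =>
    intro a ha
    rcases List.mem_append.1 ha with ha | ha
    · exact hx h.2.1 a ha
    · exact hy h.2.2 a ha

theorem comSig_colour_one {A : Type} {f : A → Fin 2} {t : BTree ComGen A}
    (h : t.HasColour comSig f 1) : ∃ a, t = leaf a := by
  cases t with
  | leaf a => exact ⟨a, rfl⟩
  | node g x y => exact absurd h.1 (by simp [comSig])

variable (k)

/-- Relabellings and compositions send monomials to monomials and so preserve the sum of
coefficients. The relations of `Com` are differences of two monomials, so no monomial becomes zero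
in `Com`. -/
theorem isIdeal_sum_zero :
    IsIdeal (σ := comSig) (k := k) (fun _ χ c =>
      LinearMap.ker (Finsupp.linearCombination k (fun _ : Mon comSig χ c => (1 : k)))) where
  relabel_mem e h f hf := by
    rw [LinearMap.mem_ker] at hf ⊢
    rw [Finsupp.lmapDomain_apply, Finsupp.linearCombination_mapDomain]
    exact hf
  comp_root_mem π t f hf := by
    rw [LinearMap.mem_ker] at hf ⊢
    rw [Finsupp.lmapDomain_apply, Finsupp.linearCombination_mapDomain]
    exact hf
  comp_input_mem π T t a f hf := by
    rw [LinearMap.mem_ker] at hf ⊢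
    rw [Finsupp.lmapDomain_apply, Finsupp.linearCombination_mapDomain]
    exact hf

/-- The linear form on the operations of `Com` with the value `1` on all monomials. -/
noncomputable def comCounit (L : Type) (χ : L → Fin 2) (c : Fin 2) :
    (presented (comRels k)).obj L χ c →ₗ[k] k :=
  opLift (comRels k) (fun _ => 1) (fun f hf => by
    refine mem_idealSpan.1 hf _ (isIdeal_sum_zero k) ?_
    have h : ∀ {A : Type} {χ : A → Fin 2} {c : Fin 2} (a b : Mon comSig χ c),
        Finsupp.linearCombination k (fun _ : Mon comSig χ c => (1 : k))
          (Finsupp.single a 1 - Finsupp.single b 1) = 0 := by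
      intro A χ c a b
      rw [map_sub, Finsupp.linearCombination_single, Finsupp.linearCombination_single, sub_self]
    rintro r (rfl | rfl) <;> exact h _ _)

theorem comCounit_op (t : Mon comSig χ c) : comCounit k L χ c (op (comRels k) t) = 1 :=
  opLift_op _ _ _ _

theorem comCounit_map {L' : Type} {χ' : L' → Fin 2} {c' : Fin 2} (e : L ≃ L')
    (h : ∀ l, χ' (e l) = χ l) (hc : c = c') (x : (presented (comRels k)).obj L χ c) :
    comCounit k L' χ' c' ((presented (comRels k)).map e h hc x) = comCounit k L χ c x := by
  induction x using op_induction with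
  | h0 => simp only [map_zero]
  | hadd x y hx hy => simp only [map_add, hx, hy]
  | hsmul r x hx => simp only [map_smul, hx]
  | hop t => rw [presented_map_op, comCounit_op, comCounit_op]

end Commutative

/-! ### The free operad on `d` -/

section FreeDer

variable {L A : Type} {χ : L → Fin 2} {c : Fin 2}

/-- The word of derivations of a tree in `d`, and the element to which it is applied. -/
def derWord : BTree DerGen L → L × List L
  | .leaf x => (x, [])
  | .node _ a b => ((derWord a).1, (derWord b).1 :: (derWord a).2)

def derChain (x : L) : List L → BTree DerGen L
  | [] => leaf x
  | δ :: w => node .d (derChain x w) (leaf δ)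

theorem derWord_map (f : A → L) (t : BTree DerGen A) :
    derWord (t.map f) = Prod.map f (List.map f) (derWord t) := by
  induction t with
  | leaf a => rfl
  | node g a b ha hb => simp [BTree.map, derWord, ha, hb]

theorem derWord_derChain (x : L) (w : List L) : derWord (derChain x w) = (x, w) := by
  induction w with
  | nil => rfl
  | cons δ w ih => simp [derChain, derWord, ih]

theorem leaves_derChain (x : L) (w : List L) : (derChain x w).leaves.Perm (x :: w) := by
  induction w with
  | nil => exact List.Perm.refl _
  | cons δ w ih =>
    exact (List.perm_append_comm (l₁ := (derChain x w).leaves)).trans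
      ((ih.cons δ).trans (List.Perm.swap _ _ _))

/-- The second input of `d` has colour 1, which is not the output colour of any vertex, so all
second branches are leaves. -/
theorem eq_derChain {t : BTree DerGen L} (h : t.HasColour derSig χ c) :
    t = derChain (derWord t).1 (derWord t).2 := by
  induction t generalizing c with
  | leaf x => rfl
  | node g a b ha hb =>
    cases b with
    | leaf δ =>
      cases g
      exact congrArg (fun a => node DerGen.d a (leaf δ)) (ha h.2.1)
    | node g' x y => exact absurd h.2.2.1 (by simp [derSig])

theorem colour_derWord {t : BTree DerGen L} (h : t.HasColour derSig χ c) :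
    χ (derWord t).1 = c := by
  induction t generalizing c with
  | leaf x => exact h
  | node g a b ha hb => exact (ha h.2.1).trans h.1

theorem derChain_hasColour_zero {x : L} {w : List L} :
    (derChain x w).HasColour derSig χ 0 ↔ χ x = 0 ∧ ∀ δ ∈ w, χ δ = 1 := by
  induction w with
  | nil => simp [derChain, HasColour]
  | cons δ w ih =>
    rw [List.forall_mem_cons, ← and_assoc, and_comm (a := χ x = 0), and_assoc, ← ih, derChain]
    exact ⟨fun h => ⟨h.2.2, h.2.1⟩, fun h => ⟨rfl, h.2, h.1⟩⟩

theorem derChain_hasColour_one {x : L} {w : List L} :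
    (derChain x w).HasColour derSig χ 1 ↔ χ x = 1 ∧ w = [] := by
  cases w with
  | nil => simp [derChain, HasColour]
  | cons δ w =>
    simp only [reduceCtorEq, and_false, iff_false, derChain]
    exact fun h => absurd h.1 (by simp [derSig])

variable (k : Type u) [Field k]

theorem idealSpan_empty {I : Type} {σ : Signature I} {L : Type} {χ : L → I} {c : I}
    {f : Free σ k χ c} (hf : f ∈ idealSpan (∅ : Set (Rel σ k)) L χ c) : f = 0 := by
  refine mem_idealSpan.1 hf (fun _ _ _ => ⊥) ⟨?_, ?_, ?_⟩ (by simp)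
  · intro L L' χ χ' c e h f hf
    rw [Submodule.mem_bot] at hf ⊢
    rw [hf, map_zero]
  · intro L A χ ψ c π t f hf
    rw [Submodule.mem_bot] at hf ⊢
    rw [hf, map_zero]
  · intro L A χ ψ c π T t a f hf
    rw [Submodule.mem_bot] at hf ⊢
    rw [hf, map_zero]

noncomputable def derEval (L : Type) (χ : L → Fin 2) (c : Fin 2) :
    (presented (∅ : Set (Rel derSig k))).obj L χ c →ₗ[k] DPoly k L :=
  opLift ∅ (fun t => MvPolynomial.X (derWord t.tree)) (fun f hf => by
    rw [idealSpan_empty k hf, map_zero])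

theorem derEval_op (t : Mon derSig χ c) :
    derEval k L χ c (op ∅ t) = MvPolynomial.X (derWord t.tree) :=
  opLift_op _ _ _ _

theorem derEval_map {L' : Type} {χ' : L' → Fin 2} {c' : Fin 2} (e : L ≃ L')
    (h : ∀ l, χ' (e l) = χ l) (hc : c = c')
    (x : (presented (∅ : Set (Rel derSig k))).obj L χ c) :
    derEval k L' χ' c' ((presented (∅ : Set (Rel derSig k))).map e h hc x) =
      letterMap k e (derEval k L χ c x) := by
  induction x using op_induction with
  | h0 => simp only [map_zero]
  | hadd x y hx hy => simp only [map_add, hx, hy]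
  | hsmul r x hx => simp only [map_smul, hx]
  | hop t =>
    rw [presented_map_op, derEval_op, derEval_op, letterMap, MvPolynomial.rename_X]
    exact congrArg _ (derWord_map _ _)

end FreeDer

/-! ### Spanning families of tensor products and direct sums -/

section Spanning

variable {k : Type*} [Field k]

/-- Induction on a finite set of positions outside which the entries already belong to the spanning
families; one more entry is expanded at a time by multilinearity. -/
theorem span_range_tprod {ι : Type*} [Finite ι] {V : ι → Type*} [∀ b, AddCommGroup (V b)]
    [∀ b, Module k (V b)] {J : ι → Type*} (v : ∀ b, J b → V b)
    (hv : ∀ b, Submodule.span k (Set.range (v b)) = ⊤) :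
    Submodule.span k (Set.range fun f : ∀ b, J b => PiTensorProduct.tprod k fun b => v b (f b))
      = ⊤ := by
  classical
  have := Fintype.ofFinite ι
  rw [eq_top_iff, ← PiTensorProduct.span_tprod_eq_top, Submodule.span_le]
  rintro _ ⟨x, rfl⟩
  have key : ∀ s : Finset ι, ∀ x : ∀ b, V b, (∀ b ∉ s, x b ∈ Set.range (v b)) →
      PiTensorProduct.tprod k x ∈ Submodule.span k
        (Set.range fun f : ∀ b, J b => PiTensorProduct.tprod k fun b => v b (f b)) := by
    intro s
    induction s using Finset.induction_on with
    | empty =>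
      intro x hx
      choose f hf using fun b => hx b (Finset.notMem_empty b)
      refine Submodule.subset_span ⟨f, ?_⟩
      exact congrArg _ (funext hf)
    | insert a s ha ih =>
      intro x hx
      have hstep : ∀ y : V a, PiTensorProduct.tprod k (Function.update x a y) ∈ Submodule.span k
          (Set.range fun f : ∀ b, J b => PiTensorProduct.tprod k fun b => v b (f b)) := by
        intro y
        have hy : y ∈ Submodule.span k (Set.range (v a)) := hv a ▸ Submodule.mem_top
        induction hy using Submodule.span_induction with
        | mem y hy =>
          refine ih _ fun b hb => ?_
          by_cases hba : b = a
          · subst hba; rwa [Function.update_self]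
          · rw [Function.update_of_ne hba]
            exact hx b (by simp [hba, hb])
        | zero => rw [MultilinearMap.map_update_zero]; exact zero_mem _
        | add y z _ _ hy hz => rw [MultilinearMap.map_update_add]; exact add_mem hy hz
        | smul r y _ hy => rw [MultilinearMap.map_update_smul]; exact Submodule.smul_mem _ r hy
      have := hstep (x a)
      rwa [Function.update_eq_self] at this
  exact key Finset.univ x fun b hb => absurd (Finset.mem_univ b) hb

theorem span_range_tmul {V W J K : Type*} [AddCommGroup V] [Module k V] [AddCommGroup W]
    [Module k W] (v : J → V) (hv : Submodule.span k (Set.range v) = ⊤) (w : K → W)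
    (hw : Submodule.span k (Set.range w) = ⊤) :
    Submodule.span k (Set.range fun p : J × K => v p.1 ⊗ₜ[k] w p.2) = ⊤ := by
  rw [eq_top_iff, ← TensorProduct.span_tmul_eq_top, Submodule.span_le]
  rintro _ ⟨x, y, rfl⟩
  have hx : x ∈ Submodule.span k (Set.range v) := hv ▸ Submodule.mem_top
  have hy : y ∈ Submodule.span k (Set.range w) := hw ▸ Submodule.mem_top
  change x ⊗ₜ[k] y ∈ Submodule.span k _
  induction hx using Submodule.span_induction with
  | mem x hx =>
    obtain ⟨j, rfl⟩ := hx
    induction hy using Submodule.span_induction with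
    | mem y hy => obtain ⟨l, rfl⟩ := hy; exact Submodule.subset_span ⟨(j, l), rfl⟩
    | zero => rw [TensorProduct.tmul_zero]; exact zero_mem _
    | add y z _ _ hy hz => rw [TensorProduct.tmul_add]; exact add_mem hy hz
    | smul r y _ hy => rw [TensorProduct.tmul_smul]; exact Submodule.smul_mem _ r hy
  | zero => rw [TensorProduct.zero_tmul]; exact zero_mem _
  | add x z _ _ hx hz => rw [TensorProduct.add_tmul]; exact add_mem hx hz
  | smul r x _ hx => rw [← TensorProduct.smul_tmul']; exact Submodule.smul_mem _ r hx

theorem span_range_lof {ι : Type*} [DecidableEq ι] {V : ι → Type*} [∀ i, AddCommGroup (V i)]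
    [∀ i, Module k (V i)] {J : ι → Type*} (v : ∀ i, J i → V i)
    (hv : ∀ i, Submodule.span k (Set.range (v i)) = ⊤) :
    Submodule.span k (Set.range fun p : Σ i, J i => DirectSum.lof k ι V p.1 (v p.1 p.2)) = ⊤ := by
  rw [eq_top_iff]
  rintro x -
  induction x using DirectSum.induction_on with
  | zero => exact zero_mem _
  | add x y hx hy => exact add_mem hx hy
  | of i x =>
    have hx : x ∈ Submodule.span k (Set.range (v i)) := hv i ▸ Submodule.mem_top
    change DirectSum.lof k ι V i x ∈ _
    induction hx using Submodule.span_induction with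
    | mem x hx => obtain ⟨j, rfl⟩ := hx; exact Submodule.subset_span ⟨⟨i, j⟩, rfl⟩
    | zero => rw [map_zero]; exact zero_mem _
    | add x y _ _ hx hy => rw [map_add]; exact add_mem hx hy
    | smul r x _ hx => rw [map_smul]; exact Submodule.smul_mem _ r hx

end Spanning

/-! ### The composition `Com ∘ F(d)` -/

section Composition

open SymCollection

variable {L L' : Type} {χ : L → Fin 2} {χ' : L' → Fin 2} {c c' : Fin 2}

/-- A choice of a monomial of `F(d)` for each block of a coloured partition. -/
abbrev BlockMon (χ : L → Fin 2) (i : CPart (Fin 2) L) : Type :=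
  ∀ b : Quotient i.1, Mon derSig (fun l : {l : L // Quotient.mk i.1 l = b} => χ l) (i.2 b)

def BlockMon.word {i : CPart (Fin 2) L} (t : BlockMon χ i) (b : Quotient i.1) : L × List L :=
  Prod.map Subtype.val (List.map Subtype.val) (derWord (t b).tree)

namespace BlockMon

variable {i : CPart (Fin 2) L} (t : BlockMon χ i)

theorem word_eq (b : Quotient i.1) : t.word b = derWord ((t b).tree.map Subtype.val) :=
  (derWord_map _ _).symm

theorem map_tree (b : Quotient i.1) :
    (t b).tree.map Subtype.val = derChain (t.word b).1 (t.word b).2 := by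
  rw [word_eq]
  exact eq_derChain ((t b).coloured.map Subtype.val fun _ => rfl)

theorem lettersOf_perm (b : Quotient i.1) :
    (lettersOf (t.word b)).Perm ((t b).tree.leaves.map Subtype.val) := by
  have h : ((t b).tree.map Subtype.val).leaves = (t b).tree.leaves.map Subtype.val :=
    leaves_map _ _
  rw [← h, map_tree]
  exact (leaves_derChain _ _).symm

theorem mem_lettersOf {b : Quotient i.1} {l : L} :
    l ∈ lettersOf (t.word b) ↔ Quotient.mk i.1 l = b := by
  rw [(t.lettersOf_perm b).mem_iff, List.mem_map]
  exact ⟨fun ⟨x, _, hx⟩ => hx ▸ x.2, fun h => ⟨⟨l, h⟩, (t b).mem _, rfl⟩⟩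

theorem word_injective : Function.Injective t.word := by
  intro b b' h
  rw [← t.mem_lettersOf.1 (List.mem_cons_self (a := (t.word b).1)), ← t.mem_lettersOf, ← h]
  exact List.mem_cons_self

theorem colour_word (b : Quotient i.1) : χ (t.word b).1 = i.2 b :=
  colour_derWord (t b).coloured

variable [Finite L]

noncomputable def words : Multiset (L × List L) :=
  letI := Fintype.ofFinite (Quotient i.1)
  Finset.univ.val.map t.word

theorem mem_words {p : L × List L} : p ∈ t.words ↔ ∃ b, t.word b = p := by
  simp [words]

theorem word_mem (b : Quotient i.1) : t.word b ∈ t.words := t.mem_words.2 ⟨b, rfl⟩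

theorem nodup_words : t.words.Nodup := by
  let _ := Fintype.ofFinite (Quotient i.1)
  exact (Multiset.nodup_map_iff_of_injective t.word_injective).2 Finset.univ.nodup

theorem rel_iff (a b : L) : i.1 a b ↔ ∃ p ∈ t.words, a ∈ lettersOf p ∧ b ∈ lettersOf p := by
  constructor
  · intro h
    exact ⟨_, t.word_mem (Quotient.mk i.1 b), t.mem_lettersOf.2 (Quotient.sound h),
      t.mem_lettersOf.2 rfl⟩
  · rintro ⟨p, hp, ha, hb⟩
    obtain ⟨x, rfl⟩ := t.mem_words.1 hp
    exact Quotient.exact ((t.mem_lettersOf.1 ha).trans (t.mem_lettersOf.1 hb).symm)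

theorem isFactorSet_words (T : Mon comSig i.2 c) : IsFactorSet χ c t.words := by
  refine ⟨t.nodup_words, ?_, ?_, ?_, ?_⟩
  · intro p hp
    obtain ⟨b, rfl⟩ := t.mem_words.1 hp
    exact (t.lettersOf_perm b).nodup_iff.2 ((t b).nodup.map Subtype.val_injective)
  · intro p hp p' hp' l hl hl'
    obtain ⟨b, rfl⟩ := t.mem_words.1 hp
    obtain ⟨b', rfl⟩ := t.mem_words.1 hp'
    rw [← t.mem_lettersOf.1 hl, ← t.mem_lettersOf.1 hl']
  · intro l
    exact ⟨_, t.word_mem (Quotient.mk i.1 l), t.mem_lettersOf.2 rfl⟩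
  · have hcol : ∀ b, (derChain (t.word b).1 (t.word b).2).HasColour derSig χ (i.2 b) := by
      intro b
      rw [← t.map_tree b]
      exact (t b).coloured.map Subtype.val fun _ => rfl
    obtain rfl | rfl : c = 0 ∨ c = 1 := by omega
    · refine Or.inl ⟨rfl, ?_, ?_⟩
      · obtain ⟨b, -⟩ := T.tree.exists_mem_leaves
        intro h
        have := t.word_mem b
        rw [h] at this
        exact absurd this (Multiset.notMem_zero _)
      · intro p hp
        obtain ⟨b, rfl⟩ := t.mem_words.1 hp
        have := hcol b
        rw [comSig_colour_zero T.coloured b (T.mem b)] at this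
        exact derChain_hasColour_zero.1 this
    · obtain ⟨b, hb⟩ := comSig_colour_one T.coloured
      have h1 : i.2 b = 1 := by
        have := T.coloured
        rw [hb] at this
        exact this
      have h2 := hcol b
      rw [h1] at h2
      obtain ⟨h2, h3⟩ := derChain_hasColour_one.1 h2
      refine Or.inr ⟨rfl, (t.word b).1, ?_, h2⟩
      refine (Multiset.Nodup.ext t.nodup_words (Multiset.nodup_singleton _)).2 fun p => ?_
      have hp : ((t.word b).1, []) = t.word b := Prod.ext rfl h3.symm
      rw [Multiset.mem_singleton, hp, t.mem_words]
      refine ⟨?_, fun h => ⟨b, h.symm⟩⟩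
      rintro ⟨b', rfl⟩
      have := T.mem b'
      rw [hb] at this
      rw [show b' = b by simpa [leaves] using this]

end BlockMon

/-- The blocks are the letter sets of the factors, so the partition is the kernel of the map from a
letter to its factor. A block is coloured by the letter x of its factor w(x), which is the output
colour of the chain. -/
theorem IsFactorSet.exists_blockMon [Finite L] {S : Multiset (L × List L)}
    (h : IsFactorSet χ c S) :
    ∃ (i : CPart (Fin 2) L) (_ : Mon comSig i.2 c) (t : BlockMon χ i), t.words = S := by
  choose p hpS hp using h.cover
  let r : Setoid L := Setoid.ker p
  let pOf : Quotient r → L × List L := Quotient.lift p fun _ _ h => h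
  have hpOf : ∀ b, pOf b ∈ S := fun b => Quotient.inductionOn b hpS
  have hinj : ∀ b b', pOf b = pOf b' → b = b' := by
    intro b b'
    induction b using Quotient.inductionOn
    induction b' using Quotient.inductionOn
    exact fun h => Quotient.sound h
  let f : Quotient r → Fin 2 := fun b => χ (pOf b).1
  have hc : ∀ b, (derChain (pOf b).1 (pOf b).2).HasColour derSig χ (f b) := by
    intro b
    rcases h.colour with ⟨-, -, h0⟩ | ⟨-, l, rfl, hl⟩
    · have h1 := h0 _ (hpOf b)
      change (derChain (pOf b).1 (pOf b).2).HasColour derSig χ (χ (pOf b).1)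
      rw [h1.1]
      exact derChain_hasColour_zero.2 h1
    · have h1 := Multiset.mem_singleton.1 (hpOf b)
      change (derChain (pOf b).1 (pOf b).2).HasColour derSig χ (χ (pOf b).1)
      rw [h1]
      exact rfl
  let s : Quotient r → BTree derSig.Gen L := fun b => derChain (pOf b).1 (pOf b).2
  obtain ⟨π, hπ, t, ht⟩ := exists_fibres s hc
    (fun b => (leaves_derChain _ _).nodup_iff.2 (h.nodup_letters _ (hpOf b)))
    (fun b b' l hl hl' => hinj b b' (h.eq_of_mem _ (hpOf b) _ (hpOf b') l
      ((leaves_derChain _ _).mem_iff.1 hl) ((leaves_derChain _ _).mem_iff.1 hl')))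
    (fun l => ⟨Quotient.mk r l, (leaves_derChain _ _).mem_iff.2 (hp l)⟩)
  obtain rfl : π = Quotient.mk r := by
    funext l
    exact (hπ _ l).1 ((leaves_derChain _ _).mem_iff.2 (hp l))
  have hT : Nonempty (Mon comSig f c) := by
    rcases h.colour with ⟨rfl, hS, h0⟩ | ⟨rfl, l, rfl, hl⟩
    · obtain ⟨q, hq⟩ := Multiset.exists_mem_of_ne_zero hS
      have : Nonempty (Quotient r) := ⟨Quotient.mk r q.1⟩
      exact exists_comMon f fun b => (h0 _ (hpOf b)).1
    · refine ⟨⟨leaf (Quotient.mk r l), ?_, by simp [leaves], fun b => ?_⟩⟩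
      · change χ (pOf _).1 = 1
        rw [Multiset.mem_singleton.1 (hpOf (Quotient.mk r l))]
        exact hl
      · have : b = Quotient.mk r l := hinj _ _ ((Multiset.mem_singleton.1 (hpOf b)).trans
          (Multiset.mem_singleton.1 (hpOf _)).symm)
        simp [leaves, this]
  refine ⟨⟨r, f⟩, hT.some, t, ?_⟩
  have hw : ∀ b, BlockMon.word (i := ⟨r, f⟩) t b = pOf b := by
    intro b
    refine (BlockMon.word_eq (i := ⟨r, f⟩) t b).trans ((congrArg derWord (ht b)).trans ?_)
    exact derWord_derChain _ _
  refine (Multiset.Nodup.ext (BlockMon.nodup_words _) h.nodup).2 fun q => ?_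
  rw [BlockMon.mem_words]
  constructor
  · rintro ⟨b, rfl⟩
    rw [hw]
    exact hpOf b
  · intro hq
    exact ⟨Quotient.mk r q.1, (hw _).trans (h.eq_of_mem _ (hpS q.1) _ hq q.1 (hp q.1)
      List.mem_cons_self)⟩

variable (k : Type u) [Field k]

/-- The operations of `F(d)` on the blocks of a partition. -/
abbrev BlockTensor (χ : L → Fin 2) (i : CPart (Fin 2) L) : Type u :=
  PiTensorProduct k fun b : Quotient i.1 =>
    (presented (∅ : Set (Rel derSig k))).obj {l : L // Quotient.mk i.1 l = b} (fun l => χ l) (i.2 b)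

/-- The product of the values of the operations of the blocks. -/
noncomputable def blockEval [Finite L] (χ : L → Fin 2) (i : CPart (Fin 2) L) :
    BlockTensor k χ i →ₗ[k] DPoly k L :=
  letI := Fintype.ofFinite (Quotient i.1)
  PiTensorProduct.lift ((MultilinearMap.mkPiAlgebra k (Quotient i.1) (DPoly k L)).compLinearMap
    fun b => (letterMap k Subtype.val).toLinearMap ∘ₗ 
      derEval k {l : L // Quotient.mk i.1 l = b} (fun l => χ l) (i.2 b))

/-- Writing the value as a `finprod` removes the chosen `Fintype` structure on the blocks, so the
product can be reindexed along a bijection of blocks. -/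
theorem blockEval_tprod [Finite L] (i : CPart (Fin 2) L)
    (y : ∀ b : Quotient i.1, (presented (∅ : Set (Rel derSig k))).obj
      {l : L // Quotient.mk i.1 l = b} (fun l => χ l) (i.2 b)) :
    blockEval k χ i (PiTensorProduct.tprod k y) =
      ∏ᶠ b, letterMap k Subtype.val (derEval k _ _ _ (y b)) := by
  let _ := Fintype.ofFinite (Quotient i.1)
  rw [finprod_eq_prod_of_fintype]
  refine (PiTensorProduct.lift.tprod _).trans ?_
  rw [MultilinearMap.compLinearMap_apply, MultilinearMap.mkPiAlgebra_apply]
  rfl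

theorem letterMap_letterMap {A B C : Type} (f : B → C) (g : A → B) (p : DPoly k A) :
    letterMap k f (letterMap k g p) = letterMap k (f ∘ g) p := by
  rw [letterMap, letterMap, MvPolynomial.rename_rename, letterMap]
  congr 2
  funext p
  exact Prod.ext rfl List.map_map

noncomputable def summandEval [Finite L] (χ : L → Fin 2) (c : Fin 2) (i : CPart (Fin 2) L) :
    Summand (presented (comRels k)) (presented (∅ : Set (Rel derSig k))) χ c i →ₗ[k] DPoly k L :=
  (TensorProduct.lid k (DPoly k L)).toLinearMap ∘ₗ
    TensorProduct.map (comCounit k (Quotient i.1) i.2 c) (blockEval k χ i)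

theorem summandEval_tmul [Finite L] (i : CPart (Fin 2) L)
    (x : (presented (comRels k)).obj (Quotient i.1) i.2 c) (y : BlockTensor k χ i) :
    summandEval k χ c i (x ⊗ₜ y) = comCounit k _ _ _ x • blockEval k χ i y := by
  rw [summandEval, LinearMap.comp_apply, TensorProduct.map_tmul]
  exact TensorProduct.lid_tmul _ _

theorem summandEval_map [Finite L] [Finite L'] (e : L ≃ L') (h : ∀ l, χ' (e l) = χ l)
    (hc : c = c') (i : CPart (Fin 2) L) (i' : CPart (Fin 2) L') (q : Quotient i.1 ≃ Quotient i'.1)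
    (hq : ∀ l, q (Quotient.mk i.1 l) = Quotient.mk i'.1 (e l)) (hi : ∀ b, i'.2 (q b) = i.2 b)
    (x : Summand (presented (comRels k)) (presented (∅ : Set (Rel derSig k))) χ c i) :
    summandEval k χ' c' i' (summandMap e h hc i i' q hq hi x) =
      letterMap k e (summandEval k χ c i x) := by
  induction x using TensorProduct.induction_on with
  | zero => simp only [map_zero]
  | add x y hx hy => simp only [map_add, hx, hy]
  | tmul p y =>
    rw [summandMap, TensorProduct.map_tmul, summandEval_tmul, summandEval_tmul, comCounit_map,
      map_smul]
    congr 1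
    induction y using PiTensorProduct.induction_on with
    | add x y hx hy => simp only [map_add, hx, hy]
    | smul_tprod r y =>
      simp only [map_smul, LinearMap.comp_apply, LinearEquiv.coe_coe,
        PiTensorProduct.reindex_tprod, PiTensorProduct.map_tprod]
      rw [blockEval_tprod, blockEval_tprod, map_finprod _ (Set.toFinite _)]
      congr 1
      refine (finprod_congr fun b => ?_).trans (finprod_comp_equiv q.symm)
      refine (congrArg (letterMap k Subtype.val)
        (derEval_map k (fibreEquiv e q hq b) (fun l => h l) _ _)).trans ?_
      rw [letterMap_letterMap, letterMap_letterMap]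
      rfl

open Classical in
noncomputable def compEval [Finite L] (χ : L → Fin 2) (c : Fin 2) :
    ((presented (comRels k)).comp (presented (∅ : Set (Rel derSig k)))).obj L χ c →ₗ[k] DPoly k L :=
  DirectSum.toModule k (CPart (Fin 2) L) (DPoly k L) (summandEval k χ c)

open Classical in
theorem compEval_lof [Finite L] (i : CPart (Fin 2) L)
    (x : Summand (presented (comRels k)) (presented (∅ : Set (Rel derSig k))) χ c i) :
    compEval k χ c (DirectSum.lof k (CPart (Fin 2) L) (Summand _ _ χ c) i x) =
      summandEval k χ c i x :=
  DirectSum.toModule_lof k i x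

theorem compEval_map [Finite L] [Finite L'] (e : L ≃ L') (h : ∀ l, χ' (e l) = χ l) (hc : c = c')
    (x : ((presented (comRels k)).comp (presented (∅ : Set (Rel derSig k)))).obj L χ c) :
    compEval k χ' c' (((presented (comRels k)).comp (presented _)).map e h hc x) =
      letterMap k e (compEval k χ c x) := by
  classical
  induction x using DirectSum.induction_on with
  | zero => exact (congrArg _ (map_zero _)).trans ((map_zero _).trans
      ((congrArg (letterMap k e) (map_zero (compEval k χ c))).trans (map_zero _)).symm)
  | add x y hx hy =>
    exact (congrArg _ (map_add _ _ _)).trans ((map_add _ _ _).trans ((congrArg₂ _ hx hy).trans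
      ((congrArg (letterMap k e) (map_add (compEval k χ c) x y)).trans (map_add _ _ _)).symm))
  | of i x =>
    refine (congrArg _ (compMap_lof _ _ e h hc i (i.transport e) (i.blockEquiv e)
      (i.blockEquiv_mk e) (i.transport_snd e) x)).trans ?_
    refine (compEval_lof k _ _).trans ((summandEval_map k e h hc _ _ _ _ _ x).trans ?_)
    exact congrArg (letterMap k e) (compEval_lof k i x).symm

/-- The monomials of `Com ∘ F(d)`. -/
abbrev CompMon (χ : L → Fin 2) (c : Fin 2) : Type :=
  Σ i : CPart (Fin 2) L, Mon comSig i.2 c × BlockMon χ i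

noncomputable def summandOp (i : CPart (Fin 2) L) (j : Mon comSig i.2 c × BlockMon χ i) :
    Summand (presented (comRels k)) (presented (∅ : Set (Rel derSig k))) χ c i :=
  op (comRels k) j.1 ⊗ₜ PiTensorProduct.tprod k fun b => op ∅ (j.2 b)

theorem span_range_summandOp [Finite L] (i : CPart (Fin 2) L) :
    Submodule.span k (Set.range (summandOp k (χ := χ) (c := c) i)) = ⊤ :=
  span_range_tmul _ (span_range_op _ _ _)
    (fun t : BlockMon χ i => PiTensorProduct.tprod k fun b => op (∅ : Set (Rel derSig k)) (t b))
    (span_range_tprod (fun _ t => op (∅ : Set (Rel derSig k)) t) fun _ => span_range_op _ _ _)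

open Classical in
noncomputable def CompMon.op (j : CompMon χ c) :
    ((presented (comRels k)).comp (presented (∅ : Set (Rel derSig k)))).obj L χ c :=
  DirectSum.lof k (CPart (Fin 2) L) (Summand (presented _) (presented _) χ c) j.1
    (summandOp k j.1 j.2)

theorem span_range_compOp [Finite L] (χ : L → Fin 2) (c : Fin 2) :
    Submodule.span k (Set.range (CompMon.op k (χ := χ) (c := c))) = ⊤ := by
  classical
  exact span_range_lof (summandOp k (χ := χ) (c := c)) fun i => span_range_summandOp k i

theorem compEval_op [Finite L] (j : CompMon χ c) :
    compEval k χ c (j.op k) = mono k j.2.2.words := by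
  classical
  let _ := Fintype.ofFinite (Quotient j.1.1)
  refine (compEval_lof k _ _).trans ?_
  rw [summandOp, summandEval_tmul, comCounit_op, one_smul, blockEval_tprod, finprod_eq_prod_of_fintype, mono,
    BlockMon.words, Multiset.map_map]
  refine Finset.prod_congr rfl fun b _ => ?_
  rw [derEval_op, letterMap, MvPolynomial.rename_X]
  rfl

/-- The words determine the partition through their letters, the colouring through the elements to
which they are applied, and the monomial of F(d) on each block. The monomial of `Com` is not
determined, but all choices represent the same operation. -/
theorem CompMon.op_eq [Finite L] {j j' : CompMon χ c} (h : j.2.2.words = j'.2.2.words) :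
    j.op k = j'.op k := by
  obtain ⟨⟨r, f⟩, T, t⟩ := j
  obtain ⟨⟨r', f'⟩, T', t'⟩ := j'
  change t.words = t'.words at h
  obtain rfl : r = r' := by
    ext a b
    exact (t.rel_iff a b).trans ((by rw [h] : _ ↔ _).trans (t'.rel_iff a b).symm)
  have hw : ∀ b, t.word b = t'.word b := by
    intro b
    induction b using Quotient.inductionOn with
    | h l =>
      have := t.word_mem (Quotient.mk r l)
      rw [h] at this
      obtain ⟨b', hb'⟩ := t'.mem_words.1 this
      have hl : l ∈ lettersOf (t.word (Quotient.mk r l)) := t.mem_lettersOf.2 rfl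
      rw [← hb', t'.mem_lettersOf] at hl
      rw [← hb', ← hl]
  obtain rfl : f = f' := by
    funext b
    exact (t.colour_word b).symm.trans ((congrArg (fun p => χ p.1) (hw b)).trans (t'.colour_word b))
  obtain rfl : t = t' := by
    funext b
    refine Mon.ext (map_injective Subtype.val_injective ?_)
    exact (t.map_tree b).trans ((congrArg (fun p => derChain p.1 p.2) (hw b)).trans (t'.map_tree b).symm)
  have hT : ColOp.op (comRels k) T = ColOp.op (comRels k) T' := (com_eqv T T').op_eq
  rw [CompMon.op, CompMon.op, summandOp, summandOp, hT]

theorem compEval_injective [Finite L] (χ : L → Fin 2) (c : Fin 2) :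
    Function.Injective (compEval k χ c) :=
  injective_of_span _ (span_range_compOp k χ c) _ (fun j => j.2.2.words) _
    (linearIndependent_mono k) (compEval_op k) fun _ _ => CompMon.op_eq k

theorem range_compEval [Finite L] (χ : L → Fin 2) (c : Fin 2) :
    LinearMap.range (compEval k χ c) = Submodule.span k (mono k '' {S | IsFactorSet χ c S}) := by
  refine range_of_span _ (span_range_compOp k χ c) _ _ ?_ ?_
  · intro j
    exact ⟨_, j.2.2.isFactorSet_words j.2.1, (compEval_op k j).symm⟩
  · rintro _ ⟨S, hS, rfl⟩
    obtain ⟨i, T, t, rfl⟩ := hS.exists_blockMon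
    exact ⟨_, compEval_op k ⟨i, T, t⟩⟩

/-- Each operation corresponds to the one with the same value in `DPoly`. Both values commute with
relabelling, and injectivity of `compEval` turns this into naturality. -/
noncomputable def dcomIso : (DCom k).Iso ((Com k).comp (FreeD k)) where
  equiv L _ χ c := (LinearEquiv.ofInjective _ (dcomEval_injective k χ c)).trans
    ((LinearEquiv.ofEq _ _ ((range_dcomEval k χ c).trans (range_compEval k χ c).symm)).trans
      (LinearEquiv.ofInjective _ (compEval_injective k χ c)).symm)
  naturality {L L' _ _ χ χ' c c'} e h hc x := by
    have key : ∀ (L : Type) [Finite L] (χ : L → Fin 2) (c : Fin 2)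
        (x : (presented (dcomRels k)).obj L χ c),
        compEval k χ c (((LinearEquiv.ofInjective _ (dcomEval_injective k χ c)).trans
          ((LinearEquiv.ofEq _ _ ((range_dcomEval k χ c).trans (range_compEval k χ c).symm)).trans
            (LinearEquiv.ofInjective _ (compEval_injective k χ c)).symm)) x) =
          dcomEval k L χ c x := by
      intro L _ χ c x
      exact congrArg Subtype.val ((LinearEquiv.ofInjective _
        (compEval_injective k χ c)).apply_symm_apply _)
    refine compEval_injective k χ' c' ?_
    refine (key L' χ' c' _).trans ((dcomEval_map k e h hc x).trans ?_)
    exact (congrArg (letterMap k e) (key L χ c x).symm).trans (compEval_map k e h hc _).symm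

end Composition

/-! ### Dimensions -/

section Dimension

variable (k : Type u) [Field k]

instance finite_obj {L : Type} [Finite L] (χ : L → Fin 2) (c : Fin 2) :
    Module.Finite k ((DCom k).obj L χ c) :=
  Module.Finite.of_surjective (presentedMk (dcomRels k) χ c) (presentedMk_surjective _ _ _)

theorem finrank_dcom {L : Type} [Finite L] (χ : L → Fin 2) (c : Fin 2) :
    Module.finrank k ((DCom k).obj L χ c) = Nat.card {S // IsFactorSet χ c S} := by
  have h1 : Module.finrank k ((DCom k).obj L χ c) =
      Module.finrank k (LinearMap.range (dcomEval k L χ c)) :=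
    (LinearEquiv.ofInjective _ (dcomEval_injective k χ c)).finrank_eq
  have h2 := (linearIndependent_mono k).comp _
    (Subtype.val_injective (p := fun S : Multiset (L × List L) => IsFactorSet χ c S))
  have h3 : Set.range (mono k ∘ (Subtype.val : {S // IsFactorSet χ c S} → _)) =
      mono k '' {S | IsFactorSet χ c S} := by
    rw [Set.range_comp, Subtype.range_coe_subtype]
  rw [h1, range_dcomEval, ← h3]
  exact Module.finrank_eq_nat_card_basis (Module.Basis.span h2)

/-! ### Counting the factor sets -/

variable {L : Type} {χ : L → Fin 2}

theorem isFactorSet_one_iff {S : Multiset (L × List L)} :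
    IsFactorSet χ 1 S ↔ ∃ l, S = {(l, [])} ∧ χ l = 1 ∧ ∀ l', l' = l := by
  constructor
  · intro h
    rcases h.colour with h0 | ⟨-, l, rfl, hl⟩
    · exact absurd h0.1 (by decide)
    · refine ⟨l, rfl, hl, fun l' => ?_⟩
      obtain ⟨p, hp, hl'⟩ := h.cover l'
      rw [Multiset.mem_singleton] at hp
      subst hp
      simpa using hl'
  · rintro ⟨l, rfl, hl, h⟩
    refine ⟨Multiset.nodup_singleton _, ?_, ?_, ?_, Or.inr ⟨rfl, l, rfl, hl⟩⟩
    · intro p hp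
      rw [Multiset.mem_singleton.1 hp]
      simp
    · intro p hp p' hp' _ _ _
      rw [Multiset.mem_singleton.1 hp, Multiset.mem_singleton.1 hp']
    · intro l'
      exact ⟨_, Multiset.mem_singleton_self _, by simp [h l']⟩

theorem card_isFactorSet_one : Nat.card {S // IsFactorSet χ 1 S} =
    Nat.card {l // χ l = 1 ∧ ∀ l', l' = l} := by
  symm
  refine Nat.card_congr (Equiv.ofBijective
    (fun l => ⟨{(l.1, [])}, isFactorSet_one_iff.2 ⟨l.1, rfl, l.2⟩⟩) ⟨?_, ?_⟩)
  · intro l l' h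
    exact Subtype.ext (l'.2.2 l.1)
  · rintro ⟨S, hS⟩
    obtain ⟨l, rfl, hl⟩ := isFactorSet_one_iff.1 hS
    exact ⟨⟨l, hl⟩, rfl⟩

/-- Distributions of the letters of colour `1` to words, one word for each letter of
colour `0`: the lengths of the words and the places of the letters in them. -/
abbrev WordData (χ : L → Fin 2) : Type :=
  Σ f : {l // χ l = 0} → ℕ, (Σ x, Fin (f x)) ≃ {l // χ l = 1}

def WordData.factor (D : WordData χ) (x : {l // χ l = 0}) : L × List L :=
  (x, List.ofFn fun i => (D.2 ⟨x, i⟩ : L))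

namespace WordData

theorem factor_injective (D : WordData χ) : Function.Injective D.factor := fun _ _ h =>
  Subtype.ext (congrArg Prod.fst h :)

theorem mem_lettersOf (D : WordData χ) {x : {l // χ l = 0}} {l : L} :
    l ∈ lettersOf (D.factor x) ↔ l = x ∨ ∃ i, (D.2 ⟨x, i⟩ : L) = l := by
  rw [List.mem_cons, factor, List.mem_ofFn']
  rfl

theorem ne (x : {l // χ l = 0}) (y : {l // χ l = 1}) : x.1 ≠ y.1 := fun h =>
  absurd (x.2.symm.trans ((congrArg χ h).trans y.2)) (by decide)

variable [Finite L]

noncomputable def factors (D : WordData χ) : Multiset (L × List L) :=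
  letI := Fintype.ofFinite {l // χ l = 0}
  Finset.univ.val.map D.factor

theorem mem_factors (D : WordData χ) {p : L × List L} : p ∈ D.factors ↔ ∃ x, D.factor x = p := by
  simp [factors]

theorem nodup_factors (D : WordData χ) : D.factors.Nodup := by
  let _ := Fintype.ofFinite {l // χ l = 0}
  exact (Multiset.nodup_map_iff_of_injective D.factor_injective).2 Finset.univ.nodup

theorem isFactorSet (D : WordData χ) [h : Nonempty {l // χ l = 0}] :
    IsFactorSet χ 0 D.factors := by
  refine ⟨D.nodup_factors, ?_, ?_, ?_, Or.inl ⟨rfl, ?_, ?_⟩⟩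
  · intro p hp
    obtain ⟨x, rfl⟩ := D.mem_factors.1 hp
    refine List.nodup_cons.2 ⟨?_, List.nodup_ofFn.2 fun i j h => ?_⟩
    · rw [factor, List.mem_ofFn']
      rintro ⟨i, hi⟩
      exact ne x _ hi.symm
    · have := D.2.injective (Subtype.ext h)
      simpa using this
  · intro p hp p' hp' l hl hl'
    obtain ⟨x, rfl⟩ := D.mem_factors.1 hp
    obtain ⟨x', rfl⟩ := D.mem_factors.1 hp'
    rw [D.mem_lettersOf] at hl hl'
    congr 1
    rcases hl with rfl | ⟨i, rfl⟩ <;> rcases hl' with h | ⟨j, h⟩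
    · exact Subtype.ext h
    · exact absurd h.symm (ne _ _)
    · exact absurd h.symm (ne _ _)
    · exact (congrArg Sigma.fst (D.2.injective (Subtype.ext h))).symm
  · intro l
    obtain h | h : χ l = 0 ∨ χ l = 1 := by omega
    · exact ⟨_, D.mem_factors.2 ⟨⟨l, h⟩, rfl⟩, D.mem_lettersOf.2 (Or.inl rfl)⟩
    · obtain ⟨⟨x, i⟩, hx⟩ := D.2.surjective ⟨l, h⟩
      exact ⟨_, D.mem_factors.2 ⟨x, rfl⟩, D.mem_lettersOf.2 (Or.inr ⟨i, congrArg Subtype.val hx⟩)⟩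
  · intro h0
    have := D.mem_factors.2 ⟨h.some, rfl⟩
    rw [h0] at this
    exact Multiset.notMem_zero _ this
  · intro p hp
    obtain ⟨x, rfl⟩ := D.mem_factors.1 hp
    refine ⟨x.2, fun δ hδ => ?_⟩
    rw [factor, List.mem_ofFn'] at hδ
    obtain ⟨i, rfl⟩ := hδ
    exact (D.2 ⟨x, i⟩).2

theorem factors_injective : Function.Injective (factors (χ := χ)) := by
  intro D D' h
  have key : ∀ x, D.factor x = D'.factor x := by
    intro x
    have hx := D.mem_factors.2 ⟨x, rfl⟩
    rw [h] at hx
    obtain ⟨x', hx'⟩ := D'.mem_factors.1 hx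
    obtain rfl : x' = x := Subtype.ext (congrArg Prod.fst hx' :)
    exact hx'.symm
  obtain ⟨f, e⟩ := D
  obtain ⟨f', e'⟩ := D'
  obtain rfl : f = f' := by
    funext x
    simpa [factor] using congrArg (fun p => p.2.length) (key x)
  congr 1
  ext ⟨x, i⟩
  exact congrFun (List.ofFn_injective (congrArg Prod.snd (key x) :)) i

theorem exists_eq {S : Multiset (L × List L)} (h : IsFactorSet χ 0 S) :
    ∃ D : WordData χ, D.factors = S := by
  have hcol : ∀ p ∈ S, χ p.1 = 0 ∧ ∀ δ ∈ p.2, χ δ = 1 := by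
    rcases h.colour with ⟨-, -, h⟩ | h
    · exact h
    · exact absurd h.1 (by decide)
  -- A letter of colour 0 cannot occur in the word of a factor, so it is the element to which some
  -- factor's word is applied; this factor is called `P x` below.
  have hP : ∀ x : {l // χ l = 0}, ∃ p ∈ S, p.1 = x := by
    intro x
    obtain ⟨p, hp, hx⟩ := h.cover x
    refine ⟨p, hp, ?_⟩
    rcases List.mem_cons.1 hx with hx | hx
    · exact hx.symm
    · exact absurd (x.2.symm.trans ((hcol p hp).2 _ hx)) (by decide)
  choose P hPS hP1 using hP
  have hPeq : ∀ p (hp : p ∈ S), P ⟨p.1, (hcol p hp).1⟩ = p := by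
    intro p hp
    refine h.eq_of_mem _ (hPS _) _ hp p.1 ?_ List.mem_cons_self
    exact List.mem_cons.2 (Or.inl (hP1 ⟨p.1, (hcol p hp).1⟩).symm)
  let f : {l // χ l = 0} → ℕ := fun x => (P x).2.length
  let e : (Σ x, Fin (f x)) → {l // χ l = 1} := fun y =>
    ⟨(P y.1).2.get y.2, (hcol _ (hPS _)).2 _ (List.get_mem _ _)⟩
  have he : Function.Bijective e := by
    constructor
    · rintro ⟨x, i⟩ ⟨x', i'⟩ hxx
      have hxx : (P x).2.get i = (P x').2.get i' := congrArg Subtype.val hxx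
      obtain rfl : x = x' := by
        refine Subtype.ext ((hP1 x).symm.trans ((congrArg Prod.fst ?_).trans (hP1 x')))
        refine h.eq_of_mem _ (hPS x) _ (hPS x') _ (List.mem_cons_of_mem _ (List.get_mem _ i)) ?_
        rw [hxx]
        exact List.mem_cons_of_mem _ (List.get_mem _ i')
      rw [(List.nodup_iff_injective_get.1 (List.nodup_cons.1 (h.nodup_letters _ (hPS x))).2) hxx]
    · rintro ⟨δ, hδ⟩
      obtain ⟨p, hp, hmem⟩ := h.cover δ
      rcases List.mem_cons.1 hmem with rfl | hmem
      · exact absurd ((hcol p hp).1.symm.trans hδ) (by decide)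
      · rw [← hPeq p hp] at hmem
        obtain ⟨i, hi⟩ := List.mem_iff_get.1 hmem
        exact ⟨⟨_, i⟩, Subtype.ext hi⟩
  let D : WordData χ := ⟨f, Equiv.ofBijective e he⟩
  have hD : ∀ x, D.factor x = P x := fun x => Prod.ext (hP1 x).symm (List.ofFn_get (P x).2)
  refine ⟨D, (Multiset.Nodup.ext D.nodup_factors h.nodup).2 fun p => ?_⟩
  rw [mem_factors]
  exact ⟨fun ⟨x, hx⟩ => hx ▸ hD x ▸ hPS x, fun hp => ⟨_, (hD _).trans (hPeq p hp)⟩⟩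

end WordData

/-- Let n be the number of letters of colour 1. The lengths of the words form a multiset of size n
on the letters of colour 0, counted by `multichoose`; for given lengths, the letters are placed by
one of n! bijections. -/
theorem card_wordData [Finite L] : Nat.card (WordData χ) =
    (Nat.card {l // χ l = 1}).factorial *
      (Nat.card {l // χ l = 0}).multichoose (Nat.card {l // χ l = 1}) := by
  classical
  let _ := Fintype.ofFinite {l // χ l = 0}
  let _ := Fintype.ofFinite {l // χ l = 1}
  let X := {f : {l // χ l = 0} → ℕ // ∑ x, f x = Nat.card {l // χ l = 1}}
  let e : (Σ f : X, ((Σ x, Fin (f.1 x)) ≃ {l // χ l = 1})) ≃ WordData χ :=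
    { toFun D := ⟨D.1.1, D.2⟩
      invFun D := ⟨⟨D.1, by rw [← Nat.card_congr D.2]; simp⟩, D.2⟩
      left_inv _ := rfl
      right_inv _ := rfl }
  let s : Sym {l // χ l = 0} (Nat.card {l // χ l = 1}) ≃ X := Sym.equivNatSumOfFintype _ _
  let _ : Fintype X := Fintype.ofEquiv _ s
  have hX : Fintype.card X =
      (Nat.card {l // χ l = 0}).multichoose (Nat.card {l // χ l = 1}) := by
    rw [← Fintype.card_congr s, Sym.card_sym_eq_multichoose,
      Nat.card_eq_fintype_card (α := {l // χ l = 0})]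
  have hE : ∀ f : X, Nat.card ((Σ x, Fin (f.1 x)) ≃ {l // χ l = 1}) =
      (Nat.card {l // χ l = 1}).factorial := by
    intro f
    have hcard : Fintype.card (Σ x, Fin (f.1 x)) = Fintype.card {l // χ l = 1} := by
      rw [← Nat.card_eq_fintype_card (α := {l // χ l = 1}), Fintype.card_sigma]
      simpa only [Fintype.card_fin] using f.2
    rw [Nat.card_eq_fintype_card, Fintype.card_equiv (Fintype.equivOfCardEq hcard), hcard,
      Nat.card_eq_fintype_card]
  rw [← Nat.card_congr e, Nat.card_sigma, Finset.sum_congr rfl fun f _ => hE f, Finset.sum_const,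
    Finset.card_univ, hX, smul_eq_mul, mul_comm]

/-- Without letters of colour 0 a factor set would have to be empty, which is excluded, whereas
`multichoose 0 0 = 1` would count it; hence the case distinction. -/
theorem card_isFactorSet_zero [Finite L] : Nat.card {S // IsFactorSet χ 0 S} =
    if Nat.card {l // χ l = 0} = 0 then 0 else (Nat.card {l // χ l = 1}).factorial *
      (Nat.card {l // χ l = 0}).multichoose (Nat.card {l // χ l = 1}) := by
  split_ifs with h0
  · have hE : IsEmpty {l // χ l = 0} := Finite.card_eq_zero_iff.1 h0
    have : IsEmpty {S // IsFactorSet χ 0 S} := by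
      refine ⟨fun ⟨S, hS⟩ => ?_⟩
      obtain ⟨p, hp⟩ := Multiset.exists_mem_of_ne_zero hS.ne_zero
      rcases hS.colour with ⟨-, -, h⟩ | h
      · exact hE.false ⟨_, (h p hp).1⟩
      · exact absurd h.1 (by decide)
    exact Nat.card_of_isEmpty
  · have : Nonempty {l // χ l = 0} := by
      by_contra hne
      have := not_nonempty_iff.1 hne
      exact h0 Nat.card_of_isEmpty
    rw [← card_wordData]
    symm
    refine Nat.card_congr (Equiv.ofBijective (fun D => ⟨D.factors, D.isFactorSet⟩) ⟨?_, ?_⟩)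
    · exact fun D D' h => WordData.factors_injective (congrArg Subtype.val h)
    · rintro ⟨S, hS⟩
      obtain ⟨D, rfl⟩ := WordData.exists_eq hS
      exact ⟨D, rfl⟩

end Dimension

/-! ### Generating series -/

section Series

theorem card_fibre (m : Fin 2 → ℕ) (i : Fin 2) :
    Nat.card {l : Σ i : Fin 2, Fin (m i) // l.1 = i} = m i := by
  rw [Nat.card_congr (Equiv.sigmaSubtype i), Nat.card_fin]

variable (k : Type u) [Field k]

theorem coeff_genSeries (c : Fin 2) (m : Fin 2 →₀ ℕ) :
    MvPowerSeries.coeff m ((DCom k).genSeries c) =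
      (Nat.card {S // IsFactorSet (Sigma.fst : (Σ i : Fin 2, Fin (m i)) → Fin 2) c S} : ℚ) /
        ((m 0).factorial * (m 1).factorial) := by
  rw [← finrank_dcom k, ← Fin.prod_univ_two (fun i => ((m i).factorial : ℚ))]
  rfl

open MvPowerSeries in
theorem genSeries_one : (DCom k).genSeries 1 = X 1 := by
  classical
  ext m
  rw [coeff_genSeries, card_isFactorSet_one, coeff_X]
  split_ifs with h
  · subst h
    have : Nat.card {l : Σ i : Fin 2, Fin (Finsupp.single (1 : Fin 2) 1 i) //
        l.1 = 1 ∧ ∀ l', l' = l} = 1 := by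
      refine Nat.card_eq_one_iff_unique.2 ⟨⟨fun a b => Subtype.ext (b.2.2 _)⟩,
        ⟨⟨⟨1, ⟨0, by simp⟩⟩, rfl, ?_⟩⟩⟩
      rintro ⟨i, j, hj⟩
      obtain rfl | rfl : i = 0 ∨ i = 1 := by omega
      · simp at hj
      · congr 1
        simp at hj
        exact Fin.ext hj
    rw [this]
    simp
  · have : IsEmpty {l : Σ i : Fin 2, Fin (m i) // l.1 = 1 ∧ ∀ l', l' = l} := by
      refine ⟨fun ⟨l, hl, hu⟩ => h ?_⟩
      have h0 : m 0 = 0 := by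
        by_contra h0
        have := congrArg Sigma.fst (hu ⟨0, ⟨0, Nat.pos_of_ne_zero h0⟩⟩)
        exact zero_ne_one ((this : (0 : Fin 2) = l.1).trans hl)
      have h1 : m 1 = 1 := by
        rw [← card_fibre m 1]
        exact Nat.card_eq_one_iff_unique.2 ⟨⟨fun a b => Subtype.ext ((hu a).trans (hu b).symm)⟩,
          ⟨⟨l, hl⟩⟩⟩
      ext i
      obtain rfl | rfl : i = 0 ∨ i = 1 := by omega
      · simpa using h0
      · simpa using h1
    rw [Nat.card_of_isEmpty]
    simp

-- After multiplication by 1 - t₂ the induction step becomes the Pascal rule for `multichoose`, with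
-- no need to expand the geometric series.
open MvPowerSeries in
theorem coeff_pow_mul_inv (d : ℕ) (e : Fin 2 →₀ ℕ) :
    coeff e ((X 0 * (1 - X 1)⁻¹ : MvPowerSeries (Fin 2) ℚ) ^ d) =
      if e 0 = d then (d.multichoose (e 1) : ℚ) else 0 := by
  classical
  let P : ℕ → MvPowerSeries (Fin 2) ℚ := fun d e =>
    if e 0 = d then (d.multichoose (e 1) : ℚ) else 0
  have hP : ∀ d e, coeff e (P d) = if e 0 = d then (d.multichoose (e 1) : ℚ) else 0 :=
    fun _ _ => rfl
  suffices h : (X 0 * (1 - X 1)⁻¹ : MvPowerSeries (Fin 2) ℚ) ^ d = P d by rw [h, hP]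
  have hc : constantCoeff (1 - X 1 : MvPowerSeries (Fin 2) ℚ) ≠ 0 := by simp
  induction d with
  | zero =>
    ext e
    rw [pow_zero, coeff_one, hP]
    have : e = 0 ↔ e 0 = 0 ∧ e 1 = 0 := by
      rw [Finsupp.ext_iff, Fin.forall_fin_two]; rfl
    simp only [this]
    rcases e 1 with _ | n <;> simp
  | succ d ih =>
    rw [pow_succ, ih, ← mul_assoc]
    symm
    rw [MvPowerSeries.eq_mul_inv_iff_mul_eq hc, mul_sub, mul_one]
    ext e
    rw [map_sub, X_def, X_def, coeff_mul_monomial, coeff_mul_monomial, hP, hP, hP]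
    simp only [Finsupp.single_le_iff, Finsupp.coe_tsub, Pi.sub_apply, Finsupp.single_apply, mul_one]
    rcases h0 : e 0 with _ | a <;> rcases h1 : e 1 with _ | b
    · simp
    · simp
    · simp
    · by_cases had : a = d
      · subst had
        simp [Nat.multichoose_succ_succ]
      · simp [had]

-- In a given degree only the power `d = m 0` of the substituted series contributes, and the
-- factorial of `m 1` cancels. Subtracting 1 removes the constant term, as there is no operation
-- without inputs.
open MvPowerSeries in
theorem genSeries_zero : (DCom k).genSeries 0 =
    (PowerSeries.exp ℚ).subst (X 0 * (1 - X 1)⁻¹ : MvPowerSeries (Fin 2) ℚ) - 1 := by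
  classical
  ext m
  have hs : PowerSeries.HasSubst (X 0 * (1 - X 1)⁻¹ : MvPowerSeries (Fin 2) ℚ) :=
    PowerSeries.HasSubst.of_constantCoeff_zero (by simp)
  rw [coeff_genSeries, card_isFactorSet_zero, card_fibre, card_fibre, map_sub,
    PowerSeries.coeff_subst hs, finsum_eq_single _ (m 0), coeff_pow_mul_inv, if_pos rfl,
    PowerSeries.coeff_exp, coeff_one]
  · have hm : m = 0 ↔ m 0 = 0 ∧ m 1 = 0 := by
      rw [Finsupp.ext_iff, Fin.forall_fin_two]; rfl
    simp only [hm]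
    have hf : ((m 1).factorial : ℚ) ≠ 0 := Nat.cast_ne_zero.2 (Nat.factorial_ne_zero _)
    have hf' : ((m 0).factorial : ℚ) ≠ 0 := Nat.cast_ne_zero.2 (Nat.factorial_ne_zero _)
    by_cases h0 : m 0 = 0
    · rw [h0]
      rcases m 1 with _ | n <;> simp
    · simp only [h0, false_and, if_false]
      push_cast
      simp
      field_simp
  · intro d hd
    rw [coeff_pow_mul_inv, if_neg hd.symm, smul_zero]

end Series

end ColOp

theorem mainTheorem10 (k : Type*) [Field k] :
    (∀ (L : Type) [LinearOrder L] [Finite L] (χ : L → Fin 2) (c : Fin 2),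
      Function.Surjective (ColOp.shToDCom k χ c)) ∧
    ColOp.QMAdmissible ∧
    (∃ G : Set (ColOp.ShRel ColOp.shSig k), (∀ g ∈ G, g.IsQuadratic) ∧
      ∀ ord : ColOp.MonOrder ColOp.shSig, ColOp.ExtendsQM ord →
        ColOp.IsGroebnerBasis ord (ColOp.dcomShIdeal k) G) ∧
    Nonempty ((ColOp.DCom k).Iso ((ColOp.Com k).comp (ColOp.FreeD k))) ∧
    (∀ (L : Type) [Finite L] (χ : L → Fin 2) (c : Fin 2),
      Module.Finite k ((ColOp.DCom k).obj L χ c)) ∧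
    (ColOp.DCom k).genSeries 0 =
      (PowerSeries.exp ℚ).subst
        ((MvPowerSeries.X 0 * (1 - MvPowerSeries.X 1)⁻¹ : MvPowerSeries (Fin 2) ℚ)) - 1 ∧
    (ColOp.DCom k).genSeries 1 = MvPowerSeries.X 1 := by
  refine ⟨fun L _ _ χ c => ColOp.shToDCom_surjective k χ c, ColOp.qmAdmissible,
    ⟨ColOp.qmBasis k, ?_, fun ord ho => ColOp.isGroebnerBasis_qmBasis k ho⟩, ⟨ColOp.dcomIso k⟩,
    fun L _ χ c => ColOp.finite_obj k χ c, ColOp.genSeries_zero k, ColOp.genSeries_one k⟩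
  rintro _ ⟨r, rfl⟩
  exact ColOp.Rule.isQuadratic_rel k r
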